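/- **Setting.** Let $q\in(0,1)$, $\alpha\in(0,\infty)$ and $n\ge 1$. Let $\mathcal S$ be the set of height functions $\vec s=(s_x)_{x\in\mathbb Z}$ with $s_x\in\mathbb Z$ and $|s_{x+1}-s_x|=1$ for all $x$. *Dynamic ASEP* is the continuous-time Markov process $\vec s(t)$ on $\mathcal S$ (with right-continuous paths having left limits, characterized by the martingale problem for its generator on bounded local functions) in which, for each $x\in\mathbb Z$ independently, provided that the jump does not leave $\mathcal S$, $$s_x\mapsto s_x-2 \ \text{ at rate }\ \frac{q(1+\alpha q^{-s_x})}{1+\alpha q^{-s_x+1}},\qquad s_x\mapsto s_x+2\ \text{ at rate }\ \frac{1+\alpha q^{-s_x}}{1+\alpha q^{-s_x-1}}.$$ Let $\mathcal X^n=\{\vec x\in\mathbb Z^n: x_1>\dots>x_n\}$, and let $L^n_{1,q}$ be the generator of the $n$-particle ASEP on $\mathcal X^n$ in which each particle jumps by $-1$ at rate $1$ and by $+1$ at rate $q$, jumps to occupied sites being suppressed. Put $(a;q)_n=\prod_{k=0}^{n-1}(1-aq^k)$ and $$Z(\vec x;\vec s)=\prod_{k=1}^n\Big(q^{-x_k}-\alpha^{-1}q^{2(k-1)}-q^{k-1}\big(q^{\frac{-s_{x_k}-x_k}{2}}-\alpha^{-1}q^{\frac{s_{x_k}-x_k}{2}}\big)\Big).$$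 *Step initial data* is $s_x(0)=|x|$ for all $x$. *Half-stationary initial data* is the random height function with $s_x(0)=x$ for $x\ge 1$ and such that $s_1(0)=1,s_0(0),s_{-1}(0),\dots$ is a Markov chain with, for each $x\le 1$, $$s_{x-1}=s_x+1\ \text{ with probability } \frac{q^{s_x}}{\alpha+q^{s_x}},\qquad s_{x-1}=s_x-1\ \text{ with probability } \frac{\alpha}{\alpha+q^{s_x}}.$$ **Statement.** For both initial data, $Z(\vec x;\vec s(t))$ is integrable for all $t\ge0$ and $\vec x\in\mathcal X^n$, and the following hold. (1) For step initial data, the function $$E_{\rm step}(t;\vec x):=\frac{1}{(-\alpha^{-1};q)_n}\,\mathbb E\big[Z(\vec x;\vec s(t))\big],\qquad t\ge0,\ \vec x\in\mathcal X^n,$$ solves the system $$\frac{d}{dt}E_{\rm step}(t;\vec x)=L^n_{1,q}E_{\rm step}(t;\vec x),\qquad E_{\rm step}(0;\vec x)=\prod_{k=1}^n\big(q^{-x_k\mathbf 1_{x_k\le0}}-q^{k-1}\big)$$ (with a one-sided derivative at $t=0$). The integral $$\frac{q^{n(n-1)/2}}{(2\pi \mathrm i)^n}\oint\cdots\oint\prod_{1\le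 i<j\le n}\frac{y_i-y_j}{y_i-qy_j}\prod_{i=1}^n\left(\Big(\frac{1-y_i}{1-qy_i}\Big)^{x_i}\exp\Big\{\frac{(1-q)^2y_i}{(1-y_i)(1-qy_i)}\,t\Big\}\right)\frac{dy_i}{y_i},$$ in which every $y_i$ runs once, positively oriented, over one and the same circle around $1$ of arbitrary radius $\rho$ with $0<\rho<\frac{1-q}{1+q}$, solves the same system with the same initial data, and it is equal to $E_{\rm step}(t;\vec x)$ for all $t\ge0$ and $\vec x\in\mathcal X^n$. (2) For half-stationary initial data, the function $$E_{\rm half}(t;\vec x):=\frac{\alpha^n}{q^{n(n-1)/2}}\,\mathbb E\big[Z(\vec x;\vec s(t))\big],\qquad t\ge0,\ \vec x\in\mathcal X^n,$$ solves the system $$\frac{d}{dt}E_{\rm half}(t;\vec x)=L^n_{1,q}E_{\rm half}(t;\vec x),\qquad E_{\rm half}(0;\vec x)=\prod_{k=1}^n\big(q^{(1-x_k)\mathbf 1_{x_k\le1}}-q^{k-1}\big).$$ (3) With $\vec 1=(1,\dots,1)$, $E_{\rm half}(0;\vec x)=E_{\rm step}(0;\vec x-\vec 1)$, and $E_{\rm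 half}(t;\vec x)=E_{\rm step}(t;\vec x-\vec 1)$ for all $t\ge0$ and $\vec x\in\mathcal X^n$. -/

import Mathlib

open MeasureTheory Filter Topology
open scoped NNReal

noncomputable section

namespace DynASEP

/-! ### Height functions and the dynamic ASEP -/

/-- The state space: integer valued height functions on `ℤ` with slopes `±1`.
It carries the product (cylinder) σ-algebra. -/
abbrev Height : Type := {s : ℤ → ℤ // ∀ x : ℤ, |s (x + 1) - s x| = 1}

/-- Rate of the jump `s_x ↦ s_x - 2` when `s_x = h`. -/
def downRate (q α : ℝ) (h : ℤ) : ℝ :=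
  q * (1 + α * q ^ (-h)) / (1 + α * q ^ (-h + 1))

/-- Rate of the jump `s_x ↦ s_x + 2` when `s_x = h`. -/
def upRate (q α : ℝ) (h : ℤ) : ℝ :=
  (1 + α * q ^ (-h)) / (1 + α * q ^ (-h - 1))

open Classical in
/-- The increment `f(s') - f(s)`, where `s'` is `s` with `s_x` replaced by `s_x + d`; it is `0`
if this replacement leaves the state space (the jump is then suppressed). -/
def jumpDiff (f : Height → ℝ) (s : Height) (x d : ℤ) : ℝ :=
  if h : ∀ y : ℤ, |Function.update s.1 x (s.1 x + d) (y + 1)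
      - Function.update s.1 x (s.1 x + d) y| = 1
  then f ⟨Function.update s.1 x (s.1 x + d), h⟩ - f s
  else 0

/-- `f` is local: it depends on the heights at finitely many sites only. -/
def IsLocal (f : Height → ℝ) : Prop :=
  ∃ A : Finset ℤ, ∀ s s' : Height, (∀ x ∈ A, s.1 x = s'.1 x) → f s = f s'

/-- The generator of the dynamic ASEP, acting on local functions (only finitely many terms of the
sum are then non-zero). -/
def dynGen (q α : ℝ) (f : Height → ℝ) (s : Height) : ℝ :=
  ∑ᶠ x : ℤ, (downRate q α (s.1 x) * jumpDiff f s x (-2) + upRate q α (s.1 x) * jumpDiff f s x 2)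

/-- `(s(t))_{t ≥ 0}` is a dynamic ASEP with parameters `q, α` (no condition on the initial state):
an adapted process with right-continuous paths that have left limits (`ℤ` being discrete, every
height is locally constant to the right of each time and constant just before it), which solves the
martingale problem of the generator `dynGen q α` on bounded local functions. -/
structure IsDynamicASEP {Ω : Type*} [MeasurableSpace Ω] (q α : ℝ) (P : Measure Ω)
    (ℱ : Filtration ℝ≥0 (inferInstance : MeasurableSpace Ω)) (s : ℝ≥0 → Ω → Height) : Prop where
  adapted : ∀ t : ℝ≥0, Measurable[ℱ t] (s t)
  right_cont : ∀ (ω : Ω) (x : ℤ) (t : ℝ≥0), ∀ᶠ u in 𝓝[>] t, (s u ω).1 x = (s t ω).1 x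
  left_lim : ∀ (ω : Ω) (x : ℤ) (t : ℝ≥0), ∃ m : ℤ, ∀ᶠ u in 𝓝[<] t, (s u ω).1 x = m
  martingale : ∀ f : Height → ℝ, IsLocal f → (∃ C : ℝ, ∀ σ : Height, |f σ| ≤ C) →
    Martingale (fun (t : ℝ≥0) (ω : Ω) =>
      f (s t ω) - f (s 0 ω) - ∫ u in (0 : ℝ)..(t : ℝ), dynGen q α f (s u.toNNReal ω)) ℱ P

/-! ### Initial data -/

/-- Step initial data: almost surely `s_x = |x|` for all `x`. -/
def IsStepData {Ω : Type*} [MeasurableSpace Ω] (P : Measure Ω) (S : Ω → Height) : Prop :=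
  ∀ᵐ ω ∂P, ∀ x : ℤ, (S ω).1 x = |x|

/-- One-step transition probabilities, from `s_x = a` to `s_{x-1} = b`, of the Markov chain that
generates the half-stationary initial data. -/
def halfTrans (q α : ℝ) (a b : ℤ) : ℝ :=
  if b = a + 1 then q ^ a / (α + q ^ a)
  else if b = a - 1 then α / (α + q ^ a)
  else 0

/-- Half-stationary initial data: `s_x = x` for `x ≥ 1`, and `s_1 = 1, s_0, s_{-1}, …` is the Markov
chain with transition probabilities `halfTrans q α`, described by its path probabilities. -/
structure IsHalfStationaryData {Ω : Type*} [MeasurableSpace Ω] (q α : ℝ) (P : Measure Ω)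
    (S : Ω → Height) : Prop where
  right : ∀ᵐ ω ∂P, ∀ x : ℤ, 1 ≤ x → (S ω).1 x = x
  left : ∀ (m : ℕ) (a : ℕ → ℤ), a 0 = 1 →
    P.real {ω | ∀ k : ℕ, k ≤ m → (S ω).1 (1 - (k : ℤ)) = a k}
      = ∏ k ∈ Finset.range m, halfTrans q α (a k) (a (k + 1))

/-! ### The standard `n`-particle ASEP -/

/-- Ordered configurations `x_1 > ⋯ > x_n` of `n` particles (indexed from `0`). -/
abbrev Config (n : ℕ) : Type := {x : Fin n → ℤ // StrictAnti x}

open Classical in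
/-- The increment `f(x') - f(x)`, where `x'` is `x` with `x_i` replaced by `x_i + d`; it is `0` if
this jump (`d = ±1`) is blocked by another particle. -/
def moveDiff {n : ℕ} {V : Type*} [AddCommGroup V] (f : Config n → V) (x : Config n) (i : Fin n)
    (d : ℤ) : V :=
  if h : StrictAnti (Function.update x.1 i (x.1 i + d))
  then f ⟨Function.update x.1 i (x.1 i + d), h⟩ - f x
  else 0

/-- The generator of the `n`-particle ASEP with left jump rate `l` and right jump rate `r`. -/
def asepGen {n : ℕ} {V : Type*} [AddCommGroup V] [Module ℝ V] (l r : ℝ) (f : Config n → V)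
    (x : Config n) : V :=
  ∑ i : Fin n, (l • moveDiff f x i (-1) + r • moveDiff f x i 1)

/-- `u` solves, for `t ≥ 0`, the system `d/dt u(t;x) = (L u(t;·))(x)` with `L` the ASEP generator,
with initial data `g` (the derivative at `t = 0` is one-sided). -/
structure SolvesASEP {n : ℕ} {V : Type*} [NormedAddCommGroup V] [NormedSpace ℝ V] (l r : ℝ)
    (g : Config n → V) (u : ℝ → Config n → V) : Prop where
  init : ∀ x : Config n, u 0 x = g x
  ode : ∀ t : ℝ, 0 ≤ t → ∀ x : Config n,
    HasDerivWithinAt (fun τ : ℝ => u τ x) (asepGen l r (u t) x) (Set.Ici 0) t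

/-- The configuration `x - (1, …, 1)`. -/
def Config.shift {n : ℕ} (x : Config n) : Config n :=
  ⟨fun i => x.1 i - 1, fun _ _ h => sub_lt_sub_right (x.2 h) 1⟩

/-! ### The duality function and its normalized expectations -/

/-- The duality function `Z_{n;q,α}(x;s)`; the particle with index `k : Fin n` is the `(k+1)`-st. -/
def dualityZ {n : ℕ} (q α : ℝ) (x : Config n) (s : Height) : ℝ :=
  ∏ k : Fin n, (q ^ (-(x.1 k)) - α⁻¹ * q ^ (2 * (k : ℕ))
    - q ^ (k : ℕ) * (q ^ ((-(s.1 (x.1 k) : ℝ) - (x.1 k : ℝ)) / 2)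
        - α⁻¹ * q ^ (((s.1 (x.1 k) : ℝ) - (x.1 k : ℝ)) / 2)))

/-- The finite `q`-Pochhammer symbol `(a;q)_n`. -/
def qPoch (a q : ℝ) (n : ℕ) : ℝ := ∏ k ∈ Finset.range n, (1 - a * q ^ k)

/-- `E_step(t;x) = E[Z(x;s(t))] / (-α⁻¹;q)_n` (used for `t ≥ 0`). -/
def stepE {n : ℕ} {Ω : Type*} [MeasurableSpace Ω] (q α : ℝ) (P : Measure Ω)
    (s : ℝ≥0 → Ω → Height) (t : ℝ) (x : Config n) : ℝ :=
  (qPoch (-α⁻¹) q n)⁻¹ * ∫ ω, dualityZ q α x (s t.toNNReal ω) ∂P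

/-- `E_half(t;x) = α^n q^{-n(n-1)/2} E[Z(x;s(t))]` (used for `t ≥ 0`). -/
def halfE {n : ℕ} {Ω : Type*} [MeasurableSpace Ω] (q α : ℝ) (P : Measure Ω)
    (s : ℝ≥0 → Ω → Height) (t : ℝ) (x : Config n) : ℝ :=
  α ^ n / q ^ (n * (n - 1) / 2) * ∫ ω, dualityZ q α x (s t.toNNReal ω) ∂P

/-- The initial values `∏_k (q^{-x_k 1_{x_k ≤ 0}} - q^{k-1})`. -/
def stepInit {n : ℕ} (q : ℝ) (x : Config n) : ℝ :=
  ∏ k : Fin n, (q ^ (if x.1 k ≤ 0 then -(x.1 k) else 0) - q ^ (k : ℕ))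

/-- The initial values `∏_k (q^{(1-x_k) 1_{x_k ≤ 1}} - q^{k-1})`. -/
def halfInit {n : ℕ} (q : ℝ) (x : Config n) : ℝ :=
  ∏ k : Fin n, (q ^ (if x.1 k ≤ 1 then 1 - x.1 k else 0) - q ^ (k : ℕ))

/-- The `n`-fold contour integral, every variable running once, positively oriented, over the circle
of radius `ρ` around `1`. -/
def contourI {n : ℕ} (q ρ t : ℝ) (x : Config n) : ℂ :=
  (q : ℂ) ^ (n * (n - 1) / 2) / (2 * (Real.pi : ℂ) * Complex.I) ^ n *
    torusIntegral (fun y : Fin n → ℂ =>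
      (∏ i : Fin n, ∏ j ∈ Finset.Ioi i, (y i - y j) / (y i - (q : ℂ) * y j)) *
        ∏ i : Fin n, (((1 - y i) / (1 - (q : ℂ) * y i)) ^ (x.1 i) *
          Complex.exp ((1 - (q : ℂ)) ^ 2 * y i / ((1 - y i) * (1 - (q : ℂ) * y i)) * (t : ℂ))
          / y i))
      (fun _ => 1) (fun _ => ρ)

end DynASEP

end

noncomputable section

namespace DynASEP

/-! ### The particle system: free evolution and boundary condition -/

/-! Put `u = q^{-(s_x+x)/2}` and `v = q^{(s_x-x)/2}`, so that `u v = q^{-x}`. The `k`-th factor of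
`Z` then splits as `(u + α⁻¹ q^{k-1}) (v - q^{k-1})`, and a move to a neighbouring site multiplies
one of `u`, `v` by a power of `q` and fixes the other. Two identities follow. A flip of the height
at `x` acts on the factor at `x` as the generator of one free particle does (`fac_duality`). Two
adjacent factors satisfy the two-body boundary condition (`fac_boundary`), under which free
particles and exclusion particles have the same generator (`asepGen_eq_free`). Together they give
the duality `dynGen_dualityZ`: the height generator acting on `Z` in `s` equals the ASEP generator
acting on `Z` in `x`.

The martingale problem concerns bounded functions, while `Z` grows exponentially in the height at
the origin. Gronwall's inequality bounds the exponential moments of this height, and truncation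
extends Dynkin's formula to `Z`; so `E[Z]` solves the ASEP system, with at most exponential growth
in `x`. In that class solutions are unique (`SolvesASEP.unique`), because iterating the equation
bounds a solution with zero initial data by `C (Kt)^j / j!` times a fixed exponential weight, for
every `j`.

The contour integrand is a product of plane waves, an eigenfunction of the free generator. The
boundary condition holds after integration: the boundary operator cancels the pole in `y_k - q
y_{k+1}` and leaves an integrand that is antisymmetric in these two variables.

What remains is initial values. For step data `Z` is explicit. For half-stationary data, averaging
over one step of the Markov chain sends a block of factors on one site to two such blocks on the
next site to the right (`halfTrans_average`), which gives the product formula by induction. For the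
contour integral the last variable is integrated out: partial fractions of the kernel leave a scalar
multiple of the integral with one variable fewer, plus terms that are holomorphic in one remaining
variable and integrate to zero. The comparison in (3) is then uniqueness together with translation
invariance. -/

theorem strictAnti_update_left {m : ℕ} {x : Fin (m + 1) → ℤ} (hx : StrictAnti x)
    (i : Fin (m + 1)) :
    StrictAnti (Function.update x i (x i + -1)) ↔
      ∀ k : Fin m, i = k.castSucc → x k.succ ≠ x k.castSucc - 1 := by
  have hx' := Fin.strictAnti_iff_succ_lt.1 hx
  rw [Fin.strictAnti_iff_succ_lt]
  refine forall_congr' fun k => ?_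
  have h1 := hx' k
  have hne : k.succ ≠ k.castSucc := (Fin.castSucc_lt_succ (i := k)).ne'
  rcases eq_or_ne i k.castSucc with rfl | h
  · simp only [Function.update_of_ne hne, Function.update_self, forall_const]
    omega
  · rcases eq_or_ne i k.succ with rfl | h'
    · simp only [Function.update_of_ne hne.symm, Function.update_self, h, false_imp_iff, iff_true]
      omega
    · simp only [Function.update_of_ne h.symm, Function.update_of_ne h'.symm, h, false_imp_iff,
        iff_true]
      exact h1

theorem strictAnti_update_right {m : ℕ} {x : Fin (m + 1) → ℤ} (hx : StrictAnti x)
    (i : Fin (m + 1)) :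
    StrictAnti (Function.update x i (x i + 1)) ↔
      ∀ k : Fin m, i = k.succ → x k.succ ≠ x k.castSucc - 1 := by
  have hx' := Fin.strictAnti_iff_succ_lt.1 hx
  rw [Fin.strictAnti_iff_succ_lt]
  refine forall_congr' fun k => ?_
  have h1 := hx' k
  have hne : k.succ ≠ k.castSucc := (Fin.castSucc_lt_succ (i := k)).ne'
  rcases eq_or_ne i k.succ with rfl | h
  · simp only [Function.update_of_ne hne.symm, Function.update_self, forall_const]
    omega
  · rcases eq_or_ne i k.castSucc with rfl | h'
    · simp only [Function.update_of_ne hne, Function.update_self, h, false_imp_iff, iff_true]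
      omega
    · simp only [Function.update_of_ne h.symm, Function.update_of_ne h'.symm, h, false_imp_iff,
        iff_true]
      exact h1

/-- A function on `ℤ^n` satisfying the two-body boundary condition is acted upon by the ASEP
generator as by the generator of independent particles. -/
theorem asepGen_eq_free {m : ℕ} {V : Type*} [AddCommGroup V] [Module ℝ V] (l r : ℝ)
    (u : (Fin (m + 1) → ℤ) → V) (x : Config (m + 1))
    (hu : ∀ k : Fin m, x.1 k.succ = x.1 k.castSucc - 1 →
      l • (u (Function.update x.1 k.castSucc (x.1 k.castSucc + -1)) - u x.1)
        + r • (u (Function.update x.1 k.succ (x.1 k.succ + 1)) - u x.1) = 0) :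
    asepGen l r (fun y : Config (m + 1) => u y.1) x =
      ∑ i, (l • (u (Function.update x.1 i (x.1 i + -1)) - u x.1)
        + r • (u (Function.update x.1 i (x.1 i + 1)) - u x.1)) := by
  classical
  set A : Fin (m + 1) → V := fun i => l • (u (Function.update x.1 i (x.1 i + -1)) - u x.1)
  set B : Fin (m + 1) → V := fun i => r • (u (Function.update x.1 i (x.1 i + 1)) - u x.1)
  have e1 : ∀ i, l • moveDiff (fun y : Config (m + 1) => u y.1) x i (-1) =
      A i - if ∀ k : Fin m, i = k.castSucc → x.1 k.succ ≠ x.1 k.castSucc - 1 then 0 else A i := by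
    intro i
    simp only [moveDiff, strictAnti_update_left x.2]
    split_ifs <;> simp [A]
  have e2 : ∀ i, r • moveDiff (fun y : Config (m + 1) => u y.1) x i 1 =
      B i - if ∀ k : Fin m, i = k.succ → x.1 k.succ ≠ x.1 k.castSucc - 1 then 0 else B i := by
    intro i
    simp only [moveDiff, strictAnti_update_right x.2]
    split_ifs <;> simp [B]
  rw [asepGen]
  simp only [e1, e2]
  -- A left jump is blocked exactly when the next label sits on the adjacent site, so blocked left
  -- jumps are indexed by adjacent pairs; the last particle is never blocked on its left. The sum
  -- `s2` treats right jumps symmetrically.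
  have s1 : ∑ i, (if ∀ k : Fin m, i = k.castSucc → x.1 k.succ ≠ x.1 k.castSucc - 1 then 0
      else A i) = ∑ k : Fin m, if x.1 k.succ = x.1 k.castSucc - 1 then A k.castSucc else 0 := by
    rw [Fin.sum_univ_castSucc]
    have : (if ∀ k : Fin m, Fin.last m = k.castSucc → x.1 k.succ ≠ x.1 k.castSucc - 1 then 0
      else A (Fin.last m)) = 0 := by
      rw [if_pos]
      intro k hk
      exact absurd hk (Fin.castSucc_lt_last k).ne'
    rw [this, add_zero]
    refine Finset.sum_congr rfl fun k _ => ?_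
    have : (∀ k' : Fin m, k.castSucc = k'.castSucc → x.1 k'.succ ≠ x.1 k'.castSucc - 1) ↔
        ¬ x.1 k.succ = x.1 k.castSucc - 1 :=
      ⟨fun h => h k rfl, fun h k' hk => by rw [← Fin.castSucc_injective _ hk]; exact h⟩
    simp only [this, ite_not]
  have s2 : ∑ i, (if ∀ k : Fin m, i = k.succ → x.1 k.succ ≠ x.1 k.castSucc - 1 then 0
      else B i) = ∑ k : Fin m, if x.1 k.succ = x.1 k.castSucc - 1 then B k.succ else 0 := by
    rw [Fin.sum_univ_succ]
    have : (if ∀ k : Fin m, (0 : Fin (m + 1)) = k.succ → x.1 k.succ ≠ x.1 k.castSucc - 1 then 0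
      else B 0) = 0 := by
      rw [if_pos]
      intro k hk
      exact absurd hk.symm (Fin.succ_ne_zero k)
    rw [this, zero_add]
    refine Finset.sum_congr rfl fun k _ => ?_
    have : (∀ k' : Fin m, k.succ = k'.succ → x.1 k'.succ ≠ x.1 k'.castSucc - 1) ↔
        ¬ x.1 k.succ = x.1 k.castSucc - 1 :=
      ⟨fun h => h k rfl, fun h k' hk => by rw [← Fin.succ_injective _ hk]; exact h⟩
    simp only [this, ite_not]
  -- An adjacent pair blocks two jumps, one of each particle. The boundary condition `hu` says that
  -- the free generator's contributions of these two jumps cancel.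
  have s3 : (∑ k : Fin m, if x.1 k.succ = x.1 k.castSucc - 1 then A k.castSucc else 0)
      + (∑ k : Fin m, if x.1 k.succ = x.1 k.castSucc - 1 then B k.succ else 0) = 0 := by
    rw [← Finset.sum_add_distrib]
    refine Finset.sum_eq_zero fun k _ => ?_
    split_ifs with h
    · exact hu k h
    · simp
  rw [Finset.sum_add_distrib, Finset.sum_sub_distrib, Finset.sum_sub_distrib, s1, s2,
    Finset.sum_add_distrib, sub_add_sub_comm, s3, sub_zero]

/-! ### Uniqueness for the ASEP system under exponential growth -/

/-- At most exponential growth in space, locally uniformly in time. -/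
def ExpGrowth {n : ℕ} {V : Type*} [Norm V] (u : ℝ → Config n → V) : Prop :=
  ∀ T : ℝ, ∃ C c : ℝ, 0 ≤ C ∧ 0 ≤ c ∧ ∀ t : ℝ, 0 ≤ t → t ≤ T → ∀ x : Config n,
    ‖u t x‖ ≤ C * Real.exp (c * ∑ i, |(x.1 i : ℝ)|)

theorem norm_moveDiff_le {n : ℕ} {V : Type*} [NormedAddCommGroup V] {f : Config n → V} {C c : ℝ}
    (hC : 0 ≤ C) (hc : 0 ≤ c) (hf : ∀ x : Config n, ‖f x‖ ≤ C * Real.exp (c * ∑ i, |(x.1 i : ℝ)|))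
    (x : Config n) (i : Fin n) {d : ℤ} (hd : |d| ≤ 1) :
    ‖moveDiff f x i d‖ ≤ C * (2 * Real.exp c) * Real.exp (c * ∑ i, |(x.1 i : ℝ)|) := by
  have h1 : 1 ≤ Real.exp c := Real.one_le_exp hc
  rw [moveDiff]
  split_ifs with h
  · have hs : ∑ j, |(Function.update x.1 i (x.1 i + d) j : ℝ)| ≤ ∑ j, |(x.1 j : ℝ)| + 1 := by
      have e : ∀ y : Fin n → ℤ, ∑ j, |(y j : ℝ)| =
          |(y i : ℝ)| + ∑ j ∈ Finset.univ.erase i, |(y j : ℝ)| := fun y =>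
        (Finset.add_sum_erase _ _ (Finset.mem_univ i)).symm
      rw [e, e]
      have e2 : ∑ j ∈ Finset.univ.erase i, |(Function.update x.1 i (x.1 i + d) j : ℝ)| =
          ∑ j ∈ Finset.univ.erase i, |(x.1 j : ℝ)| :=
        Finset.sum_congr rfl fun j hj => by
          rw [Function.update_of_ne (Finset.ne_of_mem_erase hj)]
      rw [e2, Function.update_self]
      have : |((x.1 i + d : ℤ) : ℝ)| ≤ |(x.1 i : ℝ)| + 1 := by
        push_cast
        refine (abs_add_le _ _).trans ?_
        have : |(d : ℝ)| ≤ 1 := by exact_mod_cast hd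
        linarith
      linarith
    refine (norm_sub_le _ _).trans ?_
    have a1 := hf ⟨_, h⟩
    have a2 := hf x
    have a3 : Real.exp (c * ∑ j, |(Function.update x.1 i (x.1 i + d) j : ℝ)|) ≤
        Real.exp (c * ∑ i, |(x.1 i : ℝ)|) * Real.exp c := by
      rw [← Real.exp_add]
      refine Real.exp_le_exp.2 ?_
      nlinarith
    have e0 := Real.exp_pos (c * ∑ i, |(x.1 i : ℝ)|)
    have a4 := mul_le_mul_of_nonneg_left a3 hC
    have a5 : C * Real.exp (c * ∑ i, |(x.1 i : ℝ)|) ≤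
        C * Real.exp (c * ∑ i, |(x.1 i : ℝ)|) * Real.exp c :=
      le_mul_of_one_le_right (by positivity) h1
    calc _ ≤ _ := add_le_add (a1.trans a4) (a2.trans a5)
      _ = _ := by ring
  · rw [norm_zero]
    positivity

/-- One jump changes `∑ |x_i|` by at most one. The exponential rate `c` is therefore not degraded,
only the constant in front, and the estimate can be iterated. -/
theorem norm_asepGen_le {n : ℕ} {V : Type*} [NormedAddCommGroup V] [NormedSpace ℝ V]
    (l r : ℝ) {f : Config n → V} {C c : ℝ}
    (hC : 0 ≤ C) (hc : 0 ≤ c) (hf : ∀ x : Config n, ‖f x‖ ≤ C * Real.exp (c * ∑ i, |(x.1 i : ℝ)|))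
    (x : Config n) :
    ‖asepGen l r f x‖ ≤
      C * (n * ((|l| + |r|) * (2 * Real.exp c))) * Real.exp (c * ∑ i, |(x.1 i : ℝ)|) := by
  rw [asepGen]
  refine (norm_sum_le _ _).trans ?_
  have : ∀ i ∈ (Finset.univ : Finset (Fin n)), ‖l • moveDiff f x i (-1) + r • moveDiff f x i 1‖ ≤
      (|l| + |r|) * (C * (2 * Real.exp c) * Real.exp (c * ∑ i, |(x.1 i : ℝ)|)) := by
    intro i _
    refine (norm_add_le _ _).trans ?_
    rw [norm_smul, norm_smul, add_mul]
    exact add_le_add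
      (mul_le_mul_of_nonneg_left (norm_moveDiff_le hC hc hf x i (by simp)) (norm_nonneg _))
      (mul_le_mul_of_nonneg_left (norm_moveDiff_le hC hc hf x i (by simp)) (norm_nonneg _))
  refine (Finset.sum_le_sum this).trans (le_of_eq ?_)
  simp only [Finset.sum_const, Finset.card_univ, Fintype.card_fin, nsmul_eq_mul]
  ring

theorem moveDiff_sub {n : ℕ} {V : Type*} [AddCommGroup V] (f g : Config n → V) (x : Config n)
    (i : Fin n) (d : ℤ) :
    moveDiff (fun y => f y - g y) x i d = moveDiff f x i d - moveDiff g x i d := by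
  unfold moveDiff
  split_ifs
  · exact sub_sub_sub_comm _ _ _ _
  · exact (sub_zero 0).symm

theorem asepGen_sub {n : ℕ} {V : Type*} [AddCommGroup V] [Module ℝ V] (l r : ℝ)
    (f g : Config n → V) (x : Config n) :
    asepGen l r (fun y => f y - g y) x = asepGen l r f x - asepGen l r g x := by
  simp only [asepGen, moveDiff_sub, smul_sub, ← Finset.sum_sub_distrib]
  exact Finset.sum_congr rfl fun _ _ => by abel

/-- Since the generator is bounded for the weight `exp (c ∑ |x_i|)`, integrating the equation `j`
times improves the a priori bound by the factor `(Kt)^j / j!`, which tends to zero. -/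
theorem SolvesASEP.eq_zero {n : ℕ} {V : Type*} [NormedAddCommGroup V] [NormedSpace ℝ V] {l r : ℝ}
    {u : ℝ → Config n → V} (hu : SolvesASEP l r (fun _ => 0) u) (hg : ExpGrowth u) {t : ℝ}
    (ht : 0 ≤ t) (x : Config n) : u t x = 0 := by
  obtain ⟨C, c, hC, hc, hb⟩ := hg t
  set K : ℝ := n * ((|l| + |r|) * (2 * Real.exp c)) with hK
  have hK0 : 0 ≤ K := by positivity
  have key : ∀ j : ℕ, ∀ τ : ℝ, 0 ≤ τ → τ ≤ t → ∀ x : Config n,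
      ‖u τ x‖ ≤ (C * (K * τ) ^ j / j.factorial) * Real.exp (c * ∑ i, |(x.1 i : ℝ)|) := by
    intro j
    induction j with
    | zero => intro τ h0 h1 x; simpa using hb τ h0 h1 x
    | succ j ih =>
      intro τ h0 h1 x
      set E := Real.exp (c * ∑ i, |(x.1 i : ℝ)|) with hE
      -- The comparison function is the bound of order `j + 1`; its derivative is `K` times the
      -- bound of order `j`, which dominates the norm of the generator by induction.
      refine image_norm_le_of_norm_deriv_right_le_deriv_boundary (a := 0) (b := t)
        (f := fun s => u s x) (f' := fun s => asepGen l r (u s) x)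
        (B := fun s => (C * (K * s) ^ (j + 1) / (j + 1).factorial) * E)
        (B' := fun s => (C * (K * s) ^ j / j.factorial) * K * E) ?_ ?_ ?_ ?_ ?_ ⟨h0, h1⟩
      · intro s hs
        exact ((hu.ode s hs.1 x).continuousWithinAt).mono Set.Icc_subset_Ici_self
      · intro s hs
        exact (hu.ode s hs.1 x).mono (Set.Ici_subset_Ici.2 hs.1)
      · simp [hu.init x]
      · intro s
        have h := ((((hasDerivAt_id s).const_mul K).pow (j + 1)).const_mul C).div_const
          ((j + 1).factorial : ℝ) |>.mul_const E
        refine h.congr_deriv ?_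
        have f0 : ((j.factorial : ℕ) : ℝ) ≠ 0 := by exact_mod_cast Nat.factorial_ne_zero j
        have f1 : ((j : ℝ) + 1) ≠ 0 := by positivity
        rw [Nat.factorial_succ]
        push_cast
        simp only [id]
        field_simp
      · intro s hs
        have hs0 := hs.1
        have h := norm_asepGen_le l r (f := u s) (by positivity) hc
          (ih s hs.1 hs.2.le) x
        exact h
  have hlim : Tendsto (fun j : ℕ => (C * (K * t) ^ j / j.factorial)
      * Real.exp (c * ∑ i, |(x.1 i : ℝ)|)) atTop (𝓝 0) := by
    have := (FloorSemiring.tendsto_pow_div_factorial_atTop (K * t)).const_mul C |>.mul_const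
      (Real.exp (c * ∑ i, |(x.1 i : ℝ)|))
    simpa [mul_div_assoc] using this
  exact norm_le_zero_iff.1 (ge_of_tendsto' hlim fun j => key j t ht le_rfl x)

theorem SolvesASEP.sub {n : ℕ} {V : Type*} [NormedAddCommGroup V] [NormedSpace ℝ V] {l r : ℝ}
    {f g : Config n → V} {u v : ℝ → Config n → V} (hu : SolvesASEP l r f u)
    (hv : SolvesASEP l r g v) :
    SolvesASEP l r (fun x => f x - g x) (fun t x => u t x - v t x) where
  init x := by rw [hu.init, hv.init]
  ode t ht x := by
    rw [asepGen_sub]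
    exact (hu.ode t ht x).sub (hv.ode t ht x)

theorem ExpGrowth.sub {n : ℕ} {V : Type*} [NormedAddCommGroup V]
    {u v : ℝ → Config n → V} (hu : ExpGrowth u) (hv : ExpGrowth v) :
    ExpGrowth (fun t x => u t x - v t x) := by
  intro T
  obtain ⟨C, c, hC, hc, h⟩ := hu T
  obtain ⟨C', c', hC', hc', h'⟩ := hv T
  refine ⟨C + C', max c c', by positivity, by positivity, fun t h0 h1 x => ?_⟩
  have hS : 0 ≤ ∑ i, |(x.1 i : ℝ)| := Finset.sum_nonneg fun _ _ => abs_nonneg _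
  refine (norm_sub_le _ _).trans ?_
  rw [add_mul]
  refine add_le_add ((h t h0 h1 x).trans ?_) ((h' t h0 h1 x).trans ?_)
  · gcongr; exact le_max_left _ _
  · gcongr; exact le_max_right _ _

/-- Solutions of the ASEP system of at most exponential growth are determined by their initial
values. -/
theorem SolvesASEP.unique {n : ℕ} {V : Type*} [NormedAddCommGroup V] [NormedSpace ℝ V] {l r : ℝ}
    {g : Config n → V} {u v : ℝ → Config n → V} (hu : SolvesASEP l r g u)
    (hv : SolvesASEP l r g v) (hgu : ExpGrowth u) (hgv : ExpGrowth v) {t : ℝ}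
    (ht : 0 ≤ t) (x : Config n) : u t x = v t x := by
  have h := hu.sub hv
  simp only [sub_self] at h
  exact sub_eq_zero.1 (h.eq_zero (hgu.sub hgv) ht x)

/-! ### Translation of solutions, and passage from real to complex values -/

theorem moveDiff_shift {n : ℕ} {V : Type*} [AddCommGroup V] (f : Config n → V) (x : Config n)
    (i : Fin n) (d : ℤ) :
    moveDiff (fun y : Config n => f y.shift) x i d = moveDiff f x.shift i d := by
  have e : Function.update x.shift.1 i (x.shift.1 i + d) =
      fun j => Function.update x.1 i (x.1 i + d) j - 1 := by
    funext j
    rcases eq_or_ne j i with rfl | h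
    · simp [Config.shift]; ring
    · simp [Config.shift, h]
  have h : StrictAnti (Function.update x.1 i (x.1 i + d)) ↔
      StrictAnti (Function.update x.shift.1 i (x.shift.1 i + d)) := by
    rw [e]
    exact ⟨fun h a b hab => sub_lt_sub_right (h hab) 1, fun h a b hab => by
      simpa using h hab⟩
  unfold moveDiff
  by_cases hx : StrictAnti (Function.update x.1 i (x.1 i + d))
  · rw [dif_pos hx, dif_pos (h.1 hx)]
    exact congrArg (fun z => f z - f x.shift) (Subtype.ext e.symm)
  · rw [dif_neg hx, dif_neg (mt h.2 hx)]

theorem SolvesASEP.shift {n : ℕ} {V : Type*} [NormedAddCommGroup V] [NormedSpace ℝ V] {l r : ℝ}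
    {g : Config n → V} {u : ℝ → Config n → V} (hu : SolvesASEP l r g u) :
    SolvesASEP l r (fun x => g x.shift) (fun t x => u t x.shift) where
  init x := hu.init x.shift
  ode t ht x := by
    have : asepGen l r (fun y : Config n => u t y.shift) x = asepGen l r (u t) x.shift := by
      simp only [asepGen, moveDiff_shift]
    rw [this]
    exact hu.ode t ht x.shift

theorem ExpGrowth.shift {n : ℕ} {V : Type*} [Norm V] {u : ℝ → Config n → V} (hu : ExpGrowth u) :
    ExpGrowth (fun t (x : Config n) => u t x.shift) := by
  intro T
  obtain ⟨C, c, hC, hc, h⟩ := hu T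
  refine ⟨C * Real.exp (c * n), c, by positivity, hc, fun t h0 h1 x => (h t h0 h1 _).trans ?_⟩
  rw [mul_assoc, ← Real.exp_add, ← mul_add]
  gcongr
  have : ∀ i ∈ (Finset.univ : Finset (Fin n)), |(x.shift.1 i : ℝ)| ≤ |(x.1 i : ℝ)| + 1 := by
    intro i _
    simp only [Config.shift]
    push_cast
    exact (abs_sub _ _).trans (by simp)
  refine (Finset.sum_le_sum this).trans (le_of_eq ?_)
  rw [Finset.sum_add_distrib]
  simp [add_comm]

theorem asepGen_ofReal {n : ℕ} (l r : ℝ) (f : Config n → ℝ) (x : Config n) :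
    asepGen l r (fun y => (f y : ℂ)) x = ((asepGen l r f x : ℝ) : ℂ) := by
  have : ∀ i d, moveDiff (fun y => (f y : ℂ)) x i d = ((moveDiff f x i d : ℝ) : ℂ) := by
    intro i d
    unfold moveDiff
    split_ifs <;> simp
  simp only [asepGen, this]
  push_cast
  simp

theorem SolvesASEP.ofReal {n : ℕ} {l r : ℝ} {g : Config n → ℝ} {u : ℝ → Config n → ℝ}
    (hu : SolvesASEP l r g u) :
    SolvesASEP l r (fun x => (g x : ℂ)) (fun t x => (u t x : ℂ)) where
  init x := by rw [hu.init]
  ode t ht x := by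
    rw [asepGen_ofReal]
    exact (hu.ode t ht x).ofReal_comp

theorem ExpGrowth.ofReal {n : ℕ} {u : ℝ → Config n → ℝ} (hu : ExpGrowth u) :
    ExpGrowth (fun t x => (u t x : ℂ)) := by
  intro T
  obtain ⟨C, c, hC, hc, h⟩ := hu T
  exact ⟨C, c, hC, hc, fun t h0 h1 x => by simpa using h t h0 h1 x⟩

end DynASEP

end

noncomputable section

namespace DynASEP

/-! ### The generator on local functions -/

theorem downRate_nonneg {q α : ℝ} (hq : 0 < q) (hα : 0 < α) (h : ℤ) : 0 ≤ downRate q α h := by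
  unfold downRate; positivity

theorem upRate_nonneg {q α : ℝ} (hq : 0 < q) (hα : 0 < α) (h : ℤ) : 0 ≤ upRate q α h := by
  unfold upRate; positivity

theorem downRate_le_one {q α : ℝ} (hq : 0 < q) (hq1 : q < 1) (hα : 0 < α) (h : ℤ) :
    downRate q α h ≤ 1 := by
  unfold downRate
  rw [div_le_one (by positivity), zpow_add₀ hq.ne', zpow_one]
  linarith

theorem upRate_le_one {q α : ℝ} (hq : 0 < q) (hq1 : q < 1) (hα : 0 < α) (h : ℤ) :
    upRate q α h ≤ 1 := by
  unfold upRate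
  rw [div_le_one (by positivity)]
  have : q ^ (-h) ≤ q ^ (-h - 1) := zpow_le_zpow_right_of_le_one₀ hq hq1.le (by omega)
  gcongr

/-- `f` depends on the heights at the sites of `A` only. -/
def LocalOn (A : Finset ℤ) (f : Height → ℝ) : Prop :=
  ∀ s s' : Height, (∀ x ∈ A, s.1 x = s'.1 x) → f s = f s'

theorem LocalOn.isLocal {A : Finset ℤ} {f : Height → ℝ} (hf : LocalOn A f) : IsLocal f := ⟨A, hf⟩

theorem LocalOn.mono {A B : Finset ℤ} {f : Height → ℝ} (hf : LocalOn A f) (h : A ⊆ B) :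
    LocalOn B f := fun s s' hs => hf s s' fun x hx => hs x (h hx)

theorem update_mem_height_iff (s : Height) (x d : ℤ) :
    (∀ y : ℤ, |Function.update s.1 x (s.1 x + d) (y + 1)
      - Function.update s.1 x (s.1 x + d) y| = 1) ↔
      |s.1 (x + 1) - (s.1 x + d)| = 1 ∧ |s.1 x + d - s.1 (x - 1)| = 1 := by
  constructor
  · intro h
    have h1 := h x
    have h2 := h (x - 1)
    rw [Function.update_self, Function.update_of_ne (by omega)] at h1
    rw [sub_add_cancel, Function.update_self, Function.update_of_ne (by omega)] at h2
    exact ⟨h1, h2⟩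
  · rintro ⟨h1, h2⟩ y
    by_cases hy : y = x
    · subst hy
      rwa [Function.update_self, Function.update_of_ne (by omega)]
    · by_cases hy' : y + 1 = x
      · have : y = x - 1 := by omega
        subst this
        rwa [sub_add_cancel, Function.update_self, Function.update_of_ne (by omega)]
      · rw [Function.update_of_ne hy, Function.update_of_ne hy']
        exact s.2 y

theorem LocalOn.jumpDiff_eq_zero {A : Finset ℤ} {f : Height → ℝ} (hf : LocalOn A f) (s : Height)
    {x : ℤ} (hx : x ∉ A) (d : ℤ) : jumpDiff f s x d = 0 := by
  unfold jumpDiff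
  split_ifs with h
  · rw [sub_eq_zero]
    exact hf _ _ fun y hy => Function.update_of_ne (by rintro rfl; exact hx hy) _ _
  · rfl

theorem LocalOn.dynGen_eq_sum {A : Finset ℤ} {f : Height → ℝ} (hf : LocalOn A f) (q α : ℝ)
    (s : Height) :
    dynGen q α f s = ∑ x ∈ A,
      (downRate q α (s.1 x) * jumpDiff f s x (-2) + upRate q α (s.1 x) * jumpDiff f s x 2) := by
  refine finsum_eq_sum_of_support_subset _ fun x hx => ?_
  by_contra h
  exact hx (by simp [hf.jumpDiff_eq_zero s h])

theorem LocalOn.jumpDiff_congr {A : Finset ℤ} {f : Height → ℝ} (hf : LocalOn A f) {s s' : Height}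
    (h : ∀ y ∈ A, s.1 y = s'.1 y) {x : ℤ} (h0 : s.1 x = s'.1 x) (h1 : s.1 (x + 1) = s'.1 (x + 1))
    (h2 : s.1 (x - 1) = s'.1 (x - 1)) (d : ℤ) : jumpDiff f s x d = jumpDiff f s' x d := by
  by_cases hu : ∀ y : ℤ, |Function.update s.1 x (s.1 x + d) (y + 1)
      - Function.update s.1 x (s.1 x + d) y| = 1
  · have hu' := hu
    rw [update_mem_height_iff, h0, h1, h2, ← update_mem_height_iff] at hu'
    rw [jumpDiff, jumpDiff, dif_pos hu, dif_pos hu', hf s s' h]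
    congr 1
    refine hf _ _ fun y hy => ?_
    rcases eq_or_ne y x with rfl | hyx
    · simp [h0]
    · simp [hyx, h y hy]
  · have hu' := hu
    rw [update_mem_height_iff, h0, h1, h2, ← update_mem_height_iff] at hu'
    rw [jumpDiff, jumpDiff, dif_neg hu, dif_neg hu']

theorem IsLocal.dynGen {f : Height → ℝ} (hf : IsLocal f) (q α : ℝ) :
    IsLocal (dynGen q α f) := by
  classical
  obtain ⟨A, hA⟩ := hf
  have hA' : LocalOn A f := hA
  -- Whether a flip at a site is allowed depends on the two neighbouring heights, so the generator
  -- sees one more site on each side of `A`.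
  refine ⟨A ∪ A.image (· + 1) ∪ A.image (· - 1), fun s s' h => ?_⟩
  rw [hA'.dynGen_eq_sum, hA'.dynGen_eq_sum]
  refine Finset.sum_congr rfl fun x hx => ?_
  have h0 : s.1 x = s'.1 x := h x (by simp [hx])
  have h1 : s.1 (x + 1) = s'.1 (x + 1) := h _ (by simp [hx])
  have h2 : s.1 (x - 1) = s'.1 (x - 1) :=
    h _ (Finset.mem_union_right _ (Finset.mem_image_of_mem _ hx))
  have h3 : ∀ y ∈ A, s.1 y = s'.1 y := fun y hy => h y (by simp [hy])
  rw [hA'.jumpDiff_congr h3 h0 h1 h2, hA'.jumpDiff_congr h3 h0 h1 h2, h0]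

/-- A local function factors through finitely many integer heights, a countable discrete space on
which every function is measurable. -/
theorem IsLocal.measurable {f : Height → ℝ} (hf : IsLocal f) : Measurable f := by
  obtain ⟨A, hA⟩ := hf
  have hm : Measurable (fun (s : Height) (x : A) => s.1 x) :=
    measurable_pi_lambda _ fun x => (measurable_pi_apply _).comp measurable_subtype_coe
  have hfac : Function.FactorsThrough f (fun (s : Height) (x : A) => s.1 x) := fun s s' h =>
    hA s s' fun x hx => congrFun h ⟨x, hx⟩
  have : f = (Function.extend (fun (s : Height) (x : A) => s.1 x) f 0) ∘
      (fun (s : Height) (x : A) => s.1 x) := by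
    funext s
    exact (hfac.extend_apply 0 s).symm
  rw [this]
  exact (measurable_of_countable _).comp hm

theorem abs_jumpDiff_le {f W : Height → ℝ} {L : ℝ} (hf : ∀ s, |f s| ≤ W s)
    (hW : ∀ s s' : Height, |s'.1 0 - s.1 0| ≤ 2 → W s' ≤ L * W s) (s : Height) (x : ℤ) {d : ℤ}
    (hd : |d| ≤ 2) (hL : 0 ≤ L) : |jumpDiff f s x d| ≤ (L + 1) * W s := by
  have h0 : 0 ≤ W s := (abs_nonneg _).trans (hf s)
  unfold jumpDiff
  split_ifs with h
  · refine (abs_sub _ _).trans ?_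
    rw [add_mul, one_mul]
    refine add_le_add ((hf _).trans (hW _ _ ?_)) (hf s)
    rcases eq_or_ne (0 : ℤ) x with rfl | hx
    · simpa using hd
    · simp [hx]
  · rw [abs_zero]
    positivity

/-- The rates are at most one, and a flip moves the height at the origin by at most two. A weight
`W` that changes by at most the factor `L` under such a move thus controls the generator. It is used
with constants, exponentials and truncated exponentials. -/
theorem LocalOn.abs_dynGen_le {q α : ℝ} (hq : 0 < q) (hq1 : q < 1) (hα : 0 < α) {A : Finset ℤ}
    {f W : Height → ℝ} (hfA : LocalOn A f) {L : ℝ} (hf : ∀ s, |f s| ≤ W s)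
    (hW : ∀ s s' : Height, |s'.1 0 - s.1 0| ≤ 2 → W s' ≤ L * W s) (hL : 0 ≤ L) (s : Height) :
    |DynASEP.dynGen q α f s| ≤ (A.card * (2 * (L + 1))) * W s := by
  rw [hfA.dynGen_eq_sum]
  refine (Finset.abs_sum_le_sum_abs _ _).trans ?_
  have : ∀ x ∈ A, |downRate q α (s.1 x) * jumpDiff f s x (-2) + upRate q α (s.1 x) *
      jumpDiff f s x 2| ≤ 2 * (L + 1) * W s := by
    intro x _
    refine (abs_add_le _ _).trans ?_
    rw [abs_mul, abs_mul, abs_of_nonneg (downRate_nonneg hq hα _),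
      abs_of_nonneg (upRate_nonneg hq hα _)]
    have h1 := abs_jumpDiff_le hf hW s x (d := -2) (by simp) hL
    have h2 := abs_jumpDiff_le hf hW s x (d := 2) (by simp) hL
    have h3 := mul_le_mul (downRate_le_one hq hq1 hα (s.1 x)) h1 (abs_nonneg _) zero_le_one
    have h4 := mul_le_mul (upRate_le_one hq hq1 hα (s.1 x)) h2 (abs_nonneg _) zero_le_one
    linarith
  refine (Finset.sum_le_sum this).trans (le_of_eq ?_)
  simp only [Finset.sum_const, nsmul_eq_mul]
  ring

theorem exp_abs_height_le {c : ℝ} (hc : 0 ≤ c) {s s' : Height} (h : |s'.1 0 - s.1 0| ≤ 2) :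
    Real.exp (c * |(s'.1 0 : ℝ)|) ≤ Real.exp (2 * c) * Real.exp (c * |(s.1 0 : ℝ)|) := by
  rw [← Real.exp_add]
  refine Real.exp_le_exp.2 ?_
  have h1 : |((s'.1 0 : ℝ) - s.1 0)| ≤ 2 := by exact_mod_cast h
  have h2 := abs_sub_abs_le_abs_sub (s'.1 0 : ℝ) (s.1 0)
  nlinarith

/-- Local functions of at most exponential growth in the height at the origin. -/
def ExpLocal (f : Height → ℝ) : Prop :=
  IsLocal f ∧ ∃ C c : ℝ, 0 ≤ C ∧ 0 ≤ c ∧ ∀ s : Height, |f s| ≤ C * Real.exp (c * |(s.1 0 : ℝ)|)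

theorem ExpLocal.dynGen {q α : ℝ} (hq : 0 < q) (hq1 : q < 1) (hα : 0 < α) {f : Height → ℝ}
    (hf : ExpLocal f) : ExpLocal (dynGen q α f) := by
  obtain ⟨hl, C, c, hC, hc, hb⟩ := hf
  refine ⟨hl.dynGen q α, ?_⟩
  obtain ⟨A, hA⟩ := hl
  refine ⟨(A.card * (2 * (Real.exp (2 * c) + 1))) * C, c, by positivity, hc, fun s => ?_⟩
  rw [mul_assoc]
  refine LocalOn.abs_dynGen_le hq hq1 hα hA hb (fun s s' h => ?_) (by positivity) s
  have := mul_le_mul_of_nonneg_left (exp_abs_height_le hc h) hC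
  linarith

theorem IsLocal.bounded_dynGen {q α : ℝ} (hq : 0 < q) (hq1 : q < 1) (hα : 0 < α)
    {f : Height → ℝ} (hl : IsLocal f) (hb : ∃ C : ℝ, ∀ s, |f s| ≤ C) :
    ∃ C : ℝ, ∀ s, |DynASEP.dynGen q α f s| ≤ C := by
  obtain ⟨A, hA⟩ := hl
  obtain ⟨C, hC⟩ := hb
  exact ⟨_, LocalOn.abs_dynGen_le hq hq1 hα (W := fun _ => C) (L := 1) hA hC
    (fun _ _ _ => (one_mul C).ge) zero_le_one⟩

/-! ### Expectations along the process -/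

section Dynamics

variable {Ω : Type*} [mΩ : MeasurableSpace Ω] {q α : ℝ} {P : Measure Ω}
  {ℱ : Filtration ℝ≥0 (inferInstance : MeasurableSpace Ω)} {s : ℝ≥0 → Ω → Height}

theorem IsDynamicASEP.measurable_eval (hs : IsDynamicASEP q α P ℱ s) (t : ℝ≥0) :
    Measurable (s t) := (hs.adapted t).mono (ℱ.le t) le_rfl

/-- The `+ 1` after the floor makes the grid times lie strictly to the right of `u`, where right
continuity applies. -/
theorem tendsto_floor_grid (u : ℝ≥0) :
    Tendsto (fun k : ℕ => ((⌊u * ((k : ℝ≥0) + 1)⌋₊ : ℝ≥0) + 1) / ((k : ℝ≥0) + 1)) atTop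
      (𝓝[>] u) := by
  refine tendsto_nhdsWithin_iff.2 ⟨?_, Eventually.of_forall fun k => ?_⟩
  · have hup : Tendsto (fun k : ℕ => u + 1 / ((k : ℝ≥0) + 1)) atTop (𝓝 u) := by
      have : Tendsto (fun k : ℕ => 1 / ((k : ℝ≥0) + 1)) atTop (𝓝 0) :=
        tendsto_one_div_add_atTop_nhds_zero_nat
      simpa using this.const_add u
    refine tendsto_of_tendsto_of_tendsto_of_le_of_le tendsto_const_nhds hup (fun k => ?_)
      fun k => ?_
    · show u ≤ _
      rw [le_div_iff₀ (by positivity)]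
      exact (Nat.lt_floor_add_one _).le
    · show _ / _ ≤ _
      rw [div_le_iff₀ (by positivity), add_mul, one_div, inv_mul_cancel₀ (by positivity)]
      gcongr
      exact Nat.floor_le (by positivity)
  · show u < _ / _
    rw [lt_div_iff₀ (by positivity)]
    exact Nat.lt_floor_add_one _

/-- By right continuity the process is a pointwise limit of processes that are constant in time
between grid points. Joint measurability is needed for Fubini in Dynkin's formula. -/
theorem IsDynamicASEP.measurable_joint (hs : IsDynamicASEP q α P ℱ s) :
    Measurable (fun p : ℝ≥0 × Ω => s p.1 p.2) := by
  refine Measurable.subtype_mk (measurable_pi_lambda _ fun x => ?_)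
  refine measurable_of_tendsto_metrizable (f := fun (k : ℕ) (p : ℝ≥0 × Ω) =>
    (s (((⌊p.1 * ((k : ℝ≥0) + 1)⌋₊ : ℝ≥0) + 1) / ((k : ℝ≥0) + 1)) p.2).1 x) (fun k => ?_) ?_
  · have h : ∀ g : ℕ → Ω → ℤ, (∀ j, Measurable (g j)) →
        Measurable fun p : ℝ≥0 × Ω => g ⌊p.1 * ((k : ℝ≥0) + 1)⌋₊ p.2 := fun g hg =>
      (measurable_from_prod_countable_right (f := fun p : ℕ × Ω => g p.1 p.2) hg).comp
        ((Nat.measurable_floor.comp (measurable_fst.mul_const _)).prodMk measurable_snd)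
    exact h (fun j ω => (s (((j : ℝ≥0) + 1) / ((k : ℝ≥0) + 1)) ω).1 x) fun j =>
      (measurable_pi_apply x).comp (measurable_subtype_coe.comp (hs.measurable_eval _))
  · rw [tendsto_pi_nhds]
    rintro ⟨u, ω⟩
    exact tendsto_nhds_of_eventually_eq ((tendsto_floor_grid u).eventually (hs.right_cont ω x u))

theorem IsDynamicASEP.measurable_comp (hs : IsDynamicASEP q α P ℱ s) {f : Height → ℝ}
    (hf : IsLocal f) : Measurable (fun p : ℝ × Ω => f (s p.1.toNNReal p.2)) :=
  hf.measurable.comp (hs.measurable_joint.comp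
    ((measurable_real_toNNReal.comp measurable_fst).prodMk measurable_snd))

/-- The expectation of an observable at time `t`. -/
def expectAt (P : Measure Ω) (s : ℝ≥0 → Ω → Height) (f : Height → ℝ) (t : ℝ) : ℝ :=
  ∫ ω, f (s t.toNNReal ω) ∂P

theorem IsDynamicASEP.measurable_expectAt [IsProbabilityMeasure P] (hs : IsDynamicASEP q α P ℱ s)
    {f : Height → ℝ} (hf : IsLocal f) : Measurable (expectAt P s f) :=
  (hs.measurable_comp hf).stronglyMeasurable.integral_prod_right'.measurable

/-- Dynkin's formula: the martingale starts at zero and so has mean zero, and Fubini exchanges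
expectation and time integral. -/
theorem IsDynamicASEP.expectAt_eq_of_bounded [IsProbabilityMeasure P] (hq : 0 < q) (hq1 : q < 1)
    (hα : 0 < α) (hs : IsDynamicASEP q α P ℱ s) {f : Height → ℝ} (hf : IsLocal f)
    (hb : ∃ C : ℝ, ∀ σ, |f σ| ≤ C) {t : ℝ} (ht : 0 ≤ t) :
    expectAt P s f t = expectAt P s f 0 + ∫ u in (0 : ℝ)..t, expectAt P s (dynGen q α f) u := by
  lift t to ℝ≥0 using ht
  have hM := hs.martingale f hf hb
  obtain ⟨C', hC'⟩ := hf.bounded_dynGen hq hq1 hα hb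
  obtain ⟨C, hC⟩ := hb
  have hi : ∀ u : ℝ≥0, Integrable (fun ω => f (s u ω)) P := fun u =>
    Integrable.of_bound (hf.measurable.comp (hs.measurable_eval u)).aestronglyMeasurable C
      (Eventually.of_forall fun ω => hC _)
  have h0 := hM.setIntegral_eq (zero_le (a := t)) (s := Set.univ) MeasurableSet.univ
  simp only [Measure.restrict_univ, NNReal.coe_zero, intervalIntegral.integral_same, sub_self,
    integral_zero] at h0
  have : IsFiniteMeasure (volume.restrict (Set.uIoc (0 : ℝ) t)) :=
    ⟨by rw [Measure.restrict_apply_univ]; exact measure_Ioc_lt_top⟩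
  have hprod : Integrable (Function.uncurry fun (ω : Ω) (u : ℝ) =>
      dynGen q α f (s u.toNNReal ω)) (P.prod (volume.restrict (Set.uIoc (0 : ℝ) t))) := by
    refine Integrable.of_bound ((hs.measurable_comp (hf.dynGen q α)).comp
      measurable_swap).aestronglyMeasurable C' (Eventually.of_forall fun p => hC' _)
  have hint : Integrable (fun ω => ∫ u in (0 : ℝ)..(t : ℝ), dynGen q α f (s u.toNNReal ω)) P := by
    have := hprod.integral_prod_left
    simpa [intervalIntegral.intervalIntegral_eq_integral_uIoc] using this
  rw [integral_sub (f := fun ω => f (s t ω) - f (s 0 ω)) ((hi t).sub (hi 0)) hint,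
    integral_sub (hi t) (hi 0)] at h0
  have hswap : ∫ ω, (∫ u in (0 : ℝ)..(t : ℝ), dynGen q α f (s u.toNNReal ω)) ∂P =
      ∫ u in (0 : ℝ)..(t : ℝ), expectAt P s (dynGen q α f) u := by
    simp only [intervalIntegral.intervalIntegral_eq_integral_uIoc, NNReal.coe_nonneg, if_true,
      one_smul, expectAt]
    exact integral_integral_swap hprod
  rw [hswap] at h0
  simp only [expectAt, Real.toNNReal_coe, Real.toNNReal_zero]
  simp only [expectAt] at h0
  linarith

/-- The second identity makes `g` a primitive, hence continuous, and the fundamental theorem then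
applies to the first. For this reason Dynkin's formula is used both for an observable and for its
image under the generator. -/
theorem hasDerivWithinAt_of_integral_eq {e g k : ℝ → ℝ}
    (he : ∀ t, 0 ≤ t → e t = e 0 + ∫ u in (0 : ℝ)..t, g u)
    (hg : ∀ t, 0 ≤ t → g t = g 0 + ∫ u in (0 : ℝ)..t, k u)
    (hk : ∀ a b, IntervalIntegrable k volume a b) {t : ℝ} (ht : 0 ≤ t) :
    HasDerivWithinAt e (g t) (Set.Ici 0) t := by
  -- The identity for `g` holds only on `[0, ∞)`; this primitive extends it continuously to the
  -- whole line.
  have hc : Continuous fun t : ℝ => g 0 + ∫ u in (0 : ℝ)..t, k u :=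
    continuous_const.add (intervalIntegral.continuous_primitive hk 0)
  have hd := (hc.integral_hasStrictDerivAt 0 t).hasDerivAt.const_add (e 0)
  rw [hg t ht]
  refine hd.hasDerivWithinAt.congr (fun x hx => ?_) ?_
  · rw [he x hx]
    congr 1
    refine intervalIntegral.integral_congr fun u hu => hg u ?_
    rw [Set.uIcc_of_le hx] at hu
    exact hu.1
  · rw [he t ht]
    congr 1
    refine intervalIntegral.integral_congr fun u hu => hg u ?_
    rw [Set.uIcc_of_le ht] at hu
    exact hu.1

theorem intervalIntegrable_of_measurable_of_bound {k : ℝ → ℝ} (hm : Measurable k) {b : ℝ → ℝ}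
    (hb : Monotone b) (h : ∀ t, |k t| ≤ b t) (x y : ℝ) : IntervalIntegrable k volume x y := by
  rw [intervalIntegrable_iff]
  refine IntegrableOn.of_bound measure_Ioc_lt_top hm.aestronglyMeasurable (b (max x y)) ?_
  filter_upwards [ae_restrict_mem measurableSet_uIoc] with u hu
  exact (h u).trans (hb hu.2)

theorem IsDynamicASEP.hasDerivWithinAt_of_bounded [IsProbabilityMeasure P] (hq : 0 < q)
    (hq1 : q < 1) (hα : 0 < α) (hs : IsDynamicASEP q α P ℱ s) {f : Height → ℝ} (hf : IsLocal f)
    (hb : ∃ C : ℝ, ∀ σ, |f σ| ≤ C) {t : ℝ} (ht : 0 ≤ t) :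
    HasDerivWithinAt (expectAt P s f) (expectAt P s (dynGen q α f) t) (Set.Ici 0) t := by
  have hf' := hf.dynGen q α
  have hb' := hf.bounded_dynGen hq hq1 hα hb
  have hf'' := hf'.dynGen q α
  obtain ⟨C, hC⟩ := hf'.bounded_dynGen hq hq1 hα hb'
  refine hasDerivWithinAt_of_integral_eq
    (fun t ht => hs.expectAt_eq_of_bounded hq hq1 hα hf hb ht)
    (fun t ht => hs.expectAt_eq_of_bounded hq hq1 hα hf' hb' ht)
    (intervalIntegrable_of_measurable_of_bound (hs.measurable_expectAt hf'') (b := fun _ => C)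
      monotone_const fun t => ?_) ht
  have := norm_integral_le_of_norm_le_const (μ := P)
    (f := fun ω => dynGen q α (dynGen q α f) (s t.toNNReal ω)) (Eventually.of_forall fun ω => hC _)
  simpa [expectAt] using this

/-- Exponential moments of the height at the origin, truncated at `M`. -/
theorem IsDynamicASEP.expectAt_min_exp_le [IsProbabilityMeasure P] (hq : 0 < q)
    (hq1 : q < 1) (hα : 0 < α) (hs : IsDynamicASEP q α P ℱ s) {B : ℝ}
    (hB : ∀ᵐ ω ∂P, |((s 0 ω).1 0 : ℝ)| ≤ B) {c : ℝ} (hc : 0 ≤ c) {M : ℝ} (hM : 0 ≤ M) {t : ℝ}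
    (ht : 0 ≤ t) :
    expectAt P s (fun σ => min (Real.exp (c * |(σ.1 0 : ℝ)|)) M) t ≤
      Real.exp (c * B) * Real.exp (2 * (Real.exp (2 * c) + 1) * t) := by
  set W : Height → ℝ := fun σ => min (Real.exp (c * |(σ.1 0 : ℝ)|)) M with hWdef
  have hW0 : ∀ σ, 0 ≤ W σ := fun σ => le_min (Real.exp_pos _).le hM
  have hWl : LocalOn {0} W := fun σ σ' h => by simp only [hWdef, h 0 (by simp)]
  have hWb : ∀ σ, |W σ| ≤ M := fun σ => by rw [abs_of_nonneg (hW0 σ)]; exact min_le_right _ _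
  -- Truncation at `M` keeps the growth factor `exp (2c)`, since this factor is at least one.
  have hgrow : ∀ σ σ' : Height, |σ'.1 0 - σ.1 0| ≤ 2 → W σ' ≤ Real.exp (2 * c) * W σ := by
    intro σ σ' h
    have h1 := exp_abs_height_le hc h
    have h2 : 1 ≤ Real.exp (2 * c) := Real.one_le_exp (by positivity)
    rcases min_cases (Real.exp (c * |(σ.1 0 : ℝ)|)) M with h3 | h3
    · exact (min_le_left _ _).trans (by simpa [hWdef, h3.1] using h1)
    · refine (min_le_right _ _).trans ?_
      simp only [hWdef, h3.1]
      nlinarith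
  set K : ℝ := 2 * (Real.exp (2 * c) + 1) with hK
  have hgen : ∀ σ, |dynGen q α W σ| ≤ K * W σ := fun σ => by
    have := LocalOn.abs_dynGen_le hq hq1 hα hWl (W := W) (fun σ => by rw [abs_of_nonneg (hW0 σ)])
      hgrow (by positivity) σ
    simpa [hK] using this
  have hd : ∀ t, 0 ≤ t →
      HasDerivWithinAt (expectAt P s W) (expectAt P s (dynGen q α W) t) (Set.Ici 0) t :=
    fun t ht => hs.hasDerivWithinAt_of_bounded hq hq1 hα hWl.isLocal ⟨M, hWb⟩ ht
  have hi : ∀ t : ℝ, Integrable (fun ω => W (s t.toNNReal ω)) P := fun u =>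
    Integrable.of_bound (hWl.isLocal.measurable.comp
      (hs.measurable_eval _)).aestronglyMeasurable M (Eventually.of_forall fun ω => hWb _)
  have he0 : ∀ t, 0 ≤ expectAt P s W t := fun t => integral_nonneg fun ω => hW0 _
  have hinit : ‖expectAt P s W 0‖ ≤ Real.exp (c * B) := by
    rw [Real.norm_of_nonneg (he0 0)]
    have : ∀ᵐ ω ∂P, W (s (0 : ℝ).toNNReal ω) ≤ Real.exp (c * B) := by
      filter_upwards [hB] with ω hω
      rw [Real.toNNReal_zero]
      exact (min_le_left _ _).trans (Real.exp_le_exp.2 (by gcongr))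
    simpa [expectAt] using integral_mono_ae (hi 0) (integrable_const (Real.exp (c * B))) this
  -- The rate `K` does not depend on the truncation level `M`, so the resulting bound survives `M →
  -- ∞`.
  have hgr := norm_le_gronwallBound_of_norm_deriv_right_le (f := expectAt P s W)
    (f' := expectAt P s (dynGen q α W)) (δ := Real.exp (c * B)) (K := K) (ε := 0) (a := 0)
    (b := t) (fun u hu => ((hd u hu.1).continuousWithinAt).mono Set.Icc_subset_Ici_self)
    (fun u hu => (hd u hu.1).mono (Set.Ici_subset_Ici.2 hu.1)) hinit
    (fun u _ => by
      rw [add_zero, Real.norm_of_nonneg (he0 u)]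
      refine (norm_integral_le_integral_norm _).trans ?_
      rw [expectAt, ← integral_const_mul]
      refine integral_mono_of_nonneg (Eventually.of_forall fun ω => norm_nonneg _)
        ((hi u).const_mul K) (Eventually.of_forall fun ω => hgen _)) t ⟨ht, le_rfl⟩
  rw [sub_zero, gronwallBound_ε0, Real.norm_of_nonneg (he0 t)] at hgr
  exact hgr

/-- Fatou's lemma removes the truncation from `expectAt_min_exp_le` and yields integrability and the
bound at once. -/
theorem IsDynamicASEP.integrable_exp [IsProbabilityMeasure P] (hq : 0 < q)
    (hq1 : q < 1) (hα : 0 < α) (hs : IsDynamicASEP q α P ℱ s) {B : ℝ}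
    (hB : ∀ᵐ ω ∂P, |((s 0 ω).1 0 : ℝ)| ≤ B) {c : ℝ} (hc : 0 ≤ c) (t : ℝ≥0) :
    Integrable (fun ω => Real.exp (c * |((s t ω).1 0 : ℝ)|)) P ∧
    ∫ ω, Real.exp (c * |((s t ω).1 0 : ℝ)|) ∂P ≤
      Real.exp (c * B) * Real.exp (2 * (Real.exp (2 * c) + 1) * t) := by
  set D := Real.exp (c * B) * Real.exp (2 * (Real.exp (2 * c) + 1) * t) with hD
  have hmeas : ∀ f : Height → ℝ, LocalOn {0} f → Measurable fun ω => f (s t ω) := fun f hf =>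
    hf.isLocal.measurable.comp (hs.measurable_eval t)
  have hE : LocalOn {0} (fun σ => Real.exp (c * |(σ.1 0 : ℝ)|)) := fun σ σ' h => by
    simp only [h 0 (by simp)]
  have hEM : ∀ M : ℝ, LocalOn {0} (fun σ => min (Real.exp (c * |(σ.1 0 : ℝ)|)) M) :=
    fun M σ σ' h => by simp only [h 0 (by simp)]
  have hbound : ∫⁻ ω, ENNReal.ofReal (Real.exp (c * |((s t ω).1 0 : ℝ)|)) ∂P ≤
      ENNReal.ofReal D := by
    have hlim : ∀ ω, Tendsto (fun M : ℕ =>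
        ENNReal.ofReal (min (Real.exp (c * |((s t ω).1 0 : ℝ)|)) (M : ℝ))) atTop
        (𝓝 (ENNReal.ofReal (Real.exp (c * |((s t ω).1 0 : ℝ)|)))) := by
      intro ω
      refine tendsto_nhds_of_eventually_eq ?_
      obtain ⟨N, hN⟩ := exists_nat_ge (Real.exp (c * |((s t ω).1 0 : ℝ)|))
      filter_upwards [eventually_ge_atTop N] with M hM
      rw [min_eq_left (hN.trans (by exact_mod_cast hM))]
    calc _ = ∫⁻ ω, liminf (fun M : ℕ =>
          ENNReal.ofReal (min (Real.exp (c * |((s t ω).1 0 : ℝ)|)) (M : ℝ))) atTop ∂P :=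
          lintegral_congr fun ω => (hlim ω).liminf_eq.symm
      _ ≤ liminf (fun M : ℕ => ∫⁻ ω,
          ENNReal.ofReal (min (Real.exp (c * |((s t ω).1 0 : ℝ)|)) (M : ℝ)) ∂P) atTop :=
          lintegral_liminf_le fun M => (hmeas _ (hEM M)).ennreal_ofReal
      _ ≤ ENNReal.ofReal D := by
          refine liminf_le_of_frequently_le' (Eventually.of_forall fun M => ?_).frequently
          have h0 : ∀ ω, 0 ≤ min (Real.exp (c * |((s t ω).1 0 : ℝ)|)) (M : ℝ) := fun ω =>
            le_min (Real.exp_pos _).le (Nat.cast_nonneg M)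
          rw [← ofReal_integral_eq_lintegral_ofReal
            (Integrable.of_bound (hmeas _ (hEM M)).aestronglyMeasurable M
              (Eventually.of_forall fun ω => by
                rw [Real.norm_of_nonneg (h0 ω)]; exact min_le_right _ _))
            (Eventually.of_forall h0)]
          refine ENNReal.ofReal_le_ofReal ?_
          have := hs.expectAt_min_exp_le hq hq1 hα hB hc (Nat.cast_nonneg M) t.2
          simpa [expectAt] using this
  have hint : Integrable (fun ω => Real.exp (c * |((s t ω).1 0 : ℝ)|)) P := by
    refine ⟨(hmeas _ hE).aestronglyMeasurable, ?_⟩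
    rw [hasFiniteIntegral_iff_ofReal (Eventually.of_forall fun ω => (Real.exp_pos _).le)]
    exact hbound.trans_lt ENNReal.ofReal_lt_top
  refine ⟨hint, ?_⟩
  rw [integral_eq_lintegral_of_nonneg_ae (Eventually.of_forall fun ω => (Real.exp_pos _).le)
    hint.1]
  exact ENNReal.toReal_le_of_le_ofReal (by positivity) hbound

theorem IsDynamicASEP.integrable_of_expLocal [IsProbabilityMeasure P] (hq : 0 < q)
    (hq1 : q < 1) (hα : 0 < α) (hs : IsDynamicASEP q α P ℱ s) {B : ℝ}
    (hB : ∀ᵐ ω ∂P, |((s 0 ω).1 0 : ℝ)| ≤ B) {f : Height → ℝ} (hf : ExpLocal f) (t : ℝ≥0) :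
    Integrable (fun ω => f (s t ω)) P := by
  obtain ⟨hl, C, c, hC, hc, hb⟩ := hf
  exact ((hs.integrable_exp hq hq1 hα hB hc t).1.const_mul C).mono'
    (hl.measurable.comp (hs.measurable_eval t)).aestronglyMeasurable
    (Eventually.of_forall fun ω => hb _)

/-- The bound is uniform over all `t ≤ T`. Negative times are read as time zero, which accounts for
`max T 0`. -/
theorem IsDynamicASEP.abs_expectAt_le [IsProbabilityMeasure P] (hq : 0 < q)
    (hq1 : q < 1) (hα : 0 < α) (hs : IsDynamicASEP q α P ℱ s) {B : ℝ}
    (hB : ∀ᵐ ω ∂P, |((s 0 ω).1 0 : ℝ)| ≤ B) {f : Height → ℝ} {C c : ℝ} (hC : 0 ≤ C) (hc : 0 ≤ c)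
    (hb : ∀ σ : Height, |f σ| ≤ C * Real.exp (c * |(σ.1 0 : ℝ)|)) {t T : ℝ} (htT : t ≤ T) :
    |expectAt P s f t| ≤
      C * (Real.exp (c * B) * Real.exp (2 * (Real.exp (2 * c) + 1) * max T 0)) := by
  obtain ⟨h1, h2⟩ := hs.integrable_exp hq hq1 hα hB hc t.toNNReal
  refine (norm_integral_le_of_norm_le (f := fun ω => f (s t.toNNReal ω)) (h1.const_mul C)
    (Eventually.of_forall fun ω => hb _)).trans ?_
  rw [integral_const_mul]
  refine mul_le_mul_of_nonneg_left (h2.trans ?_) hC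
  rw [Real.coe_toNNReal']
  gcongr

/-- The truncation of an observable to bounded height at the origin. -/
def truncAt (f : Height → ℝ) (M : ℕ) (σ : Height) : ℝ := if |σ.1 0| ≤ M then f σ else 0

/-- The margin `2` keeps the height at the origin below the truncation level also after the flip. -/
theorem jumpDiff_truncAt {f : Height → ℝ} {M : ℕ} {σ : Height} (hM : |σ.1 0| + 2 ≤ M) (x : ℤ)
    {d : ℤ} (hd : |d| ≤ 2) : jumpDiff (truncAt f M) σ x d = jumpDiff f σ x d := by
  unfold jumpDiff
  split_ifs with h
  · have h1 : truncAt f M σ = f σ := if_pos (by omega)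
    have h2 : truncAt f M ⟨_, h⟩ = f ⟨_, h⟩ := by
      refine if_pos ?_
      rcases eq_or_ne (0 : ℤ) x with rfl | hx
      · simp only [Function.update_self]
        have := abs_add_le (σ.1 0) d
        omega
      · simp only [Function.update_of_ne hx]
        omega
    rw [h1, h2]
  · rfl

/-- Dynkin's formula for unbounded observables. The truncations and their images under the generator
obey exponential bounds uniform in `M`, so dominated convergence applies in `ω` and then in time. -/
theorem IsDynamicASEP.expectAt_eq [IsProbabilityMeasure P] (hq : 0 < q)
    (hq1 : q < 1) (hα : 0 < α) (hs : IsDynamicASEP q α P ℱ s) {B : ℝ}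
    (hB : ∀ᵐ ω ∂P, |((s 0 ω).1 0 : ℝ)| ≤ B) {f : Height → ℝ} (hf : ExpLocal f) {t : ℝ}
    (ht : 0 ≤ t) :
    expectAt P s f t = expectAt P s f 0 + ∫ u in (0 : ℝ)..t, expectAt P s (dynGen q α f) u := by
  classical
  obtain ⟨⟨A, hA⟩, C, c, hC, hc, hb⟩ := hf
  -- The origin is added because the truncation reads the height there.
  have hl : LocalOn (insert 0 A) f := LocalOn.mono hA (Finset.subset_insert _ _)
  have htl : ∀ M, LocalOn (insert 0 A) (truncAt f M) := fun M σ σ' h => by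
    rw [truncAt, truncAt, h 0 (Finset.mem_insert_self _ _), hl σ σ' h]
  have htb : ∀ M σ, |truncAt f M σ| ≤ C * Real.exp (c * |(σ.1 0 : ℝ)|) := by
    intro M σ
    unfold truncAt
    split_ifs
    · exact hb σ
    · rw [abs_zero]; positivity
  have htb' : ∀ M : ℕ, ∀ σ, |truncAt f M σ| ≤ C * Real.exp (c * M) := by
    intro M σ
    unfold truncAt
    split_ifs with h
    · refine (hb σ).trans ?_
      have : |(σ.1 0 : ℝ)| ≤ M := by exact_mod_cast h
      gcongr
    · rw [abs_zero]; positivity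
  set K : ℝ := ((insert 0 A).card * (2 * (Real.exp (2 * c) + 1))) * C with hK
  have hgb : ∀ M σ, |dynGen q α (truncAt f M) σ| ≤ K * Real.exp (c * |(σ.1 0 : ℝ)|) := by
    intro M σ
    rw [hK, mul_assoc]
    refine LocalOn.abs_dynGen_le hq hq1 hα (htl M) (htb M) (fun s s' h => ?_) (by positivity) σ
    have := mul_le_mul_of_nonneg_left (exp_abs_height_le hc h) hC
    linarith
  have hlim1 : ∀ u : ℝ, Tendsto (fun M => expectAt P s (truncAt f M) u) atTop
      (𝓝 (expectAt P s f u)) := by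
    intro u
    refine tendsto_integral_of_dominated_convergence
      (fun ω => C * Real.exp (c * |((s u.toNNReal ω).1 0 : ℝ)|))
      (fun M => ((htl M).isLocal.measurable.comp (hs.measurable_eval _)).aestronglyMeasurable)
      ((hs.integrable_exp hq hq1 hα hB hc _).1.const_mul C)
      (fun M => Eventually.of_forall fun ω => htb M _) (Eventually.of_forall fun ω => ?_)
    refine tendsto_nhds_of_eventually_eq ?_
    filter_upwards [eventually_ge_atTop (|(s u.toNNReal ω).1 0|.toNat)] with M hM
    exact if_pos (by omega)
  have hlim2 : ∀ u : ℝ, Tendsto (fun M => expectAt P s (dynGen q α (truncAt f M)) u) atTop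
      (𝓝 (expectAt P s (dynGen q α f) u)) := by
    intro u
    refine tendsto_integral_of_dominated_convergence
      (fun ω => K * Real.exp (c * |((s u.toNNReal ω).1 0 : ℝ)|))
      (fun M => (((htl M).isLocal.dynGen q α).measurable.comp
        (hs.measurable_eval _)).aestronglyMeasurable)
      ((hs.integrable_exp hq hq1 hα hB hc _).1.const_mul K)
      (fun M => Eventually.of_forall fun ω => hgb M _) (Eventually.of_forall fun ω => ?_)
    refine tendsto_nhds_of_eventually_eq ?_
    filter_upwards [eventually_ge_atTop ((|(s u.toNNReal ω).1 0| + 2).toNat)] with M hM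
    have hM' : |(s u.toNNReal ω).1 0| + 2 ≤ M := by omega
    rw [(htl M).dynGen_eq_sum, hl.dynGen_eq_sum]
    exact Finset.sum_congr rfl fun x _ => by
      rw [jumpDiff_truncAt hM' x (by simp), jumpDiff_truncAt hM' x (by simp)]
  have hlim3 : Tendsto (fun M => ∫ u in (0 : ℝ)..t, expectAt P s (dynGen q α (truncAt f M)) u)
      atTop (𝓝 (∫ u in (0 : ℝ)..t, expectAt P s (dynGen q α f) u)) := by
    refine intervalIntegral.tendsto_integral_filter_of_dominated_convergence
      (fun _ => K * (Real.exp (c * B) * Real.exp (2 * (Real.exp (2 * c) + 1) * max t 0)))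
      (Eventually.of_forall fun M =>
        (hs.measurable_expectAt ((htl M).isLocal.dynGen q α)).aestronglyMeasurable)
      (Eventually.of_forall fun M => Eventually.of_forall fun u hu => ?_)
      intervalIntegrable_const (Eventually.of_forall fun u _ => hlim2 u)
    rw [Set.uIoc_of_le ht] at hu
    exact hs.abs_expectAt_le hq hq1 hα hB (by positivity) hc (hgb M) hu.2
  refine tendsto_nhds_unique (hlim1 t) (((hlim1 0).add hlim3).congr fun M => ?_)
  exact (hs.expectAt_eq_of_bounded hq hq1 hα (htl M).isLocal ⟨_, htb' M⟩ ht).symm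

theorem IsDynamicASEP.hasDerivWithinAt_expectAt [IsProbabilityMeasure P] (hq : 0 < q)
    (hq1 : q < 1) (hα : 0 < α) (hs : IsDynamicASEP q α P ℱ s) {B : ℝ}
    (hB : ∀ᵐ ω ∂P, |((s 0 ω).1 0 : ℝ)| ≤ B) {f : Height → ℝ} (hf : ExpLocal f) {t : ℝ}
    (ht : 0 ≤ t) :
    HasDerivWithinAt (expectAt P s f) (expectAt P s (dynGen q α f) t) (Set.Ici 0) t := by
  have hf' := hf.dynGen hq hq1 hα
  obtain ⟨hl, C, c, hC, hc, hb⟩ := hf'.dynGen hq hq1 hα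
  refine hasDerivWithinAt_of_integral_eq
    (fun t ht => hs.expectAt_eq hq hq1 hα hB hf ht)
    (fun t ht => hs.expectAt_eq hq hq1 hα hB hf' ht)
    (intervalIntegrable_of_measurable_of_bound (hs.measurable_expectAt hl) (b := fun T =>
      C * (Real.exp (c * B) * Real.exp (2 * (Real.exp (2 * c) + 1) * max T 0)))
      (fun x y hxy => by dsimp only; gcongr) fun t => hs.abs_expectAt_le hq hq1 hα hB hC hc hb le_rfl) ht

end Dynamics

end DynASEP

end

noncomputable section

namespace DynASEP

/-! ### The duality function -/

/-- The monomial `q^{-(h+x)/2}`; the monomial `q^{(h-x)/2}` is `mono q x (-h)`. -/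
def mono (q : ℝ) (x h : ℤ) : ℝ := q ^ ((-(h : ℝ) - (x : ℝ)) / 2)

/-- The factor of the duality function of the particle with label `k` at a site `x` of height `h`. -/
def fac (q α : ℝ) (k : ℕ) (x h : ℤ) : ℝ :=
  (mono q x h + α⁻¹ * q ^ k) * (mono q x (-h) - q ^ k)

theorem mono_pos {q : ℝ} (hq : 0 < q) (x h : ℤ) : 0 < mono q x h := Real.rpow_pos_of_pos hq _

/-- Between neighbouring sites, and under a flip, `h + x` changes by an even number. The
half-integer powers therefore change by integer powers of `q`, and the duality identities become
rational in the two monomials at one site. -/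
theorem mono_eq {q : ℝ} (hq : 0 < q) {x h x' h' : ℤ} (e : ℤ) (he : h' + x' + 2 * e = h + x) :
    mono q x' h' = mono q x h * q ^ e := by
  rw [mono, mono, ← Real.rpow_intCast, ← Real.rpow_add hq]
  congr 1
  have : (h' : ℝ) + x' + 2 * e = h + x := by exact_mod_cast he
  linarith

theorem mono_mul_mono_neg {q : ℝ} (hq : 0 < q) (x h : ℤ) :
    mono q x h * mono q x (-h) = q ^ (-x) := by
  rw [mono, mono, ← Real.rpow_intCast, ← Real.rpow_add hq]
  congr 1
  push_cast
  ring

theorem dualityZ_eq {n : ℕ} {q α : ℝ} (hq : 0 < q) (x : Config n) (s : Height) :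
    dualityZ q α x s = ∏ k : Fin n, fac q α k (x.1 k) (s.1 (x.1 k)) := by
  unfold dualityZ
  refine Finset.prod_congr rfl fun k _ => ?_
  rw [← mono_mul_mono_neg hq (x.1 k) (s.1 (x.1 k)), fac]
  have h2 : ((s.1 (x.1 k) : ℝ) - (x.1 k : ℝ)) / 2 = (-((-(s.1 (x.1 k)) : ℤ) : ℝ) - x.1 k) / 2 := by
    push_cast; ring
  rw [h2]
  change _ - _ - _ * (mono q (x.1 k) (s.1 (x.1 k)) - _ * mono q (x.1 k) (-(s.1 (x.1 k)))) = _
  ring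

theorem zpow_neg_eq_mono_div {q : ℝ} (hq : 0 < q) (x h : ℤ) :
    q ^ (-h) = mono q x h / mono q x (-h) := by
  rw [eq_div_iff (mono_pos hq _ _).ne', mono_eq hq (x := x) (h := -h) (h' := h) (-h) (by ring),
    mul_comm]

theorem abs_sub_eq_one_iff (a b : ℤ) : |a - b| = 1 ↔ a = b + 1 ∨ a = b - 1 := by
  rw [abs_eq zero_le_one]
  omega

/-- One-particle duality: the flip at a site acts on a factor as the free particle generator. -/
theorem fac_duality {q α : ℝ} (hq : 0 < q) (hα : 0 < α) (k : ℕ) {x h hl hr : ℤ}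
    (h1 : |hr - h| = 1) (h2 : |h - hl| = 1) :
    downRate q α h * (if |hr - (h + -2)| = 1 ∧ |h + -2 - hl| = 1
        then fac q α k x (h + -2) - fac q α k x h else 0)
      + upRate q α h * (if |hr - (h + 2)| = 1 ∧ |h + 2 - hl| = 1
        then fac q α k x (h + 2) - fac q α k x h else 0)
      = (fac q α k (x + -1) hl - fac q α k x h) + q * (fac q α k (x + 1) hr - fac q α k x h) := by
  have hu := mono_pos hq x h
  have hv := mono_pos hq x (-h)
  have hq' := hq.ne'
  have hα' := hα.ne'
  rw [abs_sub_eq_one_iff] at h1 h2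
  simp only [abs_sub_eq_one_iff]
  -- The rates are expressed through the two monomials as well, so that both sides become rational
  -- functions of the same quantities.
  have ed : downRate q α h = q * (α⁻¹ * mono q x (-h) + mono q x h) /
      (α⁻¹ * mono q x (-h) + q * mono q x h) := by
    rw [downRate, zpow_add₀ hq', zpow_one, zpow_neg_eq_mono_div hq x h,
      div_eq_div_iff (by positivity) (by positivity)]
    field_simp
  have eu : upRate q α h = (α⁻¹ * mono q x (-h) + mono q x h) /
      (α⁻¹ * mono q x (-h) + q⁻¹ * mono q x h) := by
    rw [upRate, zpow_sub₀ hq', zpow_one, zpow_neg_eq_mono_div hq x h,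
      div_eq_div_iff (by positivity) (by positivity)]
    field_simp
  have hr' : hr = h + 1 ∨ hr = h - 1 := h1
  have hl' : hl = h - 1 ∨ hl = h + 1 := by omega
  clear h1 h2
  -- The four local shapes: ascending slope, local minimum, local maximum, descending slope. On the
  -- two slopes no flip is possible and the free generator annihilates the factor; at a minimum only
  -- the upward flip, at a maximum only the downward flip contributes.
  rcases hr' with rfl | rfl <;> rcases hl' with rfl | rfl
  · rw [if_neg (by omega), if_neg (by omega)]
    simp only [fac]
    rw [mono_eq hq (x := x) (h := h) (x' := x + -1) (h' := h - 1) 1 (by ring),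
      mono_eq hq (x := x) (h := -h) (x' := x + -1) (h' := -(h - 1)) 0 (by ring),
      mono_eq hq (x := x) (h := h) (x' := x + 1) (h' := h + 1) (-1) (by ring),
      mono_eq hq (x := x) (h := -h) (x' := x + 1) (h' := -(h + 1)) 0 (by ring)]
    simp only [zpow_neg, zpow_one, zpow_zero]
    field_simp
    ring
  · rw [if_neg (by omega), if_pos (by omega), eu]
    simp only [fac]
    rw [mono_eq hq (x := x) (h := h) (x' := x + -1) (h' := h + 1) 0 (by ring),
      mono_eq hq (x := x) (h := -h) (x' := x + -1) (h' := -(h + 1)) 1 (by ring),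
      mono_eq hq (x := x) (h := h) (x' := x + 1) (h' := h + 1) (-1) (by ring),
      mono_eq hq (x := x) (h := -h) (x' := x + 1) (h' := -(h + 1)) 0 (by ring),
      mono_eq hq (x := x) (h := h) (x' := x) (h' := h + 2) (-1) (by ring),
      mono_eq hq (x := x) (h := -h) (x' := x) (h' := -(h + 2)) 1 (by ring)]
    simp only [zpow_neg, zpow_one, zpow_zero]
    generalize mono q x h = u at *
    generalize mono q x (-h) = v at *
    have : α⁻¹ * v + q⁻¹ * u ≠ 0 := by positivity
    generalize α⁻¹ = b at *
    generalize q ^ k = p at *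
    rw [mul_zero, zero_add, div_mul_eq_mul_div, div_eq_iff this]
    field_simp
    ring
  · rw [if_pos (by omega), if_neg (by omega), ed]
    simp only [fac]
    rw [mono_eq hq (x := x) (h := h) (x' := x + -1) (h' := h - 1) 1 (by ring),
      mono_eq hq (x := x) (h := -h) (x' := x + -1) (h' := -(h - 1)) 0 (by ring),
      mono_eq hq (x := x) (h := h) (x' := x + 1) (h' := h - 1) 0 (by ring),
      mono_eq hq (x := x) (h := -h) (x' := x + 1) (h' := -(h - 1)) (-1) (by ring),
      mono_eq hq (x := x) (h := h) (x' := x) (h' := h + -2) 1 (by ring),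
      mono_eq hq (x := x) (h := -h) (x' := x) (h' := -(h + -2)) (-1) (by ring)]
    simp only [zpow_neg, zpow_one, zpow_zero]
    generalize mono q x h = u at *
    generalize mono q x (-h) = v at *
    have : α⁻¹ * v + q * u ≠ 0 := by positivity
    generalize α⁻¹ = b at *
    generalize q ^ k = p at *
    rw [mul_zero, add_zero, div_mul_eq_mul_div, div_eq_iff this]
    field_simp
    ring
  · rw [if_neg (by omega), if_neg (by omega)]
    simp only [fac]
    rw [mono_eq hq (x := x) (h := h) (x' := x + -1) (h' := h + 1) 0 (by ring),
      mono_eq hq (x := x) (h := -h) (x' := x + -1) (h' := -(h + 1)) 1 (by ring),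
      mono_eq hq (x := x) (h := h) (x' := x + 1) (h' := h - 1) 0 (by ring),
      mono_eq hq (x := x) (h := -h) (x' := x + 1) (h' := -(h - 1)) (-1) (by ring)]
    simp only [zpow_neg, zpow_one, zpow_zero]
    field_simp
    ring

/-- The two-body boundary condition for neighbouring factors. -/
theorem fac_boundary {q α : ℝ} (hq : 0 < q) (k : ℕ) {x h hl : ℤ} (h2 : |h - hl| = 1) :
    fac q α k (x + -1) hl * fac q α (k + 1) (x + -1) hl
      - fac q α k x h * fac q α (k + 1) (x + -1) hl
      + q * (fac q α k x h * fac q α (k + 1) x h - fac q α k x h * fac q α (k + 1) (x + -1) hl)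
      = 0 := by
  rw [abs_sub_eq_one_iff] at h2
  have hl' : hl = h - 1 ∨ hl = h + 1 := by omega
  clear h2
  simp only [fac, pow_succ]
  rcases hl' with rfl | rfl
  · rw [mono_eq hq (x := x) (h := h) (x' := x + -1) (h' := h - 1) 1 (by ring),
      mono_eq hq (x := x) (h := -h) (x' := x + -1) (h' := -(h - 1)) 0 (by ring)]
    simp only [zpow_one, zpow_zero]
    ring
  · rw [mono_eq hq (x := x) (h := h) (x' := x + -1) (h' := h + 1) 0 (by ring),
      mono_eq hq (x := x) (h := -h) (x' := x + -1) (h' := -(h + 1)) 1 (by ring)]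
    simp only [zpow_one, zpow_zero]
    ring

theorem prod_update_eq {n : ℕ} {M : Type*} [CommMonoid M] (F : Fin n → ℤ → M) (y : Fin n → ℤ)
    (i : Fin n) (z : ℤ) :
    ∏ j, F j (Function.update y i z j) = F i z * ∏ j ∈ Finset.univ.erase i, F j (y j) := by
  rw [← Finset.mul_prod_erase _ _ (Finset.mem_univ i), Function.update_self]
  congr 1
  exact Finset.prod_congr rfl fun j hj => by
    rw [Function.update_of_ne (Finset.ne_of_mem_erase hj)]

/-- The duality relation between the dynamic ASEP and the `n`-particle ASEP. -/
theorem dynGen_dualityZ {n : ℕ} {q α : ℝ} (hq : 0 < q) (hα : 0 < α) (x : Config n) (s : Height) :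
    dynGen q α (dualityZ q α x) s = asepGen 1 q (fun y : Config n => dualityZ q α y s) x := by
  classical
  set F : Fin n → ℤ → ℝ := fun j z => fac q α j z (s.1 z) with hF
  set R : Fin n → ℝ := fun i => ∏ j ∈ Finset.univ.erase i, F j (x.1 j) with hR
  have hprod : ∀ i, ∏ j, F j (x.1 j) = F i (x.1 i) * R i := fun i =>
    (Finset.mul_prod_erase _ (fun j => F j (x.1 j)) (Finset.mem_univ i)).symm
  have hloc : LocalOn (Finset.univ.image x.1) (dualityZ q α x) := by
    intro σ σ' h
    rw [dualityZ_eq hq, dualityZ_eq hq]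
    exact Finset.prod_congr rfl fun k _ => by
      rw [h (x.1 k) (Finset.mem_image_of_mem _ (Finset.mem_univ k))]
  have hL : dynGen q α (dualityZ q α x) s = ∑ i, R i * ((F i (x.1 i + -1) - F i (x.1 i))
      + q * (F i (x.1 i + 1) - F i (x.1 i))) := by
    -- The particles occupy distinct sites, so the sum over sites is a sum over particles, and a
    -- flip at `x_i` alters the `i`-th factor alone.
    rw [hloc.dynGen_eq_sum, Finset.sum_image fun a _ b _ h => x.2.injective h]
    refine Finset.sum_congr rfl fun i _ => ?_
    have hj : ∀ d : ℤ, jumpDiff (dualityZ q α x) s (x.1 i) d =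
        R i * (if |s.1 (x.1 i + 1) - (s.1 (x.1 i) + d)| = 1 ∧
          |s.1 (x.1 i) + d - s.1 (x.1 i - 1)| = 1
          then fac q α i (x.1 i) (s.1 (x.1 i) + d) - fac q α i (x.1 i) (s.1 (x.1 i)) else 0) := by
      intro d
      rw [jumpDiff]
      by_cases hc : ∀ y : ℤ, |Function.update s.1 (x.1 i) (s.1 (x.1 i) + d) (y + 1)
          - Function.update s.1 (x.1 i) (s.1 (x.1 i) + d) y| = 1
      · rw [dif_pos hc, if_pos ((update_mem_height_iff _ _ _).1 hc), dualityZ_eq hq,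
          dualityZ_eq hq, hprod i, ← Finset.mul_prod_erase _ _ (Finset.mem_univ i)]
        simp only [Function.update_self]
        have : ∏ j ∈ Finset.univ.erase i, fac q α j (x.1 j)
            (Function.update s.1 (x.1 i) (s.1 (x.1 i) + d) (x.1 j)) = R i :=
          Finset.prod_congr rfl fun j hj => by
            rw [Function.update_of_ne fun h => Finset.ne_of_mem_erase hj (x.2.injective h)]
        rw [this]
        ring
      · rw [dif_neg hc, if_neg (mt (update_mem_height_iff _ _ _).2 hc), mul_zero]
    rw [hj, hj]
    have h2 := s.2 (x.1 i - 1)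
    rw [sub_add_cancel] at h2
    have := fac_duality hq hα i (x := x.1 i) (s.2 (x.1 i)) h2
    simp only [hF]
    rw [← sub_eq_add_neg (x.1 i) 1] at this ⊢
    linear_combination R i * this
  have hZ : (fun y : Config n => dualityZ q α y s) = fun y : Config n =>
      (fun z : Fin n → ℤ => ∏ j, F j (z j)) y.1 := funext fun y => dualityZ_eq hq y s
  rw [hZ, hL]
  cases n with
  | zero => simp [asepGen]
  | succ m =>
    refine Eq.trans ?_ (asepGen_eq_free 1 q (fun z => ∏ j, F j (z j)) x ?_).symm
    · refine Finset.sum_congr rfl fun i _ => ?_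
      simp only [prod_update_eq, hprod i, smul_eq_mul]
      change _ = 1 * (_ * R i - _) + q * (_ * R i - _)
      ring
    · intro k hk
      have hne : k.succ ≠ k.castSucc := (Fin.castSucc_lt_succ (i := k)).ne'
      -- All factors other than those of the adjacent pair are common to the four terms of the
      -- boundary condition, which reduces to `fac_boundary`.
      set S : ℝ := ∏ j ∈ (Finset.univ.erase k.castSucc).erase k.succ, F j (x.1 j) with hS
      have r1 : R k.castSucc = F k.succ (x.1 k.succ) * S :=
        (Finset.mul_prod_erase _ (fun j => F j (x.1 j)) (by simp [hne])).symm
      have r2 : R k.succ = F k.castSucc (x.1 k.castSucc) * S := by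
        rw [hS, Finset.erase_right_comm]
        exact (Finset.mul_prod_erase _ (fun j => F j (x.1 j)) (by simp [hne.symm])).symm
      have h2 := s.2 (x.1 k.castSucc - 1)
      rw [sub_add_cancel, sub_eq_add_neg (x.1 k.castSucc)] at h2
      have hb := fac_boundary (α := α) hq k (x := x.1 k.castSucc) h2
      simp only [prod_update_eq, hprod k.castSucc, smul_eq_mul]
      change 1 * (_ * R k.castSucc - _) + q * (_ * R k.succ - _) = 0
      rw [r1, r2, hk]
      simp only [hF, Fin.val_castSucc, Fin.val_succ, sub_eq_add_neg]
      simp only [neg_add_cancel_right]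
      linear_combination S * hb

/-! ### Growth of the duality function -/

theorem abs_height_le (s : Height) (x : ℤ) : |s.1 x| ≤ |s.1 0| + |x| := by
  have h : ∀ n : ℕ, |s.1 n| ≤ |s.1 0| + n ∧ |s.1 (-n)| ≤ |s.1 0| + n := by
    intro n
    induction n with
    | zero => simp
    | succ n ih =>
      have h1 := s.2 n
      have h2 := s.2 (-(n : ℤ) - 1)
      rw [sub_add_cancel] at h2
      have e : (-((n + 1 : ℕ) : ℤ)) = -(n : ℤ) - 1 := by push_cast; ring
      rw [e]
      push_cast
      have h3 := abs_sub_abs_le_abs_sub (s.1 (n + 1)) (s.1 n)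
      have h4 := abs_sub_abs_le_abs_sub (s.1 (-(n : ℤ) - 1)) (s.1 (-n))
      rw [abs_sub_comm] at h4
      omega
  rcases le_total 0 x with hx | hx
  · have := (h x.toNat).1
    rw [Int.toNat_of_nonneg hx] at this
    rwa [abs_of_nonneg hx]
  · have := (h (-x).toNat).2
    rw [Int.toNat_of_nonneg (by omega), neg_neg] at this
    rwa [abs_of_nonpos hx]

theorem mono_le {q : ℝ} (hq : 0 < q) (hq1 : q < 1) (x h : ℤ) :
    mono q x h ≤ Real.exp (-Real.log q * ((|(h : ℝ)| + |(x : ℝ)|) / 2)) := by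
  rw [mono, Real.rpow_def_of_pos hq]
  refine Real.exp_le_exp.2 ?_
  have hl : Real.log q < 0 := Real.log_neg hq hq1
  have h1 := le_abs_self (h : ℝ)
  have h2 := le_abs_self (x : ℝ)
  nlinarith

theorem abs_fac_le {q α : ℝ} (hq : 0 < q) (hq1 : q < 1) (hα : 0 < α) (k : ℕ) (x h : ℤ) :
    |fac q α k x h| ≤ 2 * (1 + α⁻¹) * Real.exp (-Real.log q * (|(h : ℝ)| + |(x : ℝ)|)) := by
  have hl : 0 ≤ -Real.log q := by linarith [Real.log_neg hq hq1]
  have hp : q ^ k ≤ 1 := pow_le_one₀ hq.le hq1.le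
  have hp0 : 0 < q ^ k := by positivity
  have h1 := mono_le hq hq1 x h
  have h2 := mono_le hq hq1 x (-h)
  have m1 := mono_pos hq x h
  have m2 := mono_pos hq x (-h)
  push_cast at h2
  rw [abs_neg] at h2
  set E := Real.exp (-Real.log q * ((|(h : ℝ)| + |(x : ℝ)|) / 2)) with hE
  have hE1 : 1 ≤ E := Real.one_le_exp (by positivity)
  have hEE : Real.exp (-Real.log q * (|(h : ℝ)| + |(x : ℝ)|)) = E * E := by
    rw [hE, ← Real.exp_add]; congr 1; ring
  have hi : 0 < α⁻¹ := by positivity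
  rw [fac, abs_mul, hEE]
  have a1 : |mono q x h + α⁻¹ * q ^ k| ≤ (1 + α⁻¹) * E := by
    rw [abs_of_pos (by positivity)]
    have : α⁻¹ * q ^ k ≤ α⁻¹ * E := by gcongr; linarith
    linarith
  have a2 : |mono q x (-h) - q ^ k| ≤ 2 * E := by
    rw [abs_le]
    constructor <;> linarith
  calc _ ≤ ((1 + α⁻¹) * E) * (2 * E) := mul_le_mul a1 a2 (abs_nonneg _) (by positivity)
    _ = _ := by ring

/-- The bound separates the dependence on `x`, which puts the expectations in the uniqueness class,
from that on the height at the origin, whose exponential moments are finite. -/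
theorem abs_dualityZ_le {n : ℕ} {q α : ℝ} (hq : 0 < q) (hq1 : q < 1) (hα : 0 < α) (x : Config n)
    (s : Height) :
    |dualityZ q α x s| ≤ ((2 * (1 + α⁻¹)) ^ n *
      Real.exp (2 * -Real.log q * ∑ i, |(x.1 i : ℝ)|)) *
        Real.exp (n * -Real.log q * |(s.1 0 : ℝ)|) := by
  have hl : 0 ≤ -Real.log q := by linarith [Real.log_neg hq hq1]
  rw [dualityZ_eq hq, Finset.abs_prod]
  have : ∀ k ∈ (Finset.univ : Finset (Fin n)), |fac q α k (x.1 k) (s.1 (x.1 k))| ≤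
      2 * (1 + α⁻¹) * Real.exp (-Real.log q * (|(s.1 0 : ℝ)| + 2 * |(x.1 k : ℝ)|)) := by
    intro k _
    refine (abs_fac_le hq hq1 hα k _ _).trans ?_
    have h : |(s.1 (x.1 k) : ℝ)| ≤ |(s.1 0 : ℝ)| + |(x.1 k : ℝ)| := by
      exact_mod_cast abs_height_le s (x.1 k)
    exact mul_le_mul_of_nonneg_left (Real.exp_le_exp.2
      (mul_le_mul_of_nonneg_left (by linarith) hl)) (by positivity)
  refine (Finset.prod_le_prod (fun _ _ => abs_nonneg _) this).trans (le_of_eq ?_)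
  rw [Finset.prod_mul_distrib, ← Real.exp_sum, mul_assoc, ← Real.exp_add]
  congr 1
  · simp
  · congr 1
    rw [← Finset.mul_sum, Finset.sum_add_distrib, ← Finset.mul_sum]
    simp only [Finset.sum_const, Finset.card_univ, Fintype.card_fin, nsmul_eq_mul]
    ring

theorem expLocal_dualityZ {n : ℕ} {q α : ℝ} (hq : 0 < q) (hq1 : q < 1) (hα : 0 < α)
    (x : Config n) : ExpLocal (dualityZ q α x) := by
  classical
  have hl : 0 ≤ -Real.log q := by linarith [Real.log_neg hq hq1]
  refine ⟨⟨Finset.univ.image x.1, fun σ σ' h => ?_⟩, _, n * -Real.log q, by positivity,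
    by positivity, abs_dualityZ_le hq hq1 hα x⟩
  rw [dualityZ_eq hq, dualityZ_eq hq]
  exact Finset.prod_congr rfl fun k _ => by
    rw [h (x.1 k) (Finset.mem_image_of_mem _ (Finset.mem_univ k))]

/-! ### The expected duality function as a solution of the particle system -/

section Dynamics

variable {Ω : Type*} [mΩ : MeasurableSpace Ω] {q α : ℝ} {P : Measure Ω}
  {ℱ : Filtration ℝ≥0 (inferInstance : MeasurableSpace Ω)} {s : ℝ≥0 → Ω → Height}

/-- The expectations of the duality function solve the ASEP system. -/
theorem IsDynamicASEP.solvesASEP [IsProbabilityMeasure P] (n : ℕ) (hq : 0 < q)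
    (hq1 : q < 1) (hα : 0 < α) (hs : IsDynamicASEP q α P ℱ s) {B : ℝ}
    (hB : ∀ᵐ ω ∂P, |((s 0 ω).1 0 : ℝ)| ≤ B) (a : ℝ) :
    SolvesASEP (n := n) 1 q (fun x => a * expectAt P s (dualityZ q α x) 0)
      (fun t x => a * expectAt P s (dualityZ q α x) t) where
  init _ := rfl
  ode t ht x := by
    have h := (hs.hasDerivWithinAt_expectAt hq hq1 hα hB
      (expLocal_dualityZ hq hq1 hα x) ht).const_mul a
    refine h.congr_deriv ?_
    have hi : ∀ y : Config n, Integrable (fun ω => dualityZ q α y (s t.toNNReal ω)) P := fun y =>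
      hs.integrable_of_expLocal hq hq1 hα hB (expLocal_dualityZ hq hq1 hα y) _
    -- The particle generator is a finite combination of differences of integrable functions, so it
    -- commutes with the expectation.
    have hm : ∀ i d, Integrable (fun ω => moveDiff (fun y : Config n =>
        dualityZ q α y (s t.toNNReal ω)) x i d) P ∧
        a * ∫ ω, moveDiff (fun y : Config n => dualityZ q α y (s t.toNNReal ω)) x i d ∂P =
          moveDiff (fun y : Config n => a * expectAt P s (dualityZ q α y) t) x i d := by
      intro i d
      unfold moveDiff
      split_ifs with hc
      · exact ⟨(hi _).sub (hi x), by rw [integral_sub (hi _) (hi x), mul_sub]; rfl⟩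
      · exact ⟨integrable_zero _ _ _, by simp⟩
    have e : expectAt P s (dynGen q α (dualityZ q α x)) t = ∫ ω, asepGen 1 q
        (fun y : Config n => dualityZ q α y (s t.toNNReal ω)) x ∂P := by
      simp only [expectAt, dynGen_dualityZ hq hα]
    rw [e]
    simp only [asepGen, ← (hm _ _).2, smul_eq_mul]
    rw [integral_finsetSum _ fun i _ => Integrable.fun_add ((hm i (-1)).1.const_mul 1)
      ((hm i 1).1.const_mul q), Finset.mul_sum]
    refine Finset.sum_congr rfl fun i _ => ?_
    rw [integral_add ((hm i _).1.const_mul _) ((hm i _).1.const_mul _), integral_const_mul,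
      integral_const_mul]
    ring

theorem IsDynamicASEP.expGrowth [IsProbabilityMeasure P] (n : ℕ) (hq : 0 < q)
    (hq1 : q < 1) (hα : 0 < α) (hs : IsDynamicASEP q α P ℱ s) {B : ℝ}
    (hB : ∀ᵐ ω ∂P, |((s 0 ω).1 0 : ℝ)| ≤ B) (a : ℝ) :
    ExpGrowth (fun t (x : Config n) => a * expectAt P s (dualityZ q α x) t) := by
  intro T
  have hl : 0 ≤ -Real.log q := by linarith [Real.log_neg hq hq1]
  set c : ℝ := n * -Real.log q with hc
  refine ⟨|a| * ((2 * (1 + α⁻¹)) ^ n *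
    (Real.exp (c * B) * Real.exp (2 * (Real.exp (2 * c) + 1) * max T 0))), 2 * -Real.log q,
    by positivity, by positivity, fun t _ hT x => ?_⟩
  have := hs.abs_expectAt_le hq hq1 hα hB (by positivity) (by positivity)
    (abs_dualityZ_le hq hq1 hα x) hT
  rw [Real.norm_eq_abs, abs_mul, mul_assoc |a|]
  refine mul_le_mul_of_nonneg_left (this.trans (le_of_eq ?_)) (abs_nonneg a)
  ring

end Dynamics

end DynASEP

end

noncomputable section

namespace DynASEP

/-! ### Initial values: step initial data -/

theorem mono_neg_self (q : ℝ) (x : ℤ) : mono q x (-x) = 1 := by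
  simp [mono]

theorem mono_self {q : ℝ} (hq : 0 < q) (x : ℤ) : mono q x x = q ^ (-x) := by
  rw [← mono_mul_mono_neg hq x x, mono_neg_self, mul_one]

theorem fac_zero_self (q α : ℝ) (x : ℤ) : fac q α 0 x x = 0 := by
  simp [fac, mono_neg_self]

/-- If the first particle is at a positive site, both sides have a zero first factor. Otherwise all
sites are nonpositive, where `s_x = -x` makes the first monomial equal to `1`; the first brackets
then multiply to the `q`-Pochhammer symbol. -/
theorem dualityZ_abs {n : ℕ} (hn : 1 ≤ n) {q α : ℝ} (hq : 0 < q) (x : Config n) {s : Height}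
    (hs : ∀ y, s.1 y = |y|) : dualityZ q α x s = qPoch (-α⁻¹) q n * stepInit q x := by
  obtain ⟨m, rfl⟩ : ∃ m, n = m + 1 := ⟨n - 1, by omega⟩
  rw [dualityZ_eq hq, stepInit, qPoch]
  rcases lt_or_ge 0 (x.1 0) with h | h
  · rw [Finset.prod_eq_zero (Finset.mem_univ 0), Finset.prod_eq_zero (Finset.mem_univ 0), mul_zero]
    · rw [if_neg h.not_ge]; simp
    · rw [hs, abs_of_pos h]
      exact fac_zero_self q α _
  · rw [Finset.prod_range, ← Finset.prod_mul_distrib]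
    refine Finset.prod_congr rfl fun k _ => ?_
    have hk : x.1 k ≤ 0 := (x.2.antitone (Fin.zero_le k)).trans h
    rw [if_pos hk, hs, abs_of_nonpos hk, fac, neg_neg, mono_neg_self, mono_self hq]
    ring

theorem qPoch_neg_pos {q a : ℝ} (hq : 0 < q) (ha : 0 < a) (n : ℕ) : 0 < qPoch (-a) q n := by
  refine Finset.prod_pos fun k _ => ?_
  have : 0 < a * q ^ k := by positivity
  linarith

theorem stepE_zero {n : ℕ} (hn : 1 ≤ n) {Ω : Type*} [MeasurableSpace Ω] {q α : ℝ} (hq : 0 < q)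
    (hα : 0 < α) {P : Measure Ω} [IsProbabilityMeasure P] {s : ℝ≥0 → Ω → Height}
    (hs : IsStepData P (s 0)) (x : Config n) : stepE q α P s 0 x = stepInit q x := by
  have h : ∫ ω, dualityZ q α x (s (0 : ℝ).toNNReal ω) ∂P = qPoch (-α⁻¹) q n * stepInit q x := by
    rw [Real.toNNReal_zero, integral_congr_ae (g := fun _ => qPoch (-α⁻¹) q n * stepInit q x)]
    · simp
    · filter_upwards [hs] with ω hω
      exact dualityZ_abs hn hq x hω
  rw [stepE, h, inv_mul_cancel_left₀ (qPoch_neg_pos hq (by positivity) n).ne']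

/-! ### Initial values: half-stationary initial data -/

/-- Scaling `z` by `q` shifts the index of a `q`-Pochhammer product by one, so only a factor at the
end changes. -/
theorem prod_range_succ_mul_add (q z w : ℝ) (a m : ℕ) :
    ∏ j ∈ Finset.range (m + 1), (q * z + w * q ^ (a + j)) =
      q ^ m * (q * z + w * q ^ a) * ∏ j ∈ Finset.range m, (z + w * q ^ (a + j)) := by
  rw [Finset.prod_range_succ', add_zero]
  have : ∀ j ∈ Finset.range m, q * z + w * q ^ (a + (j + 1)) = q * (z + w * q ^ (a + j)) := by
    intro j _
    rw [← add_assoc, pow_succ]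
    ring
  rw [Finset.prod_congr rfl this, Finset.prod_mul_distrib, Finset.prod_const, Finset.card_range]
  ring

/-- One step of the half-stationary chain averages a block of factors to two such blocks. -/
theorem halfTrans_average {q α : ℝ} (hq : 0 < q) (hα : 0 < α) (a m : ℕ) (x h : ℤ) :
    halfTrans q α h (h + 1) * ∏ j ∈ Finset.range (m + 1), fac q α (a + j) (x - 1) (h + 1)
      + halfTrans q α h (h - 1) * ∏ j ∈ Finset.range (m + 1), fac q α (a + j) (x - 1) (h - 1)
    = q ^ m * (q * ∏ j ∈ Finset.range (m + 1), fac q α (a + j) x h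
      + α⁻¹ * q ^ (a + m) * (q ^ (a + m + 1) - q ^ a)
        * ∏ j ∈ Finset.range m, fac q α (a + j) x h) := by
  have hu := mono_pos hq x h
  have hv := mono_pos hq x (-h)
  have hqh : q ^ h = mono q x (-h) / mono q x h := by
    have := zpow_neg_eq_mono_div hq x (-h)
    rwa [neg_neg] at this
  have tp : halfTrans q α h (h + 1) =
      α⁻¹ * mono q x (-h) / (mono q x h + α⁻¹ * mono q x (-h)) := by
    rw [halfTrans, if_pos rfl, hqh, div_eq_div_iff (by positivity) (by positivity)]
    field_simp
  have tm : halfTrans q α h (h - 1) =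
      mono q x h / (mono q x h + α⁻¹ * mono q x (-h)) := by
    rw [halfTrans, if_neg (by omega), if_pos rfl, hqh,
      div_eq_div_iff (by positivity) (by positivity)]
    field_simp
  rw [tp, tm]
  simp only [fac, Finset.prod_mul_distrib]
  -- A step of the chain to the left multiplies the second monomial by `q` if the height rises and
  -- the first if it falls, leaving the other fixed. Only one of the two products is thus shifted,
  -- and the denominator of the transition probabilities cancels in the sum.
  rw [mono_eq hq (x := x) (h := h) (x' := x - 1) (h' := h + 1) 0 (by ring),
    mono_eq hq (x := x) (h := -h) (x' := x - 1) (h' := -(h + 1)) 1 (by ring),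
    mono_eq hq (x := x) (h := h) (x' := x - 1) (h' := h - 1) 1 (by ring),
    mono_eq hq (x := x) (h := -h) (x' := x - 1) (h' := -(h - 1)) 0 (by ring)]
  simp only [zpow_one, zpow_zero, mul_one]
  generalize mono q x h = u at *
  generalize mono q x (-h) = v at *
  have hne : u + α⁻¹ * v ≠ 0 := by positivity
  have e1 := prod_range_succ_mul_add q v (-1) a m
  have e2 := prod_range_succ_mul_add q u α⁻¹ a m
  simp only [neg_one_mul, ← sub_eq_add_neg] at e1
  rw [mul_comm v q, mul_comm u q, e1, e2, Finset.prod_range_succ, Finset.prod_range_succ]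
  generalize ∏ j ∈ Finset.range m, (v - q ^ (a + j)) = V
  generalize ∏ j ∈ Finset.range m, (u + α⁻¹ * q ^ (a + j)) = U
  generalize α⁻¹ = b at *
  rw [div_mul_eq_mul_div, div_mul_eq_mul_div, ← add_div, div_eq_iff hne]
  ring

section Half

variable {Ω : Type*} [mΩ : MeasurableSpace Ω] {q α : ℝ} {P : Measure Ω} {S : Ω → Height}

theorem measurable_height (hS : Measurable S) (x : ℤ) : Measurable fun ω => (S ω).1 x :=
  (measurable_pi_apply x).comp (measurable_subtype_coe.comp hS)

theorem measurableSet_path (hS : Measurable S) (m : ℕ) (p : ℕ → ℤ) :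
    MeasurableSet {ω | ∀ k : ℕ, k ≤ m → (S ω).1 (1 - (k : ℤ)) = p k} := by
  have : {ω | ∀ k : ℕ, k ≤ m → (S ω).1 (1 - (k : ℤ)) = p k} =
      ⋂ k : ℕ, ⋂ _ : k ≤ m, (fun ω => (S ω).1 (1 - (k : ℤ))) ⁻¹' {p k} := by
    ext ω; simp
  rw [this]
  exact MeasurableSet.iInter fun k => MeasurableSet.iInter fun _ =>
    measurable_height hS _ (measurableSet_singleton _)

/-- On the event of a given path up to time `m`, the next step is taken according to the transition
probabilities. -/
theorem IsHalfStationaryData.setIntegral_path [IsProbabilityMeasure P]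
    (hS : Measurable S) (hH : IsHalfStationaryData q α P S) (m : ℕ) (p : ℕ → ℤ) (hp : p 0 = 1)
    (φ : ℤ → ℝ) :
    ∫ ω in {ω | ∀ k : ℕ, k ≤ m → (S ω).1 (1 - (k : ℤ)) = p k}, φ ((S ω).1 (1 - ((m + 1 : ℕ) : ℤ))) ∂P
      = P.real {ω | ∀ k : ℕ, k ≤ m → (S ω).1 (1 - (k : ℤ)) = p k} *
        (halfTrans q α (p m) (p m + 1) * φ (p m + 1)
          + halfTrans q α (p m) (p m - 1) * φ (p m - 1)) := by
  classical
  -- The path `p` continued by the value `z` at time `m + 1`. Comparing path probabilities for `m +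
  -- 1` and `m` isolates the last transition.
  set p' : ℤ → ℕ → ℤ := fun z k => if k ≤ m then p k else z with hp'
  set A : ℤ → Set Ω := fun z => {ω | ∀ k : ℕ, k ≤ m + 1 → (S ω).1 (1 - (k : ℤ)) = p' z k} with hA
  have hAm : ∀ z, MeasurableSet (A z) := fun z => measurableSet_path hS (m + 1) (p' z)
  have hmem : ∀ z ω, ω ∈ A z ↔ (∀ k : ℕ, k ≤ m → (S ω).1 (1 - (k : ℤ)) = p k) ∧
      (S ω).1 (1 - ((m + 1 : ℕ) : ℤ)) = z := by
    intro z ω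
    constructor
    · intro h
      refine ⟨fun k hk => ?_, ?_⟩
      · have := h k (by omega)
        simpa [hp', hk] using this
      · have := h (m + 1) le_rfl
        simpa [hp'] using this
    · rintro ⟨h1, h2⟩ k hk
      rcases Nat.lt_or_ge m k with h | h
      · have : k = m + 1 := by omega
        subst this
        simpa [hp'] using h2
      · simpa [hp', h] using h1 k h
  have hAreal : ∀ z, P.real (A z) =
      P.real {ω | ∀ k : ℕ, k ≤ m → (S ω).1 (1 - (k : ℤ)) = p k} * halfTrans q α (p m) z := by
    intro z
    rw [hA]
    dsimp only
    rw [hH.left (m + 1) (p' z) (by simp [hp', hp]), hH.left m p hp, Finset.prod_range_succ]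
    congr 1
    · refine Finset.prod_congr rfl fun k hk => ?_
      have hk' := Finset.mem_range.1 hk
      simp [hp', hk'.le, Nat.succ_le_of_lt hk']
    · simp [hp']
  -- Slopes are `±1`, so a path has only two continuations.
  have hunion : {ω | ∀ k : ℕ, k ≤ m → (S ω).1 (1 - (k : ℤ)) = p k} =
      A (p m + 1) ∪ A (p m - 1) := by
    ext ω
    rw [Set.mem_union, hmem, hmem, Set.mem_ofPred_eq, ← and_or_left]
    refine ⟨fun h => ⟨h, ?_⟩, fun h => h.1⟩
    have h1 := (S ω).2 (1 - ((m + 1 : ℕ) : ℤ))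
    have e : (1 - ((m + 1 : ℕ) : ℤ)) + 1 = 1 - (m : ℤ) := by push_cast; ring
    rw [e, h m le_rfl, abs_sub_eq_one_iff] at h1
    omega
  have hdisj : Disjoint (A (p m + 1)) (A (p m - 1)) := by
    rw [Set.disjoint_left]
    intro ω h1 h2
    have := ((hmem _ _).1 h1).2.symm.trans ((hmem _ _).1 h2).2
    omega
  have hconst : ∀ z, Set.EqOn (fun ω => φ ((S ω).1 (1 - ((m + 1 : ℕ) : ℤ)))) (fun _ => φ z)
      (A z) := fun z ω h => by
    simp only [((hmem _ _).1 h).2]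
  have hint : ∀ z, IntegrableOn (fun ω => φ ((S ω).1 (1 - ((m + 1 : ℕ) : ℤ)))) (A z) P := fun z =>
    (integrableOn_congr_fun (hconst z) (hAm z)).2 (integrable_const _).integrableOn
  have hval : ∀ z, ∫ ω in A z, φ ((S ω).1 (1 - ((m + 1 : ℕ) : ℤ))) ∂P = P.real (A z) * φ z := by
    intro z
    rw [setIntegral_congr_fun (hAm z) (hconst z), setIntegral_const, smul_eq_mul]
  conv_lhs => rw [hunion]
  rw [setIntegral_union hdisj (hAm _) (hint _) (hint _), hval, hval, hAreal, hAreal]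
  ring

/-- The Markov property in integrated form. There are countably many initial paths; on the event of
each one `G` is constant and `setIntegral_path` gives the mean of the next step. -/
theorem IsHalfStationaryData.integral_step [IsProbabilityMeasure P]
    (hS : Measurable S) (hH : IsHalfStationaryData q α P S) (m : ℕ) {G : Ω → ℝ}
    (hG : ∀ ω ω', (∀ k : ℕ, k ≤ m → (S ω).1 (1 - (k : ℤ)) = (S ω').1 (1 - (k : ℤ))) → G ω = G ω')
    {φ ψ : ℤ → ℝ}
    (hφψ : ∀ h, halfTrans q α h (h + 1) * φ (h + 1) + halfTrans q α h (h - 1) * φ (h - 1) = ψ h)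
    (hi : Integrable (fun ω => G ω * φ ((S ω).1 (1 - ((m + 1 : ℕ) : ℤ)))) P)
    (hi' : Integrable (fun ω => G ω * ψ ((S ω).1 (1 - (m : ℤ)))) P) :
    ∫ ω, G ω * φ ((S ω).1 (1 - ((m + 1 : ℕ) : ℤ))) ∂P =
      ∫ ω, G ω * ψ ((S ω).1 (1 - (m : ℤ))) ∂P := by
  set H : Ω → (Fin (m + 1) → ℤ) := fun ω k => (S ω).1 (1 - ((k : ℕ) : ℤ)) with hHdef
  have hHm : Measurable H := measurable_pi_lambda _ fun k => measurable_height hS _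
  have hcell : ∀ a, MeasurableSet (H ⁻¹' {a}) := fun a => hHm (measurableSet_singleton a)
  have hdisj : Pairwise (Function.onFun Disjoint fun a => H ⁻¹' {a}) := fun a b hab =>
    Disjoint.preimage H (by simpa using hab)
  have huniv : (⋃ a, H ⁻¹' {a}) = Set.univ := by
    ext ω; simp
  have s1 := hasSum_integral_iUnion hcell hdisj (by rw [huniv]; exact hi.integrableOn)
  have s2 := hasSum_integral_iUnion hcell hdisj (by rw [huniv]; exact hi'.integrableOn)
  rw [huniv, setIntegral_univ] at s1 s2
  refine s1.unique ?_
  convert s2 using 1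
  funext a
  rcases (H ⁻¹' {a}).eq_empty_or_nonempty with he | ⟨ω₀, hω₀⟩
  · simp [he]
  set p : ℕ → ℤ := fun k => (S ω₀).1 (1 - (k : ℤ)) with hpdef
  have hset : H ⁻¹' {a} = {ω | ∀ k : ℕ, k ≤ m → (S ω).1 (1 - (k : ℤ)) = p k} := by
    have ha : H ω₀ = a := hω₀
    ext ω
    rw [Set.mem_preimage, Set.mem_singleton_iff, ← ha, Set.mem_ofPred_eq]
    constructor
    · intro h k hk
      exact congrFun h ⟨k, by omega⟩
    · intro h
      funext k
      exact h k (by omega)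
  -- The path probabilities are prescribed only for paths starting at height `1`; the other cells
  -- are null, since the case of length zero gives that start probability one.
  by_cases hp : p 0 = 1
  · have hc := hcell a
    rw [hset] at hc ⊢
    have g1 : ∀ χ : Ω → ℝ, ∫ ω in {ω | ∀ k : ℕ, k ≤ m → (S ω).1 (1 - (k : ℤ)) = p k},
        G ω * χ ω ∂P =
        G ω₀ * ∫ ω in {ω | ∀ k : ℕ, k ≤ m → (S ω).1 (1 - (k : ℤ)) = p k}, χ ω ∂P := by
      intro χ
      rw [← integral_const_mul]
      exact setIntegral_congr_fun hc fun ω hω => by simp only [hG ω ω₀ hω]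
    rw [g1, g1, hH.setIntegral_path hS m p hp φ, hφψ,
      setIntegral_congr_fun (g := fun _ => ψ (p m)) hc fun ω hω => by
        simp only [hω m le_rfl], setIntegral_const, smul_eq_mul]
  · have h0 : P (H ⁻¹' {a}) = 0 := by
      have h1 := hH.left 0 (fun _ => 1) rfl
      rw [Finset.prod_range_zero] at h1
      have h2 := measurableSet_path hS 0 (fun _ => 1)
      have h3 : P.real {ω | ∀ k : ℕ, k ≤ 0 → (S ω).1 (1 - (k : ℤ)) = 1}ᶜ = 0 := by
        rw [probReal_compl_eq_one_sub h2, h1, sub_self]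
      rw [measureReal_eq_zero_iff] at h3
      refine measure_mono_null (fun ω hω => ?_) h3
      rw [hset] at hω
      intro h
      exact hp ((hω 0 (by omega)).symm.trans (h 0 le_rfl))
    rw [setIntegral_measure_zero _ h0, setIntegral_measure_zero _ h0]

theorem IsHalfStationaryData.abs_le (hH : IsHalfStationaryData q α P S) :
    ∀ᵐ ω ∂P, |(S ω).1 0| ≤ 2 := by
  filter_upwards [hH.right] with ω hω
  have h1 := (S ω).2 0
  rw [zero_add, hω 1 le_rfl, abs_sub_eq_one_iff] at h1
  rw [_root_.abs_le]
  omega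

theorem IsHalfStationaryData.integrable_prod_fac [IsProbabilityMeasure P] (hq : 0 < q)
    (hq1 : q < 1) (hα : 0 < α) (hS : Measurable S) (hH : IsHalfStationaryData q α P S)
    (d : ℕ → ℕ) (b : ℕ) :
    Integrable (fun ω => ∏ k ∈ Finset.range b, fac q α k (1 - d k) ((S ω).1 (1 - d k))) P := by
  have hl : 0 ≤ -Real.log q := by linarith [Real.log_neg hq hq1]
  refine Integrable.of_bound (Measurable.aestronglyMeasurable ?_)
    (∏ k ∈ Finset.range b, 2 * (1 + α⁻¹) *
      Real.exp (-Real.log q * (2 + |((1 - d k : ℤ) : ℝ)| + |((1 - d k : ℤ) : ℝ)|))) ?_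
  · exact Finset.measurable_prod _ fun k _ =>
      (measurable_of_countable (fac q α k (1 - d k))).comp (measurable_height hS _)
  · filter_upwards [hH.abs_le] with ω hω
    rw [Real.norm_eq_abs, Finset.abs_prod]
    refine Finset.prod_le_prod (fun _ _ => abs_nonneg _) fun k _ => ?_
    refine (abs_fac_le hq hq1 hα _ _ _).trans ?_
    have h : |((S ω).1 (1 - d k) : ℝ)| ≤ 2 + |((1 - d k : ℤ) : ℝ)| := by
      have := (abs_height_le (S ω) (1 - d k)).trans (add_le_add_left hω _)
      exact_mod_cast this
    exact mul_le_mul_of_nonneg_left (Real.exp_le_exp.2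
      (mul_le_mul_of_nonneg_left (by linarith) hl)) (by positivity)

/-- The half-stationary expectation of a product of factors. -/
theorem IsHalfStationaryData.integral_prod_fac [IsProbabilityMeasure P] (hq : 0 < q)
    (hq1 : q < 1) (hα : 0 < α) (hS : Measurable S) (hH : IsHalfStationaryData q α P S) (m : ℕ) :
    ∀ d : ℕ → ℕ, Monotone d → (∀ k, d k ≤ m) → ∀ b : ℕ,
      ∫ ω, ∏ k ∈ Finset.range b, fac q α k (1 - d k) ((S ω).1 (1 - d k)) ∂P =
        ∏ k ∈ Finset.range b, (α⁻¹ * q ^ k * (q ^ d k - q ^ k)) := by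
  -- Here `d k` is the distance of the `k`-th factor's site to the left of site `1`, and the
  -- induction is on the largest distance. It ranges over weakly monotone `d` and all `b`, because
  -- moving factors to the right merges sites and one of the resulting terms has one factor fewer.
  induction m with
  | zero =>
    intro d _ hd b
    have hd0 : ∀ k, d k = 0 := fun k => Nat.le_zero.1 (hd k)
    cases b with
    | zero => simp
    | succ b =>
      rw [Finset.prod_eq_zero (i := 0) (by simp) (by simp [hd0])]
      refine integral_eq_zero_of_ae ?_
      filter_upwards [hH.right] with ω hω
      refine Finset.prod_eq_zero (i := 0) (by simp) ?_
      rw [hω _ (by simp [hd0])]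
      exact fac_zero_self q α _
  | succ m ih =>
    intro d hdm hd b
    set d' : ℕ → ℕ := fun k => min (d k) m with hd'
    have hdm' : Monotone d' := fun i j hij => min_le_min_right m (hdm hij)
    have ih' := ih d' hdm' fun k => min_le_right _ _
    by_cases hex : ∃ j, j < b ∧ d j = m + 1
    · have hex' : ∃ j, d j = m + 1 := ⟨_, hex.choose_spec.2⟩
      classical
      set j := Nat.find hex' with hj
      have hj1 : d j = m + 1 := Nat.find_spec hex'
      have hjb : j < b := lt_of_le_of_lt (Nat.find_min' hex' hex.choose_spec.2)
        hex.choose_spec.1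
      have hlt : ∀ k, k < j → d k = d' k := by
        intro k hk
        have h1 := Nat.find_min hex' hk
        have h2 := hd k
        simp only [hd']
        omega
      have hge : ∀ k, d (j + k) = m + 1 := fun k => by
        have h1 := hdm (Nat.le_add_right j k)
        have h2 := hd (j + k)
        omega
      have hge' : ∀ k, d' (j + k) = m := fun k => by simp [hd', hge k]
      obtain ⟨l, rfl⟩ : ∃ l, b = j + (l + 1) := ⟨b - j - 1, by omega⟩
      set G : Ω → ℝ := fun ω => ∏ k ∈ Finset.range j, fac q α k (1 - d' k) ((S ω).1 (1 - d' k))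
        with hGdef
      set φ : ℤ → ℝ := fun h => ∏ i ∈ Finset.range (l + 1),
        fac q α (j + i) (1 - ((m + 1 : ℕ) : ℤ)) h with hφ
      set Q : ℕ → ℤ → ℝ := fun r h => ∏ i ∈ Finset.range r, fac q α (j + i) (1 - (m : ℤ)) h
        with hQ
      set c : ℝ := α⁻¹ * q ^ (j + l) * (q ^ (j + l + 1) - q ^ j) with hc
      -- The conditional mean of the block at distance `m + 1`: a combination of blocks of `l + 1`
      -- and of `l` factors at distance `m`, to which the induction hypothesis applies with `b = j +
      -- l + 1` and `b = j + l`.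
      set ψ : ℤ → ℝ := fun h => q ^ l * (q * Q (l + 1) h + c * Q l h) with hψ
      have e1 : ∀ ω, ∏ k ∈ Finset.range (j + (l + 1)), fac q α k (1 - d k) ((S ω).1 (1 - d k)) =
          G ω * φ ((S ω).1 (1 - ((m + 1 : ℕ) : ℤ))) := by
        intro ω
        rw [Finset.prod_range_add]
        congr 1
        · exact Finset.prod_congr rfl fun k hk => by rw [hlt k (Finset.mem_range.1 hk)]
        · exact Finset.prod_congr rfl fun k _ => by rw [hge]
      have e2 : ∀ r ω, ∏ k ∈ Finset.range (j + r), fac q α k (1 - d' k) ((S ω).1 (1 - d' k)) =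
          G ω * Q r ((S ω).1 (1 - (m : ℤ))) := by
        intro r ω
        rw [Finset.prod_range_add]
        congr 1
        exact Finset.prod_congr rfl fun k _ => by rw [hge']
      have i1 := hH.integrable_prod_fac hq hq1 hα hS d (j + (l + 1))
      have i2 := fun r => hH.integrable_prod_fac hq hq1 hα hS d' (j + r)
      simp only [e1] at i1
      simp only [e2] at i2
      have e3 : ∀ ω, G ω * ψ ((S ω).1 (1 - (m : ℤ))) =
          q ^ l * q * (G ω * Q (l + 1) ((S ω).1 (1 - (m : ℤ))))
            + q ^ l * c * (G ω * Q l ((S ω).1 (1 - (m : ℤ)))) := fun ω => by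
        simp only [hψ]; ring
      have i3 : Integrable (fun ω => G ω * ψ ((S ω).1 (1 - (m : ℤ)))) P := by
        simp only [e3]
        exact ((i2 (l + 1)).const_mul _).add ((i2 l).const_mul _)
      have hstep := hH.integral_step hS m (G := G) (φ := φ) (ψ := ψ) (fun ω ω' h => by
        refine Finset.prod_congr rfl fun k _ => ?_
        rw [h (d' k) (min_le_right _ _)]) (fun h => by
        have := halfTrans_average hq hα j l (1 - (m : ℤ)) h
        have e : (1 - ((m + 1 : ℕ) : ℤ)) = 1 - (m : ℤ) - 1 := by push_cast; ring
        simp only [hφ, hψ, e]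
        exact this) i1 i3
      have j1 := ih' (j + (l + 1))
      have j2 := ih' (j + l)
      simp only [e2] at j1 j2
      simp only [e1]
      rw [hstep]
      simp only [e3]
      rw [integral_add ((i2 (l + 1)).const_mul _) ((i2 l).const_mul _), integral_const_mul,
        integral_const_mul, j1, j2, Finset.prod_range_add _ j (l + 1),
        Finset.prod_range_add _ j l, Finset.prod_range_add _ j (l + 1)]
      have e4 : ∏ k ∈ Finset.range j, (α⁻¹ * q ^ k * (q ^ d k - q ^ k)) =
          ∏ k ∈ Finset.range j, (α⁻¹ * q ^ k * (q ^ d' k - q ^ k)) :=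
        Finset.prod_congr rfl fun k hk => by rw [hlt k (Finset.mem_range.1 hk)]
      have e5 := prod_range_succ_mul_add q (q ^ m) (-1) j l
      simp only [neg_one_mul, ← sub_eq_add_neg] at e5
      simp only [hge, hge', pow_succ' q m, e4]
      have e6 : ∀ (r : ℕ) (z : ℝ), ∏ i ∈ Finset.range r, (α⁻¹ * q ^ (j + i) * (z - q ^ (j + i))) =
          (∏ i ∈ Finset.range r, α⁻¹ * q ^ (j + i)) * ∏ i ∈ Finset.range r, (z - q ^ (j + i)) :=
        fun r z => Finset.prod_mul_distrib
      rw [e6, e6, e6, e5, Finset.prod_range_succ, Finset.prod_range_succ, hc]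
      ring
    · push Not at hex
      have hlt : ∀ k ∈ Finset.range b, d k = d' k := by
        intro k hk
        have h1 := hex k (Finset.mem_range.1 hk)
        have h2 := hd k
        simp only [hd']
        omega
      rw [Finset.prod_congr rfl fun k hk => by rw [hlt k hk], ← ih' b]
      refine integral_congr_ae (Eventually.of_forall fun ω => ?_)
      exact Finset.prod_congr rfl fun k hk => by rw [hlt k hk]

theorem halfE_zero {n : ℕ} (hn : 1 ≤ n) {s : ℝ≥0 → Ω → Height} [IsProbabilityMeasure P]
    (hq : 0 < q) (hq1 : q < 1) (hα : 0 < α) (hS : Measurable (s 0))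
    (hH : IsHalfStationaryData q α P (s 0)) (x : Config n) :
    halfE q α P s 0 x = halfInit q x := by
  rw [halfE, Real.toNNReal_zero]
  obtain ⟨m, rfl⟩ : ∃ m, n = m + 1 := ⟨n - 1, by omega⟩
  -- If `x_1 ≥ 1` the height there is deterministic and the first factor vanishes on both sides.
  -- Otherwise all distances `1 - x_k` are positive.
  rcases le_or_gt 1 (x.1 0) with h | h
  · have h1 : halfInit q x = 0 := by
      refine Finset.prod_eq_zero (Finset.mem_univ 0) ?_
      split_ifs with h'
      · have : x.1 0 = 1 := le_antisymm h' h
        simp [this]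
      · simp
    rw [h1, integral_eq_zero_of_ae, mul_zero]
    filter_upwards [hH.right] with ω hω
    rw [dualityZ_eq hq]
    refine Finset.prod_eq_zero (Finset.mem_univ 0) ?_
    rw [hω _ h]
    exact fac_zero_self q α _
  -- The distances are continued by a constant beyond the last particle, since `integral_prod_fac`
  -- takes a sequence on all of `ℕ`.
  · set d : ℕ → ℕ := fun k => (1 - x.1 ⟨min k m, by omega⟩).toNat with hd
    have hneg : ∀ k, x.1 k < 1 := fun k => lt_of_le_of_lt (x.2.antitone (Fin.zero_le k)) h
    have hdm : Monotone d := fun i j hij => by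
      have : x.1 ⟨min j m, by omega⟩ ≤ x.1 ⟨min i m, by omega⟩ :=
        x.2.antitone (by simp only [Fin.mk_le_mk]; omega)
      simp only [hd]
      omega
    have hdb : ∀ k, d k ≤ d m := fun k => by
      rcases le_total k m with hk | hk
      · exact hdm hk
      · simp only [hd, min_eq_right hk, min_self, le_refl]
    have hdk : ∀ k : Fin (m + 1), (d k : ℤ) = 1 - x.1 k := fun k => by
      have e : (⟨min k m, by omega⟩ : Fin (m + 1)) = k := Fin.ext (by simp; omega)
      have := hneg k
      simp only [hd, e]
      omega
    have key := hH.integral_prod_fac hq hq1 hα hS (d m) d hdm hdb (m + 1)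
    simp only [Finset.prod_range, hdk, sub_sub_cancel] at key
    simp only [dualityZ_eq hq]
    rw [key, Finset.prod_mul_distrib, halfInit]
    have e1 : ∏ k : Fin (m + 1), (α⁻¹ * q ^ (k : ℕ)) =
        (α⁻¹) ^ (m + 1) * q ^ ((m + 1) * (m + 1 - 1) / 2) := by
      rw [← Finset.prod_range (fun k => α⁻¹ * q ^ k), Finset.prod_mul_distrib, Finset.prod_const,
        Finset.card_range, Finset.prod_pow_eq_pow_sum, Finset.sum_range_id]
    have e2 : ∏ k : Fin (m + 1), (q ^ d k - q ^ (k : ℕ)) =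
        ∏ k : Fin (m + 1), (q ^ (if x.1 k ≤ 1 then 1 - x.1 k else 0) - q ^ (k : ℕ)) :=
      Finset.prod_congr rfl fun k _ => by
        rw [if_pos (hneg k).le, ← hdk k, zpow_natCast]
    rw [e1, e2, inv_pow]
    have h1 : α ^ (m + 1) ≠ 0 := by positivity
    have h2 : q ^ ((m + 1) * (m + 1 - 1) / 2) ≠ 0 := by positivity
    generalize q ^ ((m + 1) * (m + 1 - 1) / 2) = z at *
    field_simp

end Half

theorem halfInit_eq {n : ℕ} (q : ℝ) (x : Config n) : halfInit q x = stepInit q x.shift := by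
  refine Finset.prod_congr rfl fun k _ => ?_
  simp only [Config.shift, neg_sub, sub_nonpos]

end DynASEP

end

noncomputable section

namespace DynASEP

/-! ### Integrals over the torus of points with all coordinates on one circle around `1` -/

/-- Points with all coordinates on the circle of radius `ρ` around `1`. -/
def torus (n : ℕ) (ρ : ℝ) : Set (Fin n → ℂ) := {y | ∀ i, y i ∈ Metric.sphere (1 : ℂ) ρ}

/-- The integral over `torus n ρ`. -/
def torusI {n : ℕ} (ρ : ℝ) (f : (Fin n → ℂ) → ℂ) : ℂ := torusIntegral f (fun _ => 1) (fun _ => ρ)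

theorem torusMap_mem {n : ℕ} {ρ : ℝ} (hρ : 0 ≤ ρ) (θ : Fin n → ℝ) :
    torusMap (fun _ => 1) (fun _ => ρ) θ ∈ torus n ρ := fun i => by
  simp [torusMap, Complex.norm_exp_ofReal_mul_I, abs_of_nonneg hρ]

theorem continuous_torusMap {n : ℕ} (c : Fin n → ℂ) (R : Fin n → ℝ) : Continuous (torusMap c R) :=
  by unfold torusMap; fun_prop

theorem torusI_congr {n : ℕ} {ρ : ℝ} (hρ : 0 ≤ ρ) {f g : (Fin n → ℂ) → ℂ}
    (h : Set.EqOn f g (torus n ρ)) : torusI ρ f = torusI ρ g := by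
  unfold torusI torusIntegral
  refine setIntegral_congr_fun measurableSet_Icc fun θ _ => ?_
  simp only [h (torusMap_mem hρ θ)]

theorem torusIntegrable_of_continuousOn {n : ℕ} {ρ : ℝ} (hρ : 0 ≤ ρ) {f : (Fin n → ℂ) → ℂ}
    (h : ContinuousOn f (torus n ρ)) : TorusIntegrable f (fun _ => 1) (fun _ => ρ) :=
  (h.comp_continuous (continuous_torusMap _ _) (torusMap_mem hρ)).continuousOn.integrableOn_compact
    isCompact_Icc

theorem torusI_const_mul {n : ℕ} (ρ : ℝ) (a : ℂ) (f : (Fin n → ℂ) → ℂ) :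
    torusI ρ (fun y => a * f y) = a * torusI ρ f := torusIntegral_const_mul _ _ _ _

theorem torusI_add {n : ℕ} {ρ : ℝ} (hρ : 0 ≤ ρ) {f g : (Fin n → ℂ) → ℂ}
    (hf : ContinuousOn f (torus n ρ)) (hg : ContinuousOn g (torus n ρ)) :
    torusI ρ (fun y => f y + g y) = torusI ρ f + torusI ρ g :=
  torusIntegral_add (torusIntegrable_of_continuousOn hρ hf) (torusIntegrable_of_continuousOn hρ hg)

theorem torusI_sub {n : ℕ} {ρ : ℝ} (hρ : 0 ≤ ρ) {f g : (Fin n → ℂ) → ℂ}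
    (hf : ContinuousOn f (torus n ρ)) (hg : ContinuousOn g (torus n ρ)) :
    torusI ρ (fun y => f y - g y) = torusI ρ f - torusI ρ g :=
  torusIntegral_sub (torusIntegrable_of_continuousOn hρ hf) (torusIntegrable_of_continuousOn hρ hg)

theorem torusI_sum {n : ℕ} {ρ : ℝ} (hρ : 0 ≤ ρ) {ι : Type*} (s : Finset ι)
    {f : ι → (Fin n → ℂ) → ℂ} (hf : ∀ i ∈ s, ContinuousOn (f i) (torus n ρ)) :
    torusI ρ (fun y => ∑ i ∈ s, f i y) = ∑ i ∈ s, torusI ρ (f i) := by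
  classical
  induction s using Finset.induction_on with
  | empty => simp [torusI, torusIntegral]
  | insert a s ha ih =>
    simp only [Finset.sum_insert ha]
    rw [torusI_add hρ (hf a (by simp)) (continuousOn_finsetSum _ fun i hi => hf i (by simp [hi])),
      ih fun i hi => hf i (by simp [hi])]

/-- Permuting the angles preserves Lebesgue measure and the cube, and the product of the
differentials is symmetric. -/
theorem torusI_comp_perm {n : ℕ} (ρ : ℝ) (σ : Equiv.Perm (Fin n)) (f : (Fin n → ℂ) → ℂ) :
    torusI ρ (fun y => f (y ∘ σ)) = torusI ρ f := by
  have hmp : MeasurePreserving (MeasurableEquiv.piCongrLeft (fun _ : Fin n => ℝ) σ.symm) :=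
    volume_measurePreserving_piCongrLeft _ _
  have happ : ∀ θ : Fin n → ℝ, MeasurableEquiv.piCongrLeft (fun _ : Fin n => ℝ) σ.symm θ = θ ∘ σ := by
    intro θ
    funext i
    have := MeasurableEquiv.piCongrLeft_apply_apply (β := fun _ => ℝ) σ.symm θ (σ i)
    simpa using this
  have hpre : (MeasurableEquiv.piCongrLeft (fun _ : Fin n => ℝ) σ.symm) ⁻¹'
      (Set.Icc (0 : Fin n → ℝ) fun _ => 2 * Real.pi) = Set.Icc 0 fun _ => 2 * Real.pi := by
    ext θ
    simp only [Set.mem_preimage, happ, Set.mem_Icc, Pi.le_def, Function.comp, Pi.zero_apply]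
    constructor
    · rintro ⟨h1, h2⟩
      exact ⟨fun i => by simpa using h1 (σ.symm i), fun i => by simpa using h2 (σ.symm i)⟩
    · rintro ⟨h1, h2⟩
      exact ⟨fun i => h1 _, fun i => h2 _⟩
  unfold torusI torusIntegral
  conv_rhs => rw [← hmp.map_eq, setIntegral_map_equiv, hpre]
  refine setIntegral_congr_fun measurableSet_Icc fun θ _ => ?_
  simp only [happ]
  congr 1
  exact (Equiv.prod_comp σ fun i => (ρ : ℂ) * Complex.exp (θ i * Complex.I) * Complex.I).symm

/-! ### Elementary inequalities on the circle -/

section Circle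

variable {q ρ : ℝ}

theorem radius_lt_one (hq : 0 < q) (hq1 : q < 1) (hρ : ρ < (1 - q) / (1 + q)) : ρ < 1 :=
  hρ.trans_le ((div_le_one (by linarith)).2 (by linarith))

/-- This is the use of the bound on the radius: in norm, points of the disc are at least `1 - ρ`,
while `q` times such points are at most `q (1 + ρ)`. Hence no denominator `y - q z` vanishes. -/
theorem radius_bound (hq : 0 < q) (hρ : ρ < (1 - q) / (1 + q)) : q * (1 + ρ) < 1 - ρ := by
  rw [lt_div_iff₀ (by linarith)] at hρ
  linarith

theorem norm_bounds {y : ℂ} (hy : y ∈ Metric.closedBall (1 : ℂ) ρ) :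
    1 - ρ ≤ ‖y‖ ∧ ‖y‖ ≤ 1 + ρ := by
  rw [mem_closedBall_iff_norm] at hy
  have h1 := norm_sub_norm_le (1 : ℂ) y
  have h2 := norm_sub_norm_le y 1
  rw [norm_sub_rev] at h1
  rw [norm_one] at h1 h2
  constructor <;> linarith

theorem ne_zero_of_mem (hq : 0 < q) (hq1 : q < 1) (hρ : ρ < (1 - q) / (1 + q)) {y : ℂ}
    (hy : y ∈ Metric.closedBall (1 : ℂ) ρ) : y ≠ 0 := by
  rintro rfl
  have := (norm_bounds hy).1
  rw [norm_zero] at this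
  linarith [radius_lt_one hq hq1 hρ]

theorem sub_mul_ne_zero (hq : 0 < q) (hρ : ρ < (1 - q) / (1 + q)) {y z : ℂ}
    (hy : y ∈ Metric.closedBall (1 : ℂ) ρ) (hz : z ∈ Metric.closedBall (1 : ℂ) ρ) :
    y - q * z ≠ 0 := by
  intro h
  have h1 := (norm_bounds hy).1
  have h2 := (norm_bounds hz).2
  have h3 : ‖y‖ = q * ‖z‖ := by
    rw [sub_eq_zero.1 h, norm_mul, Complex.norm_real, Real.norm_of_nonneg hq.le]
  have h4 := radius_bound hq hρ
  nlinarith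

theorem one_sub_mul_ne_zero (hq : 0 < q) (hρ0 : 0 ≤ ρ) (hρ : ρ < (1 - q) / (1 + q)) {y : ℂ}
    (hy : y ∈ Metric.closedBall (1 : ℂ) ρ) : 1 - q * y ≠ 0 :=
  sub_mul_ne_zero hq hρ (Metric.mem_closedBall_self hρ0) hy

theorem one_sub_ne_zero (hρ0 : 0 < ρ) {y : ℂ} (hy : y ∈ Metric.sphere (1 : ℂ) ρ) : 1 - y ≠ 0 := by
  intro h
  rw [mem_sphere_iff_norm, norm_sub_rev, h, norm_zero] at hy
  linarith

end Circle

/-! ### The integrand -/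

/-- The interaction kernel of the contour integral. -/
def ker {n : ℕ} (q : ℝ) (y : Fin n → ℂ) : ℂ :=
  ∏ i : Fin n, ∏ j ∈ Finset.Ioi i, (y i - y j) / (y i - (q : ℂ) * y j)

/-- The function `ξ(y) = (1 - y)/(1 - q y)`. -/
def xi (q : ℝ) (y : ℂ) : ℂ := (1 - y) / (1 - (q : ℂ) * y)

/-- The eigenvalue of the one-particle generator. -/
def eig (q : ℝ) (y : ℂ) : ℂ := (1 - (q : ℂ)) ^ 2 * y / ((1 - y) * (1 - (q : ℂ) * y))

/-- The time zero integrand. -/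
def integrand {n : ℕ} (q : ℝ) (x : Fin n → ℤ) (y : Fin n → ℂ) : ℂ :=
  ker q y * ∏ i, (xi q (y i) ^ x i / y i)

section Integrand

variable {q ρ : ℝ} {n : ℕ}

theorem continuousOn_ker (hq : 0 < q) (hρ : ρ < (1 - q) / (1 + q)) :
    ContinuousOn (ker (n := n) q) (torus n ρ) := by
  unfold ker
  refine continuousOn_finsetProd _ fun i _ => continuousOn_finsetProd _ fun j _ => ?_
  refine ContinuousOn.div (by fun_prop) (by fun_prop) fun y hy => ?_
  exact sub_mul_ne_zero hq hρ (Metric.sphere_subset_closedBall (hy i))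
    (Metric.sphere_subset_closedBall (hy j))

theorem xi_ne_zero (hq : 0 < q) (hρ0 : 0 < ρ) (hρ : ρ < (1 - q) / (1 + q)) {y : ℂ}
    (hy : y ∈ Metric.sphere (1 : ℂ) ρ) : xi q y ≠ 0 :=
  div_ne_zero (one_sub_ne_zero hρ0 hy)
    (one_sub_mul_ne_zero hq hρ0.le hρ (Metric.sphere_subset_closedBall hy))

theorem continuousOn_xi (hq : 0 < q) (hρ0 : 0 < ρ) (hρ : ρ < (1 - q) / (1 + q)) :
    ContinuousOn (xi q) (Metric.sphere (1 : ℂ) ρ) := by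
  unfold xi
  refine ContinuousOn.div (by fun_prop) (by fun_prop) fun y hy => ?_
  exact one_sub_mul_ne_zero hq hρ0.le hρ (Metric.sphere_subset_closedBall hy)

theorem continuousOn_eig (hq : 0 < q) (hρ0 : 0 < ρ) (hρ : ρ < (1 - q) / (1 + q)) :
    ContinuousOn (eig q) (Metric.sphere (1 : ℂ) ρ) := by
  unfold eig
  refine ContinuousOn.div (by fun_prop) (by fun_prop) fun y hy => ?_
  exact mul_ne_zero (one_sub_ne_zero hρ0 hy)
    (one_sub_mul_ne_zero hq hρ0.le hρ (Metric.sphere_subset_closedBall hy))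

theorem continuousOn_coord {f : ℂ → ℂ} (hf : ContinuousOn f (Metric.sphere (1 : ℂ) ρ)) (i : Fin n) :
    ContinuousOn (fun y : Fin n → ℂ => f (y i)) (torus n ρ) :=
  hf.comp (continuous_apply i).continuousOn fun _ hy => hy i

theorem continuousOn_integrand (hq : 0 < q) (hq1 : q < 1) (hρ0 : 0 < ρ)
    (hρ : ρ < (1 - q) / (1 + q)) (x : Fin n → ℤ) :
    ContinuousOn (integrand q x) (torus n ρ) := by
  unfold integrand
  refine (continuousOn_ker hq hρ).mul (continuousOn_finsetProd _ fun i _ => ?_)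
  refine continuousOn_coord (f := fun z => xi q z ^ x i / z) (ContinuousOn.div
    ((continuousOn_xi hq hρ0 hρ).zpow₀ _ fun y hy => Or.inl (xi_ne_zero hq hρ0 hρ hy))
    continuousOn_id fun y hy => ne_zero_of_mem hq hq1 hρ (Metric.sphere_subset_closedBall hy)) i

/-- The time dependent integrand. -/
def timeIntegrand (q t : ℝ) (x : Fin n → ℤ) (y : Fin n → ℂ) : ℂ :=
  integrand q x y * Complex.exp ((∑ i, eig q (y i)) * (t : ℂ))

theorem continuousOn_timeIntegrand (hq : 0 < q) (hq1 : q < 1) (hρ0 : 0 < ρ)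
    (hρ : ρ < (1 - q) / (1 + q)) (t : ℝ) (x : Fin n → ℤ) :
    ContinuousOn (timeIntegrand q t x) (torus n ρ) := by
  refine (continuousOn_integrand hq hq1 hρ0 hρ x).mul (ContinuousOn.cexp (ContinuousOn.mul
    (continuousOn_finsetSum _ fun i _ => continuousOn_coord (continuousOn_eig hq hρ0 hρ) i)
    continuousOn_const))

theorem contourI_eq (q ρ t : ℝ) (x : Config n) :
    contourI q ρ t x = (q : ℂ) ^ (n * (n - 1) / 2) / (2 * (Real.pi : ℂ) * Complex.I) ^ n *
      torusI ρ (timeIntegrand q t x.1) := by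
  unfold contourI torusI
  congr 2
  funext y
  unfold timeIntegrand integrand ker
  rw [mul_assoc, Finset.sum_mul, Complex.exp_sum,
    ← Finset.prod_mul_distrib (f := fun i => xi q (y i) ^ x.1 i / y i)]
  refine congrArg _ (Finset.prod_congr rfl fun i _ => ?_)
  rw [xi, eig]
  ring

/-! ### Differentiation of the torus integral in time -/

theorem hasDerivAt_setIntegral_mul_exp {A E : (Fin n → ℝ) → ℂ} (hA : Continuous A)
    (hE : Continuous E) {K : Set (Fin n → ℝ)} (hK : IsCompact K) (t : ℝ) :
    HasDerivAt (fun t : ℝ => ∫ θ in K, A θ * Complex.exp (E θ * t))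
      (∫ θ in K, A θ * Complex.exp (E θ * t) * E θ) t := by
  refine (hasDerivAt_integral_of_dominated_loc_of_deriv_le (μ := volume.restrict K)
    (F := fun (t : ℝ) θ => A θ * Complex.exp (E θ * t))
    (F' := fun (t : ℝ) θ => A θ * Complex.exp (E θ * t) * E θ)
    (bound := fun θ => ‖A θ‖ * Real.exp (‖E θ‖ * (|t| + 1)) * ‖E θ‖) (s := Metric.ball t 1)
    (Metric.ball_mem_nhds t one_pos) (Eventually.of_forall fun u => ?_) ?_ ?_ ?_ ?_ ?_).2
  · exact Continuous.aestronglyMeasurable (by fun_prop)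
  · exact ContinuousOn.integrableOn_compact (f := fun θ => A θ * Complex.exp (E θ * t)) hK
      (Continuous.continuousOn (by fun_prop))
  · exact Continuous.aestronglyMeasurable (by fun_prop)
  · refine Eventually.of_forall fun θ u hu => ?_
    rw [norm_mul, norm_mul, Complex.norm_exp]
    gcongr
    refine (Complex.re_le_norm _).trans ?_
    rw [norm_mul, Complex.norm_real]
    gcongr
    rw [Metric.mem_ball, Real.dist_eq] at hu
    have := abs_sub_abs_le_abs_sub u t
    rw [Real.norm_eq_abs]
    linarith
  · exact ContinuousOn.integrableOn_compact
      (f := fun θ => ‖A θ‖ * Real.exp (‖E θ‖ * (|t| + 1)) * ‖E θ‖) hK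
      (Continuous.continuousOn (by fun_prop))
  · refine Eventually.of_forall fun θ u _ => ?_
    have h : HasDerivAt (fun u : ℝ => E θ * (u : ℂ)) (E θ) u := by
      simpa using (Complex.ofRealCLM.hasDerivAt (x := u)).const_mul (E θ)
    have := (h.cexp).const_mul (A θ)
    rw [← mul_assoc] at this
    exact this

theorem hasDerivAt_torusI_timeIntegrand (hq : 0 < q) (hq1 : q < 1) (hρ0 : 0 < ρ)
    (hρ : ρ < (1 - q) / (1 + q)) (t : ℝ) (x : Fin n → ℤ) :
    HasDerivAt (fun t : ℝ => torusI ρ (timeIntegrand q t x))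
      (torusI ρ fun y => timeIntegrand q t x y * ∑ i, eig q (y i)) t := by
  have hA : Continuous fun θ : Fin n → ℝ =>
      (∏ i, (ρ : ℂ) * Complex.exp (θ i * Complex.I) * Complex.I) *
        integrand q x (torusMap (fun _ => 1) (fun _ => ρ) θ) := by
    refine Continuous.mul (by fun_prop) ?_
    exact (continuousOn_integrand hq hq1 hρ0 hρ x).comp_continuous (continuous_torusMap _ _)
      (torusMap_mem hρ0.le)
  have hE : Continuous fun θ : Fin n → ℝ =>
      ∑ i, eig q (torusMap (fun _ => 1) (fun _ => ρ) θ i) :=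
    (continuousOn_finsetSum _ fun i _ => continuousOn_coord
      (continuousOn_eig hq hρ0 hρ) i).comp_continuous (continuous_torusMap _ _)
      (torusMap_mem hρ0.le)
  have := hasDerivAt_setIntegral_mul_exp hA hE
    (isCompact_Icc (a := (0 : Fin n → ℝ)) (b := fun _ => 2 * Real.pi)) t
  simpa only [torusI, torusIntegral, timeIntegrand, smul_eq_mul, mul_assoc] using this

/-! ### The generator and the boundary condition on the integrand -/

theorem timeIntegrand_update (t : ℝ) (x : Fin n → ℤ) (i : Fin n) (d : ℤ) {y : Fin n → ℂ}
    (hy : xi q (y i) ≠ 0) :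
    timeIntegrand q t (Function.update x i (x i + d)) y =
      timeIntegrand q t x y * xi q (y i) ^ d := by
  unfold timeIntegrand integrand
  rw [prod_update_eq (fun j z => xi q (y j) ^ z / y j), ← Finset.mul_prod_erase Finset.univ
    (fun j => xi q (y j) ^ x j / y j) (Finset.mem_univ i), zpow_add₀ hy]
  ring

theorem xi_eig (hy1 : ∀ y ∈ Metric.sphere (1 : ℂ) ρ, 1 - y ≠ 0 ∧ 1 - (q : ℂ) * y ≠ 0) {y : ℂ}
    (hy : y ∈ Metric.sphere (1 : ℂ) ρ) :
    (xi q y ^ (-1 : ℤ) - 1) + q * (xi q y ^ (1 : ℤ) - 1) = eig q y := by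
  obtain ⟨h1, h2⟩ := hy1 y hy
  have e : ∀ a b : ℂ, a ≠ 0 → b ≠ 0 → ((a / b)⁻¹ - 1) + q * (a / b - 1) =
      ((b - a) * b + q * ((a - b) * a)) / (a * b) := by
    intro a b ha hb
    field_simp
  rw [zpow_neg, zpow_one, xi, eig, e _ _ h1 h2]
  ring

/-- Two labels are allowed because both cases occur: `i = j` gives the one-particle free generator,
and neighbouring labels give the boundary combination. -/
theorem torusI_free (hq : 0 < q) (hq1 : q < 1) (hρ0 : 0 < ρ) (hρ : ρ < (1 - q) / (1 + q))
    (t : ℝ) (x : Fin n → ℤ) (i j : Fin n) :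
    (torusI ρ (timeIntegrand q t (Function.update x i (x i + -1))) - torusI ρ (timeIntegrand q t x))
      + q * (torusI ρ (timeIntegrand q t (Function.update x j (x j + 1)))
        - torusI ρ (timeIntegrand q t x)) =
    torusI ρ fun y => timeIntegrand q t x y *
      ((xi q (y i) ^ (-1 : ℤ) - 1) + q * (xi q (y j) ^ (1 : ℤ) - 1)) := by
  have hc := continuousOn_timeIntegrand (n := n) hq hq1 hρ0 hρ t
  rw [← torusI_sub hρ0.le (hc _) (hc _), ← torusI_sub hρ0.le (hc _) (hc _), ← torusI_const_mul]
  refine (torusI_add hρ0.le ((hc _).fun_sub (hc _))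
    (continuousOn_const.fun_mul ((hc _).fun_sub (hc _)))).symm.trans ?_
  refine torusI_congr hρ0.le fun y hy => ?_
  simp only [timeIntegrand_update t x _ _ (xi_ne_zero hq hρ0 hρ (hy _))]
  ring

/-- Pairs of labels in increasing order. -/
def incPairs (n : ℕ) : Finset (Fin n × Fin n) := Finset.univ.filter fun p => p.1 < p.2

theorem prod_Ioi_eq_prod_incPairs (f : Fin n → Fin n → ℂ) :
    ∏ i, ∏ j ∈ Finset.Ioi i, f i j = ∏ p ∈ incPairs n, f p.1 p.2 := by
  rw [incPairs, Finset.prod_filter, ← Finset.univ_product_univ, Finset.prod_product]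
  refine Finset.prod_congr rfl fun i _ => ?_
  rw [← Finset.prod_filter, Finset.filter_lt_eq_Ioi]

theorem ker_eq_mul {m : ℕ} (k : Fin m) (y : Fin (m + 1) → ℂ) :
    ker q y = (y k.castSucc - y k.succ) / (y k.castSucc - q * y k.succ) *
      ∏ p ∈ (incPairs (m + 1)).erase (k.castSucc, k.succ),
        (y p.1 - y p.2) / (y p.1 - q * y p.2) := by
  rw [ker, prod_Ioi_eq_prod_incPairs]
  exact (Finset.mul_prod_erase _ (fun p : Fin (m + 1) × Fin (m + 1) =>
    (y p.1 - y p.2) / (y p.1 - q * y p.2)) (a := (k.castSucc, k.succ))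
    (by simp [incPairs])).symm

/-- An adjacent transposition reverses the order of a single pair, so it permutes the other
increasing pairs. -/
theorem prod_incPairs_erase_swap {m : ℕ} (k : Fin m) (f : Fin (m + 1) → Fin (m + 1) → ℂ) :
    ∏ p ∈ (incPairs (m + 1)).erase (k.castSucc, k.succ),
      f (Equiv.swap k.castSucc k.succ p.1) (Equiv.swap k.castSucc k.succ p.2) =
    ∏ p ∈ (incPairs (m + 1)).erase (k.castSucc, k.succ), f p.1 p.2 := by
  set σ := Equiv.swap k.castSucc k.succ with hσ
  refine Finset.prod_equiv (Equiv.prodCongr σ σ) (fun p => ?_) fun p _ => rfl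
  obtain ⟨a, b⟩ := p
  simp only [incPairs, Finset.mem_erase, Finset.mem_filter, Finset.mem_univ, true_and, ne_eq,
    Prod.mk.injEq, Equiv.prodCongr_apply, Prod.map_apply, hσ, Equiv.swap_apply_def]
  split_ifs <;>
    simp only [Fin.ext_iff, Fin.lt_def, Fin.val_castSucc, Fin.val_succ] at * <;>
    first
    | omega
    | (simp only [true_and, not_true_eq_false, false_and, iff_false]; omega)

/-- The boundary factor contains `y_k - q y_{k+1}`, which cancels the corresponding denominator of
the kernel. The remaining integrand changes sign when the two variables are exchanged, so its
integral equals its own negative. -/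
theorem torusI_boundary {m : ℕ} (hq : 0 < q) (hρ0 : 0 < ρ) (hρ : ρ < (1 - q) / (1 + q))
    (t : ℝ) (x : Fin (m + 1) → ℤ) (k : Fin m) (hk : x k.succ = x k.castSucc - 1) :
    torusI ρ (fun y => timeIntegrand q t x y *
      ((xi q (y k.castSucc) ^ (-1 : ℤ) - 1) + q * (xi q (y k.succ) ^ (1 : ℤ) - 1))) = 0 := by
  have hne : k.succ ≠ k.castSucc := (Fin.castSucc_lt_succ (i := k)).ne'
  set σ := Equiv.swap k.castSucc k.succ with hσ
  have hσ1 : σ k.castSucc = k.succ := Equiv.swap_apply_left _ _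
  have hσ2 : σ k.succ = k.castSucc := Equiv.swap_apply_right _ _
  have hσ3 : ∀ j ∈ (Finset.univ.erase k.castSucc).erase k.succ, σ j = j := fun j hj => by
    simp only [Finset.mem_erase, Finset.mem_univ, and_true] at hj
    exact Equiv.swap_apply_of_ne_of_ne hj.2 hj.1
  set g : (Fin (m + 1) → ℂ) → ℂ := fun y => timeIntegrand q t x y *
      ((xi q (y k.castSucc) ^ (-1 : ℤ) - 1) + q * (xi q (y k.succ) ^ (1 : ℤ) - 1)) with hg
  -- The explicit antisymmetric form. Both powers of `ξ` have the exponent `x_k - 1`: one by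
  -- adjacency, the other through the factor `ξ⁻¹` of the boundary term.
  have hform : ∀ y ∈ torus (m + 1) ρ, g y =
      ((y k.castSucc - y k.succ) * (∏ p ∈ (incPairs (m + 1)).erase (k.castSucc, k.succ),
        (y p.1 - y p.2) / (y p.1 - q * y p.2))) *
      (((xi q (y k.castSucc) * xi q (y k.succ)) ^ (x k.castSucc - 1) *
        ((1 - q) / ((1 - q * y k.castSucc) * (1 - q * y k.succ))) /
          (y k.castSucc * y k.succ)) *
      (∏ j ∈ (Finset.univ.erase k.castSucc).erase k.succ, xi q (y j) ^ x j / y j)) *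
      Complex.exp ((∑ i, eig q (y i)) * (t : ℂ)) := by
    intro y hy
    have hc := hy k.castSucc
    have hs := hy k.succ
    have b1 := one_sub_mul_ne_zero hq hρ0.le hρ (Metric.sphere_subset_closedBall hc)
    have b2 := one_sub_mul_ne_zero hq hρ0.le hρ (Metric.sphere_subset_closedBall hs)
    have b3 := sub_mul_ne_zero hq hρ (Metric.sphere_subset_closedBall hc)
      (Metric.sphere_subset_closedBall hs)
    have b4 := xi_ne_zero hq hρ0 hρ hc
    have b5 : (xi q (y k.castSucc) ^ (-1 : ℤ) - 1) + q * (xi q (y k.succ) ^ (1 : ℤ) - 1) =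
        (xi q (y k.castSucc))⁻¹ * ((1 - q) * (y k.castSucc - q * y k.succ) /
          ((1 - q * y k.castSucc) * (1 - q * y k.succ))) := by
      rw [zpow_neg, zpow_one, zpow_one, eq_inv_mul_iff_mul_eq₀ b4, mul_add, mul_sub,
        mul_inv_cancel₀ b4]
      have e : ∀ a b a' b' : ℂ, b ≠ 0 → b' ≠ 0 → 1 - a / b * 1 + a / b * (q * (a' / b' - 1)) =
          (b * b' - a * b' + a * q * (a' - b')) / (b * b') := by
        intro a b a' b' hb hb'
        field_simp
      rw [xi, xi, e _ _ _ _ b1 b2]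
      ring
    simp only [hg]
    rw [b5, timeIntegrand, integrand, ker_eq_mul k y,
      ← Finset.mul_prod_erase Finset.univ (fun j => xi q (y j) ^ x j / y j)
        (Finset.mem_univ k.castSucc),
      ← Finset.mul_prod_erase (Finset.univ.erase k.castSucc) (fun j => xi q (y j) ^ x j / y j)
        (a := k.succ) (by simp [hne]), hk, mul_zpow, zpow_sub_one₀ b4]
    generalize ∏ j ∈ (Finset.univ.erase k.castSucc).erase k.succ, xi q (y j) ^ x j / y j = R
    generalize ∏ p ∈ (incPairs (m + 1)).erase (k.castSucc, k.succ),
        (y p.1 - y p.2) / (y p.1 - q * y p.2) = R'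
    generalize Complex.exp ((∑ i, eig q (y i)) * (t : ℂ)) = R''
    have b6 : y k.castSucc - y k.succ = (y k.castSucc - y k.succ) /
        (y k.castSucc - q * y k.succ) * (y k.castSucc - q * y k.succ) :=
      (div_mul_cancel₀ _ b3).symm
    generalize (y k.castSucc - y k.succ) / (y k.castSucc - q * y k.succ) = W at *
    rw [b6]
    ring
  have hanti : ∀ y ∈ torus (m + 1) ρ, g (y ∘ σ) = -1 * g y := by
    intro y hy
    rw [hform y hy, hform (y ∘ σ) fun i => hy (σ i)]
    simp only [Function.comp, hσ1, hσ2]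
    have h3 : ∏ j ∈ (Finset.univ.erase k.castSucc).erase k.succ, xi q (y (σ j)) ^ x j / y (σ j) =
        ∏ j ∈ (Finset.univ.erase k.castSucc).erase k.succ, xi q (y j) ^ x j / y j :=
      Finset.prod_congr rfl fun j hj => by rw [hσ3 j hj]
    rw [prod_incPairs_erase_swap k fun a b => (y a - y b) / (y a - q * y b), h3,
      Equiv.sum_comp σ fun i => eig q (y i)]
    rw [mul_comm (xi q (y k.succ)), mul_comm (1 - (q : ℂ) * y k.succ), mul_comm (y k.succ)]
    ring
  have h1 := torusI_comp_perm ρ σ g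
  rw [torusI_congr hρ0.le hanti, torusI_const_mul] at h1
  linear_combination (-1 / 2 : ℂ) * h1

theorem solvesASEP_contourI (hq : 0 < q) (hq1 : q < 1) (hρ0 : 0 < ρ)
    (hρ : ρ < (1 - q) / (1 + q)) (hn : 1 ≤ n) :
    SolvesASEP (n := n) 1 q (fun x => contourI q ρ 0 x) (fun t x => contourI q ρ t x) where
  init _ := rfl
  ode t _ x := by
    obtain ⟨m, rfl⟩ : ∃ m, n = m + 1 := ⟨n - 1, by omega⟩
    simp only [contourI_eq]
    set a := (q : ℂ) ^ ((m + 1) * (m + 1 - 1) / 2) / (2 * (Real.pi : ℂ) * Complex.I) ^ (m + 1)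
    have h := ((hasDerivAt_torusI_timeIntegrand hq hq1 hρ0 hρ t x.1).const_mul a).hasDerivWithinAt
      (s := Set.Ici 0)
    refine h.congr_deriv ?_
    have hfree := fun i j : Fin (m + 1) => torusI_free hq hq1 hρ0 hρ t x.1 i j
    refine Eq.trans ?_ (asepGen_eq_free 1 q
      (fun z => a * torusI ρ (timeIntegrand q t z)) x ?_).symm
    · have e : ∀ i, (1 : ℝ) • (a * torusI ρ (timeIntegrand q t (Function.update x.1 i (x.1 i + -1)))
          - a * torusI ρ (timeIntegrand q t x.1)) +
          q • (a * torusI ρ (timeIntegrand q t (Function.update x.1 i (x.1 i + 1)))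
          - a * torusI ρ (timeIntegrand q t x.1)) =
          a * torusI ρ (fun y => timeIntegrand q t x.1 y * eig q (y i)) := by
        intro i
        have e2 : torusI ρ (fun y => timeIntegrand q t x.1 y * eig q (y i)) =
            torusI ρ fun y => timeIntegrand q t x.1 y *
              ((xi q (y i) ^ (-1 : ℤ) - 1) + q * (xi q (y i) ^ (1 : ℤ) - 1)) :=
          torusI_congr hρ0.le fun y hy => by
            rw [xi_eig (fun z hz => ⟨one_sub_ne_zero hρ0 hz, one_sub_mul_ne_zero hq hρ0.le hρ
              (Metric.sphere_subset_closedBall hz)⟩) (hy i)]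
        rw [e2, ← hfree i i, one_smul, Complex.real_smul]
        ring
      simp only [e]
      rw [← Finset.mul_sum, ← torusI_sum hρ0.le]
      · simp only [Finset.mul_sum]
      · exact fun i _ => (continuousOn_timeIntegrand hq hq1 hρ0 hρ t x.1).mul
          (continuousOn_coord (continuousOn_eig hq hρ0 hρ) i)
    · intro k hk
      have := hfree k.castSucc k.succ
      rw [torusI_boundary hq hρ0 hρ t x.1 k hk] at this
      rw [one_smul, Complex.real_smul]
      linear_combination a * this

/-! ### Growth of the contour integral -/

/-- On the compact circle both `ξ` and `ξ⁻¹` are bounded, so the powers `ξ^x` grow at most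
exponentially in `|x|`. -/
theorem expGrowth_contourI (hq : 0 < q) (hq1 : q < 1) (hρ0 : 0 < ρ)
    (hρ : ρ < (1 - q) / (1 + q)) :
    ExpGrowth (fun t (x : Config n) => contourI q ρ t x) := by
  intro T
  have hS := isCompact_sphere (1 : ℂ) ρ
  have hTc : IsCompact (torus n ρ) := by
    have : torus n ρ = Set.univ.pi fun _ => Metric.sphere (1 : ℂ) ρ := by
      ext y; simp [torus]
    rw [this]
    exact isCompact_univ_pi fun _ => hS
  obtain ⟨K1, hK1⟩ := hTc.exists_bound_of_continuousOn
    (continuousOn_integrand (n := n) hq hq1 hρ0 hρ 0)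
  obtain ⟨K2, hK2⟩ := hTc.exists_bound_of_continuousOn (f := fun y : Fin n → ℂ => ∑ i, eig q (y i))
    (continuousOn_finsetSum _ fun i _ => continuousOn_coord (continuousOn_eig hq hρ0 hρ) i)
  obtain ⟨K3, hK3⟩ := hS.exists_bound_of_continuousOn (continuousOn_xi hq hρ0 hρ)
  obtain ⟨K4, hK4⟩ := hS.exists_bound_of_continuousOn ((continuousOn_xi hq hρ0 hρ).inv₀
    fun y hy => xi_ne_zero hq hρ0 hρ hy)
  -- Any `c` with `exp c` above both bounds would do; this one works because `exp c ≥ 1 + c`.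
  set c : ℝ := |K3| + |K4| with hc
  set a : ℂ := (q : ℂ) ^ (n * (n - 1) / 2) / (2 * (Real.pi : ℂ) * Complex.I) ^ n with ha
  have hxi : ∀ y ∈ Metric.sphere (1 : ℂ) ρ, ∀ z : ℤ, ‖xi q y ^ z‖ ≤ Real.exp (c * |(z : ℝ)|) := by
    intro y hy z
    have hK : |K3| ≤ Real.exp c ∧ |K4| ≤ Real.exp c := by
      have h1 := Real.add_one_le_exp c
      have h2 := abs_nonneg K3
      have h3 := abs_nonneg K4
      constructor <;> linarith
    have e1 : ‖xi q y‖ ≤ Real.exp c := (hK3 y hy).trans ((le_abs_self _).trans hK.1)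
    have e2 : ‖(xi q y)⁻¹‖ ≤ Real.exp c := (hK4 y hy).trans ((le_abs_self _).trans hK.2)
    rcases le_total 0 z with hz | hz
    · lift z to ℕ using hz
      rw [zpow_natCast, norm_pow, Int.cast_natCast, Nat.abs_cast, mul_comm, Real.exp_nat_mul]
      exact pow_le_pow_left₀ (norm_nonneg _) e1 _
    · obtain ⟨w, rfl⟩ : ∃ w : ℕ, z = -(w : ℤ) := ⟨(-z).toNat, by omega⟩
      rw [zpow_neg, ← inv_zpow, zpow_natCast, norm_pow, Int.cast_neg, Int.cast_natCast, abs_neg,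
        Nat.abs_cast, mul_comm, Real.exp_nat_mul]
      exact pow_le_pow_left₀ (norm_nonneg _) e2 _
  have hint : ∀ (x : Fin n → ℤ), ∀ y ∈ torus n ρ,
      ‖integrand q x y‖ ≤ |K1| * Real.exp (c * ∑ i, |(x i : ℝ)|) := by
    intro x y hy
    have e : integrand q x y = integrand q 0 y * ∏ i, xi q (y i) ^ x i := by
      unfold integrand
      rw [mul_assoc, ← Finset.prod_mul_distrib]
      congr 1
      refine Finset.prod_congr rfl fun i _ => ?_
      simp only [Pi.zero_apply, zpow_zero]
      ring
    rw [e, norm_mul]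
    refine mul_le_mul ((hK1 y hy).trans (le_abs_self _)) ?_ (norm_nonneg _) (abs_nonneg _)
    rw [norm_prod, Finset.mul_sum, Real.exp_sum]
    exact Finset.prod_le_prod (fun _ _ => norm_nonneg _) fun i _ => hxi _ (hy i) _
  refine ⟨‖a‖ * (((2 * Real.pi) ^ n * ∏ _i : Fin n, |ρ|) *
    (|K1| * Real.exp (|K2| * |T|))), c, by positivity, by positivity, fun t h0 h1 x => ?_⟩
  change ‖contourI q ρ t x‖ ≤ _
  rw [contourI_eq, norm_mul, mul_assoc ‖a‖]
  refine mul_le_mul_of_nonneg_left ?_ (norm_nonneg _)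
  rw [mul_assoc]
  refine norm_torusIntegral_le_of_norm_le_const fun θ => ?_
  have hy := torusMap_mem hρ0.le θ
  set y := torusMap (fun _ : Fin n => (1 : ℂ)) (fun _ => ρ) θ
  have e3 : ‖Complex.exp ((∑ i, eig q (y i)) * (t : ℂ))‖ ≤ Real.exp (|K2| * |T|) := by
    rw [Complex.norm_exp]
    refine Real.exp_le_exp.2 ((Complex.re_le_norm _).trans ?_)
    rw [norm_mul, Complex.norm_real, Real.norm_eq_abs]
    exact mul_le_mul ((hK2 y hy).trans (le_abs_self _))
      (by rw [abs_of_nonneg h0]; exact h1.trans (le_abs_self _)) (abs_nonneg _) (abs_nonneg _)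
  rw [timeIntegrand, norm_mul]
  calc _ ≤ (|K1| * Real.exp (c * ∑ i, |(x.1 i : ℝ)|)) * Real.exp (|K2| * |T|) :=
        mul_le_mul (hint x.1 y hy) e3 (norm_nonneg _) (by positivity)
    _ = _ := by ring

end Integrand

end DynASEP

end

noncomputable section

namespace DynASEP

/-! ### Partial fractions of the interaction kernel -/

/-- The increasing pairs containing `i` correspond to the labels other than `i`. -/
theorem prod_incPairs_eq_prod_erase {n : ℕ} (i : Fin n) (F : Fin n → ℂ) :
    ∏ p ∈ incPairs n, (if p.1 = i then F p.2 else if p.2 = i then F p.1 else 1) =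
      ∏ j ∈ Finset.univ.erase i, F j := by
  symm
  refine Finset.prod_of_injOn (fun j => if i < j then (i, j) else (j, i)) ?_ ?_ ?_ ?_
  · intro a _ b _ hab
    dsimp only at hab
    split_ifs at hab <;> simp_all
  · intro j hj
    have : j ≠ i := by simpa using hj
    dsimp only
    split_ifs with h
    · simpa [incPairs] using h
    · simpa [incPairs] using lt_of_le_of_ne (not_lt.1 h) this
  · rintro ⟨a, b⟩ hab hni
    have hlt : a < b := by simpa [incPairs] using hab
    dsimp only
    split_ifs with h1 h2
    · subst h1
      exact absurd ⟨b, by simpa using hlt.ne', by simp [hlt]⟩ hni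
    · subst h2
      exact absurd ⟨a, by simpa using hlt.ne, by simp [hlt.not_gt]⟩ hni
    · rfl
  · intro j hj
    have : j ≠ i := by simpa using hj
    split_ifs <;> simp_all

/-- The factors of the residue of the interaction kernel in the last variable. -/
def residueFactor {n : ℕ} (q : ℝ) (i : Fin n) (y : Fin n → ℂ) (p : Fin n × Fin n) : ℂ :=
  if p.1 = i then 1 else if p.2 = i then (q * y p.1 - y i) / (y p.1 - q * y i)
    else (y p.1 - y p.2) / (y p.1 - q * y p.2)

/-- The residue of the interaction kernel in the last variable, divided by a power of `q`. -/
def kerResidue {n : ℕ} (q : ℝ) (i : Fin n) (y : Fin n → ℂ) : ℂ :=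
  (1 - q) * y i * ∏ p ∈ incPairs n, residueFactor q i y p

section PartialFractions

variable {q : ℝ} {n : ℕ}

/-- The right side is the partial fraction coefficient, with denominators `y_i - y_j`. In
`kerResidue` these have been cancelled against the kernel, so it makes sense where coordinates
coincide, as they may on the torus. -/
theorem kerResidue_of_injective {y : Fin n → ℂ} (hy : Function.Injective y)
    (h : ∀ a b, y a - q * y b ≠ 0) (i : Fin n) :
    kerResidue q i y = ker q y * ((1 - q) * y i *
      ∏ j ∈ Finset.univ.erase i, (y i - q * y j) / (y i - y j)) := by
  rw [kerResidue, ker, prod_Ioi_eq_prod_incPairs (fun i j => (y i - y j) / (y i - q * y j)),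
    mul_left_comm, ← prod_incPairs_eq_prod_erase i (fun j => (y i - q * y j) / (y i - y j)),
    ← Finset.prod_mul_distrib]
  congr 1
  refine Finset.prod_congr rfl fun p hp => ?_
  obtain ⟨a, b⟩ := p
  have hab : a < b := by simpa [incPairs] using hp
  have h1 : y a - y b ≠ 0 := sub_ne_zero.2 (hy.ne hab.ne)
  have h2 : y b - y a ≠ 0 := sub_ne_zero.2 (hy.ne hab.ne')
  have h3 := h a b
  unfold residueFactor
  dsimp only
  split_ifs with c1 c2
  · subst c1
    rw [div_mul_div_comm, mul_comm, div_self (mul_ne_zero h3 h1)]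
  · subst c2
    rw [div_mul_div_comm, div_eq_div_iff h3 (mul_ne_zero h3 h2)]
    ring
  · rw [mul_one]

/-- Partial fractions in `z` by Lagrange interpolation: the difference of the monic polynomials with
roots `q y_i` and `y_i` has degree below `n`, is recovered from its values at the `y_i`, and is
evaluated at `q z`. -/
theorem prod_div_of_injective (hq : q ≠ 0) {y : Fin n → ℂ} (hy : Function.Injective y) {z : ℂ}
    (hz : ∀ i, y i - q * z ≠ 0) :
    ∏ i, (y i - z) / (y i - q * z) = ((q : ℂ) ^ n)⁻¹ * (1 + ∑ i, (1 - q) * y i *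
      (∏ j ∈ Finset.univ.erase i, (y i - q * y j) / (y i - y j)) / (q * z - y i)) := by
  have hq' : (q : ℂ) ≠ 0 := by exact_mod_cast hq
  have hz' : ∀ i, (q : ℂ) * z - y i ≠ 0 := fun i => by
    rw [← neg_sub]; exact neg_ne_zero.2 (hz i)
  set D : Polynomial ℂ := Lagrange.nodal Finset.univ (fun i => (q : ℂ) * y i) -
    Lagrange.nodal Finset.univ y with hD
  have hdeg : D.degree < (Finset.univ : Finset (Fin n)).card := by
    rw [← Lagrange.degree_nodal (R := ℂ) (v := fun i => (q : ℂ) * y i)]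
    refine Polynomial.degree_sub_lt_left (by rw [Lagrange.degree_nodal, Lagrange.degree_nodal])
      Lagrange.nodal_ne_zero ?_
    rw [Lagrange.nodal_monic.leadingCoeff, Lagrange.nodal_monic.leadingCoeff]
  have hev := congrArg (Polynomial.eval ((q : ℂ) * z))
    (Lagrange.eq_interpolate hy.injOn hdeg)
  rw [Lagrange.eval_interpolate_not_at_node _ fun i _ => sub_ne_zero.1 (hz' i), hD,
    Polynomial.eval_sub, Lagrange.eval_nodal, Lagrange.eval_nodal] at hev
  have hne : ∏ i, ((q : ℂ) * z - y i) ≠ 0 := Finset.prod_ne_zero_iff.2 fun i _ => hz' i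
  have hs : ∑ i, (1 - q) * y i *
      (∏ j ∈ Finset.univ.erase i, (y i - q * y j) / (y i - y j)) / (q * z - y i) =
      ∑ i, Lagrange.nodalWeight Finset.univ y i * ((q : ℂ) * z - y i)⁻¹ *
        Polynomial.eval (y i) D := by
    refine Finset.sum_congr rfl fun i hi => ?_
    rw [hD, Polynomial.eval_sub, Lagrange.eval_nodal_at_node hi, Lagrange.eval_nodal, sub_zero,
      ← Finset.mul_prod_erase _ _ hi, Lagrange.nodalWeight, Finset.prod_div_distrib,
      Finset.prod_inv_distrib]
    ring
  rw [hs, eq_inv_mul_iff_mul_eq₀ (pow_ne_zero _ hq')]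
  refine mul_left_cancel₀ hne ?_
  rw [mul_add, mul_one, ← hD] at *
  rw [← hev]
  have : (q : ℂ) ^ n = ∏ _i : Fin n, (q : ℂ) := by simp
  rw [this, ← Finset.prod_mul_distrib, ← Finset.prod_mul_distrib, add_sub_cancel]
  refine Finset.prod_congr rfl fun i _ => ?_
  rw [← mul_assoc, mul_div_assoc', div_eq_iff (hz i)]
  ring

/-- Nearby points with distinct coordinates. -/
theorem eventually_injective_add (y : Fin n → ℂ) :
    ∀ᶠ ε : ℂ in 𝓝[≠] 0, Function.Injective fun i => y i + ε * (i : ℕ) := by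
  have : ∀ᶠ ε : ℂ in 𝓝[≠] 0, ∀ i j : Fin n, i ≠ j → y i + ε * (i : ℕ) ≠ y j + ε * (j : ℕ) := by
    refine eventually_all.2 fun i => eventually_all.2 fun j => ?_
    by_cases hij : i = j
    · exact Eventually.of_forall fun _ h => absurd hij h
    by_cases hy : y i = y j
    · filter_upwards [self_mem_nhdsWithin] with ε hε _ h
      rw [hy] at h
      have := mul_left_cancel₀ hε (add_left_cancel h)
      exact hij (Fin.ext (by exact_mod_cast this))
    · refine nhdsWithin_le_nhds ?_
      have hc : Continuous fun ε : ℂ => (y i + ε * (i : ℕ)) - (y j + ε * (j : ℕ)) := by fun_prop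
      filter_upwards [hc.continuousAt.eventually_ne (x := 0) (y := 0)
        (by simpa [sub_eq_zero] using hy)] with ε hε _
      exact sub_ne_zero.1 hε
  filter_upwards [this] with ε hε i j h
  by_contra hij
  exact hε i j hij h

/-- For distinct coordinates this is `prod_div_of_injective`. The perturbation `y_i + ε i` separates
coinciding coordinates and both sides are continuous at `ε = 0`. -/
theorem ker_mul_prod (hq : q ≠ 0) {y : Fin n → ℂ} (h : ∀ a b, y a - q * y b ≠ 0) {z : ℂ}
    (hz : ∀ i, y i - q * z ≠ 0) :
    ker q y * ∏ i, (y i - z) / (y i - q * z) =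
      ((q : ℂ) ^ n)⁻¹ * (ker q y + ∑ i, kerResidue q i y / (q * z - y i)) := by
  set Y : ℂ → Fin n → ℂ := fun ε i => y i + ε * (i : ℕ) with hY
  have hY0 : Y 0 = y := by simp [hY]
  have hYc : ∀ i, ContinuousAt (fun ε => Y ε i) 0 := fun i => by
    simp only [hY]; fun_prop
  have hz' : ∀ i, (q : ℂ) * z - y i ≠ 0 := fun i => by
    rw [← neg_sub]; exact neg_ne_zero.2 (hz i)
  have hker : ContinuousAt (fun ε => ker q (Y ε)) 0 := by
    unfold ker
    refine tendsto_finsetProd _ fun i _ => tendsto_finsetProd _ fun j _ => ?_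
    exact ContinuousAt.div ((hYc i).sub (hYc j)) ((hYc i).sub (continuousAt_const.mul (hYc j)))
      (by rw [hY0]; exact h i j)
  have hres : ∀ i, ContinuousAt (fun ε => kerResidue q i (Y ε)) 0 := fun i => by
    unfold kerResidue
    refine ContinuousAt.mul (continuousAt_const.mul (hYc i)) (tendsto_finsetProd _ fun p _ => ?_)
    unfold residueFactor
    split_ifs
    · exact tendsto_const_nhds
    · exact ContinuousAt.div ((continuousAt_const.mul (hYc _)).sub (hYc i))
        ((hYc _).sub (continuousAt_const.mul (hYc i))) (by rw [hY0]; exact h _ _)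
    · exact ContinuousAt.div ((hYc _).sub (hYc _)) ((hYc _).sub (continuousAt_const.mul (hYc _)))
        (by rw [hY0]; exact h _ _)
  have hL : ContinuousAt (fun ε => ker q (Y ε) * ∏ i, (Y ε i - z) / (Y ε i - q * z)) 0 := by
    refine hker.mul (tendsto_finsetProd _ fun i _ => ?_)
    exact ContinuousAt.div ((hYc i).sub continuousAt_const) ((hYc i).sub continuousAt_const)
      (by rw [hY0]; exact hz i)
  have hR : ContinuousAt (fun ε => ((q : ℂ) ^ n)⁻¹ *
      (ker q (Y ε) + ∑ i, kerResidue q i (Y ε) / (q * z - Y ε i))) 0 := by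
    refine continuousAt_const.mul (hker.add (tendsto_finsetSum _ fun i _ => ?_))
    exact ContinuousAt.div (hres i) (continuousAt_const.sub (hYc i)) (by rw [hY0]; exact hz' i)
  have hev : ∀ᶠ ε in 𝓝[≠] (0 : ℂ), ker q (Y ε) * ∏ i, (Y ε i - z) / (Y ε i - q * z) =
      ((q : ℂ) ^ n)⁻¹ * (ker q (Y ε) + ∑ i, kerResidue q i (Y ε) / (q * z - Y ε i)) := by
    have e1 : ∀ᶠ ε in 𝓝[≠] (0 : ℂ), ∀ a b, Y ε a - q * Y ε b ≠ 0 := by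
      refine nhdsWithin_le_nhds (eventually_all.2 fun a => eventually_all.2 fun b => ?_)
      exact ((hYc a).sub (continuousAt_const.mul (hYc b))).eventually_ne
        (by change Y 0 a - q * Y 0 b ≠ 0; rw [hY0]; exact h a b)
    have e2 : ∀ᶠ ε in 𝓝[≠] (0 : ℂ), ∀ a, Y ε a - q * z ≠ 0 := by
      refine nhdsWithin_le_nhds (eventually_all.2 fun a => ?_)
      exact ((hYc a).sub continuousAt_const).eventually_ne
        (by change Y 0 a - q * z ≠ 0; rw [hY0]; exact hz a)
    filter_upwards [eventually_injective_add y, e1, e2] with ε hi h1 h2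
    rw [prod_div_of_injective hq (y := Y ε) hi h2, mul_left_comm, mul_add, mul_one, Finset.mul_sum]
    congr 2
    refine Finset.sum_congr rfl fun i _ => ?_
    rw [kerResidue_of_injective (y := Y ε) hi h1]
    ring
  have := tendsto_nhds_unique_of_eventuallyEq (hL.tendsto.mono_left nhdsWithin_le_nhds)
    (hR.tendsto.mono_left nhdsWithin_le_nhds) hev
  simpa only [hY0] using this

/-- The expansion at `z = 0`, where the product equals `1`. -/
theorem sum_kerResidue_div (hq : q ≠ 0) {y : Fin n → ℂ} (h : ∀ a b, y a - q * y b ≠ 0)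
    (hy : ∀ i, y i ≠ 0) :
    ∑ i, kerResidue q i y / y i = ker q y * (1 - (q : ℂ) ^ n) := by
  have hq' : (q : ℂ) ^ n ≠ 0 := pow_ne_zero _ (by exact_mod_cast hq)
  have := ker_mul_prod hq h (z := 0) (by simpa using hy)
  simp only [mul_zero, sub_zero, zero_sub, div_neg, Finset.sum_neg_distrib] at this
  rw [Finset.prod_congr rfl fun i _ => div_self (hy i), Finset.prod_const_one, mul_one,
    eq_inv_mul_iff_mul_eq₀ hq'] at this
  linear_combination this

end PartialFractions

end DynASEP

end

noncomputable section

namespace DynASEP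

/-! ### Integrating out one variable of a torus integral -/

theorem insertNth_mem_torus {n : ℕ} {ρ : ℝ} (i : Fin (n + 1)) {z : ℂ} {y : Fin n → ℂ}
    (hz : z ∈ Metric.sphere (1 : ℂ) ρ) (hy : y ∈ torus n ρ) :
    i.insertNth (α := fun _ => ℂ) z y ∈ torus (n + 1) ρ := by
  intro j
  refine Fin.succAboveCases i ?_ (fun k => ?_) j
  · simpa using hz
  · simpa using hy k

theorem torusI_succAbove {n : ℕ} {ρ : ℝ} (hρ : 0 ≤ ρ) {f : (Fin (n + 1) → ℂ) → ℂ}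
    (hf : ContinuousOn f (torus (n + 1) ρ)) (i : Fin (n + 1)) :
    torusI ρ f = torusI ρ fun y : Fin n → ℂ => ∮ z in C(1, ρ), f (i.insertNth z y) := by
  set e : ℝ × (Fin n → ℝ) ≃ᵐ (Fin (n + 1) → ℝ) :=
    (MeasurableEquiv.piFinSuccAbove (fun _ => ℝ) i).symm
  have hem : MeasurePreserving e :=
    (volume_preserving_piFinSuccAbove (fun _ : Fin (n + 1) => ℝ) i).symm _
  have heπ : (e ⁻¹' Set.Icc 0 fun _ => 2 * Real.pi) =
      Set.Icc 0 (2 * Real.pi) ×ˢ Set.Icc (0 : Fin n → ℝ) fun _ => 2 * Real.pi :=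
    ((Fin.insertNthOrderIso (fun _ => ℝ) i).preimage_Icc _ _).trans (Set.Icc_prod_eq _ _)
  have hint := (torusIntegrable_of_continuousOn hρ hf).function_integrable
  rw [← hem.integrableOn_comp_preimage e.measurableEmbedding, heπ, Measure.volume_eq_prod] at hint
  unfold torusI
  rw [torusIntegral, ← hem.map_eq, setIntegral_map_equiv, heπ, Measure.volume_eq_prod,
    ← setIntegral_prod_swap, setIntegral_prod, torusIntegral]
  · refine setIntegral_congr_fun measurableSet_Icc fun Θ _ => ?_
    simp only [circleIntegral_def_Icc, ← integral_smul, deriv_circleMap, circleMap_zero]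
    refine setIntegral_congr_fun measurableSet_Icc fun θ _ => ?_
    simp +unfoldPartialApp only [e, i.prod_univ_succAbove _, smul_smul, torusMap, Prod.swap]
    simp only [MeasurableEquiv.piFinSuccAbove_symm_apply, i.insertNth_apply_same,
      i.insertNth_apply_succAbove, Fin.insertNthEquiv, Equiv.coe_fn_mk]
    rw [mul_comm]
    congr 2
    simp only [funext_iff, i.forall_iff_succAbove, circleMap, Fin.insertNth_apply_same,
      Fin.insertNth_apply_succAbove, imp_true_iff, and_self_iff]
  · rw [IntegrableOn, ← Measure.prod_restrict] at hint ⊢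
    exact hint.swap

/-- A torus integral vanishes if the integrand extends holomorphically in one variable. -/
theorem torusI_eq_zero_of_differentiableOn {n : ℕ} {ρ : ℝ} (hρ : 0 ≤ ρ)
    {f h : (Fin (n + 1) → ℂ) → ℂ} (hf : ContinuousOn f (torus (n + 1) ρ)) (i : Fin (n + 1))
    (hfh : Set.EqOn f h (torus (n + 1) ρ))
    (hh : ∀ y ∈ torus n ρ, DifferentiableOn ℂ (fun z => h (i.insertNth z y))
      (Metric.closedBall 1 ρ)) : torusI ρ f = 0 := by
  -- The zero integrand is written as `0 * 0` so that its integral is evaluated by pulling out the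
  -- constant.
  rw [torusI_succAbove hρ hf i, torusI_congr hρ (g := fun _ => 0 * 0), torusI_const_mul, zero_mul]
  intro y hy
  dsimp only
  rw [mul_zero, circleIntegral.integral_congr hρ fun z hz => hfh (insertNth_mem_torus i hz hy)]
  exact Complex.circleIntegral_eq_zero_of_differentiable_on_off_countable hρ Set.countable_empty
    (hh y hy).continuousOn fun z hz => (hh y hy).differentiableAt
      (mem_of_superset (Metric.isOpen_ball.mem_nhds hz.1) Metric.ball_subset_closedBall)

/-! ### One-dimensional contour integrals -/

section OneDim

variable {q ρ : ℝ}

theorem circleIntegrable_const_mul {f : ℂ → ℂ} {c : ℂ} {R : ℝ} (a : ℂ)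
    (hf : CircleIntegrable f c R) : CircleIntegrable (fun z => a * f z) c R :=
  hf.const_smul (a := a)

/-- The reciprocal of `ξ`. -/
def kap (q : ℝ) (z : ℂ) : ℂ := (1 - (q : ℂ) * z) / (1 - z)

/-- The value of `kap q` at `w / q`. -/
def eta (q : ℝ) (w : ℂ) : ℂ := q * (1 - w) / (q - w)

theorem xi_zpow_neg (q : ℝ) (z : ℂ) (m : ℕ) : xi q z ^ (-(m : ℤ)) = kap q z ^ m := by
  rw [xi, kap, zpow_neg, zpow_natCast, ← inv_pow, inv_div]

theorem continuousOn_kap (hρ0 : 0 < ρ) : ContinuousOn (kap q) (Metric.sphere (1 : ℂ) ρ) := by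
  unfold kap
  exact ContinuousOn.div (by fun_prop) (by fun_prop) fun y hy => one_sub_ne_zero hρ0 hy

theorem hasDerivAt_kap_pow (m : ℕ) {z : ℂ} (hz : 1 - z ≠ 0) :
    HasDerivAt (fun z => kap q z ^ (m + 1) / (m + 1)) ((1 - q) * (kap q z ^ m / (1 - z) ^ 2)) z := by
  have h1 : HasDerivAt (kap q) ((1 - q) / (1 - z) ^ 2) z := by
    have := (((hasDerivAt_id z).const_mul (q : ℂ)).const_sub 1).div
      ((hasDerivAt_id z).const_sub 1) hz
    refine this.congr_deriv ?_
    simp only [id]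
    ring
  refine ((h1.pow (m + 1)).div_const ((m : ℂ) + 1)).congr_deriv ?_
  have : (m : ℂ) + 1 ≠ 0 := by exact_mod_cast m.succ_ne_zero
  simp only [Nat.cast_add, Nat.cast_one, Nat.add_sub_cancel]
  field_simp

variable (hq : 0 < q) (hq1 : q < 1) (hρ0 : 0 < ρ) (hρ : ρ < (1 - q) / (1 + q))

include hq hq1 hρ0 hρ

/-- Since `kap q z = 1 + (1 - q) z / (1 - z)`, raising the power by one adds a multiple of `kap^m /
(1 - z)^2`, which has a primitive. All values agree with that of `m = 0`, a simple pole. -/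
theorem circleIntegral_kap_pow_div_one_sub (m : ℕ) :
    (∮ z in C(1, ρ), kap q z ^ m / ((1 - z) * z)) = -(2 * Real.pi * Complex.I) := by
  have hz0 : ∀ z ∈ Metric.closedBall (1 : ℂ) ρ, z ≠ 0 := fun z => ne_zero_of_mem hq hq1 hρ
  have hsub := Metric.sphere_subset_closedBall (x := (1 : ℂ)) (ε := ρ)
  have h1z : ∀ z ∈ Metric.sphere (1 : ℂ) ρ, 1 - z ≠ 0 := fun z hz => one_sub_ne_zero hρ0 hz
  induction m with
  | zero =>
    have hd : DifferentiableOn ℂ (fun z : ℂ => z⁻¹) (Metric.closedBall 1 ρ) :=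
      differentiableOn_id.inv hz0
    have := hd.diffContOnCl_ball (subset_refl _) |>.circleIntegral_sub_inv_smul
      (Metric.mem_ball_self hρ0)
    rw [inv_one, smul_eq_mul, mul_one] at this
    rw [← this, neg_eq_neg_one_mul, ← circleIntegral.integral_const_mul]
    refine circleIntegral.integral_congr hρ0.le fun z hz => ?_
    have h2 : z - 1 ≠ 0 := by rw [← neg_sub]; exact neg_ne_zero.2 (h1z z hz)
    have h3 := hz0 z (hsub hz)
    have h4 := h1z z hz
    simp only [pow_zero, smul_eq_mul]
    rw [← neg_sub z 1]
    field_simp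
  | succ m ih =>
    have e : (∮ z in C(1, ρ), kap q z ^ (m + 1) / ((1 - z) * z)) =
        ∮ z in C(1, ρ), (kap q z ^ m / ((1 - z) * z) + (1 - q) * (kap q z ^ m / (1 - z) ^ 2)) := by
      refine circleIntegral.integral_congr hρ0.le fun z hz => ?_
      have h3 := hz0 z (hsub hz)
      have h4 := h1z z hz
      rw [pow_succ]
      nth_rewrite 2 [kap]
      field_simp
      ring
    rw [e, circleIntegral.integral_add, ih, circleIntegral.integral_eq_zero_of_hasDerivWithinAt
      hρ0.le fun z hz => (hasDerivAt_kap_pow m (h1z z hz)).hasDerivWithinAt, add_zero]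
    · exact ContinuousOn.circleIntegrable hρ0.le (((continuousOn_kap hρ0).pow m).div (by fun_prop)
        fun z hz => mul_ne_zero (h1z z hz) (hz0 z (hsub hz)))
    · exact ContinuousOn.circleIntegrable hρ0.le (continuousOn_const.mul
        (((continuousOn_kap hρ0).pow m).div (by fun_prop) fun z hz => pow_ne_zero _ (h1z z hz)))

theorem circleIntegrable_kap_pow_div (m : ℕ) :
    CircleIntegrable (fun z => kap q z ^ m / z) 1 ρ :=
  ContinuousOn.circleIntegrable hρ0.le (((continuousOn_kap hρ0).pow m).div (by fun_prop)
    fun _ hz => ne_zero_of_mem hq hq1 hρ (Metric.sphere_subset_closedBall hz))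

theorem circleIntegrable_kap_pow_div_one_sub (m : ℕ) :
    CircleIntegrable (fun z => kap q z ^ m / ((1 - z) * z)) 1 ρ :=
  ContinuousOn.circleIntegrable hρ0.le (((continuousOn_kap hρ0).pow m).div (by fun_prop)
    fun _ hz => mul_ne_zero (one_sub_ne_zero hρ0 hz)
      (ne_zero_of_mem hq hq1 hρ (Metric.sphere_subset_closedBall hz)))

theorem circleIntegrable_kap_pow_div_sub (m : ℕ) {w : ℂ} (hw : w ∈ Metric.sphere (1 : ℂ) ρ) :
    CircleIntegrable (fun z => kap q z ^ m / ((w - q * z) * z)) 1 ρ :=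
  ContinuousOn.circleIntegrable hρ0.le (((continuousOn_kap hρ0).pow m).div (by fun_prop)
    fun _ hz => mul_ne_zero (sub_mul_ne_zero hq hρ (Metric.sphere_subset_closedBall hw)
      (Metric.sphere_subset_closedBall hz))
      (ne_zero_of_mem hq hq1 hρ (Metric.sphere_subset_closedBall hz)))

/-- In terms of residues outside the circle, `1` comes from `z = 0` and `q^m` from infinity. The
recursion in `m` comes from `kap q z = q + (1 - q) / (1 - z)`. -/
theorem circleIntegral_kap_pow_div (m : ℕ) :
    (∮ z in C(1, ρ), kap q z ^ m / z) = 2 * Real.pi * Complex.I * ((q : ℂ) ^ m - 1) := by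
  have hz0 : ∀ z ∈ Metric.closedBall (1 : ℂ) ρ, z ≠ 0 := fun z => ne_zero_of_mem hq hq1 hρ
  induction m with
  | zero =>
    simp only [pow_zero, sub_self, mul_zero]
    have hd : DifferentiableOn ℂ (fun z : ℂ => 1 / z) (Metric.closedBall 1 ρ) :=
      (differentiableOn_const 1).fun_div differentiableOn_id hz0
    exact (hd.diffContOnCl_ball (subset_refl _)).circleIntegral_eq_zero hρ0.le
  | succ m ih =>
    have e : (∮ z in C(1, ρ), kap q z ^ (m + 1) / z) =
        ∮ z in C(1, ρ), (q * (kap q z ^ m / z) + (1 - q) * (kap q z ^ m / ((1 - z) * z))) := by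
      refine circleIntegral.integral_congr hρ0.le fun z hz => ?_
      have h3 := hz0 z (Metric.sphere_subset_closedBall hz)
      have h4 := one_sub_ne_zero hρ0 hz
      rw [pow_succ]
      nth_rewrite 2 [kap]
      field_simp
      ring
    rw [e, circleIntegral.integral_add, circleIntegral.integral_const_mul,
      circleIntegral.integral_const_mul, ih,
      circleIntegral_kap_pow_div_one_sub hq hq1 hρ0 hρ]
    · ring
    · exact circleIntegrable_const_mul _ (circleIntegrable_kap_pow_div hq hq1 hρ0 hρ m)
    · exact circleIntegrable_const_mul _ (circleIntegrable_kap_pow_div_one_sub hq hq1 hρ0 hρ m)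

/-- The outer poles are `0` and `w / q`, where `kap` takes the values `1` and `eta q w`; infinity
does not contribute. The recursion in `m` expands `kap` around its value at `w / q`. -/
theorem circleIntegral_kap_pow_div_sub (m : ℕ) {w : ℂ} (hw : w ∈ Metric.sphere (1 : ℂ) ρ) :
    (∮ z in C(1, ρ), kap q z ^ m / ((w - q * z) * z)) =
      2 * Real.pi * Complex.I * (eta q w ^ m - 1) / w := by
  have hw' := Metric.sphere_subset_closedBall hw
  have hz0 : ∀ z ∈ Metric.closedBall (1 : ℂ) ρ, z ≠ 0 := fun z => ne_zero_of_mem hq hq1 hρ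
  have hwz : ∀ z ∈ Metric.closedBall (1 : ℂ) ρ, w - q * z ≠ 0 :=
    fun z => sub_mul_ne_zero hq hρ hw'
  have hqw : (q : ℂ) - w ≠ 0 := by
    have := hwz 1 (Metric.mem_closedBall_self hρ0.le)
    rw [mul_one] at this
    rw [← neg_sub]
    exact neg_ne_zero.2 this
  have hw0 := hz0 w hw'
  induction m with
  | zero =>
    simp only [pow_zero, sub_self, mul_zero, zero_div]
    have hd : DifferentiableOn ℂ (fun z : ℂ => 1 / ((w - q * z) * z)) (Metric.closedBall 1 ρ) :=
      (differentiableOn_const 1).fun_div (by fun_prop) fun z hz => mul_ne_zero (hwz z hz) (hz0 z hz)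
    exact (hd.diffContOnCl_ball (subset_refl _)).circleIntegral_eq_zero hρ0.le
  | succ m ih =>
    have e : (∮ z in C(1, ρ), kap q z ^ (m + 1) / ((w - q * z) * z)) =
        ∮ z in C(1, ρ), (eta q w * (kap q z ^ m / ((w - q * z) * z)) +
          (-((1 - q) / (q - w))) * (kap q z ^ m / ((1 - z) * z))) := by
      refine circleIntegral.integral_congr hρ0.le fun z hz => ?_
      have h3 := hz0 z (Metric.sphere_subset_closedBall hz)
      have h4 := one_sub_ne_zero hρ0 hz
      have h5 := hwz z (Metric.sphere_subset_closedBall hz)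
      have h6 : kap q z = eta q w - (1 - q) / (q - w) * ((w - q * z) / (1 - z)) := by
        unfold kap eta
        field_simp
        ring
      rw [pow_succ]
      nth_rewrite 2 [h6]
      field_simp
      ring
    rw [e, circleIntegral.integral_add, circleIntegral.integral_const_mul,
      circleIntegral.integral_const_mul, ih,
      circleIntegral_kap_pow_div_one_sub hq hq1 hρ0 hρ, pow_succ]
    · have h7 : eta q w = 1 + w * (1 - q) / (q - w) := by
        unfold eta
        field_simp
        ring
      rw [h7]
      field_simp
      ring
    · exact circleIntegrable_const_mul _ (circleIntegrable_kap_pow_div_sub hq hq1 hρ0 hρ m hw)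
    · exact circleIntegrable_const_mul _ (circleIntegrable_kap_pow_div_one_sub hq hq1 hρ0 hρ m)

end OneDim

end DynASEP

end

noncomputable section

namespace DynASEP

/-! ### The contour integral at time zero -/

section TimeZero

variable {q ρ : ℝ} {n : ℕ}

theorem insertNth_mem_closedBall (i : Fin (n + 1)) {z : ℂ} {y : Fin n → ℂ}
    (hz : z ∈ Metric.closedBall (1 : ℂ) ρ) (hy : y ∈ torus n ρ) (j : Fin (n + 1)) :
    i.insertNth (α := fun _ => ℂ) z y j ∈ Metric.closedBall (1 : ℂ) ρ := by
  refine Fin.succAboveCases i ?_ (fun k => ?_) j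
  · simpa using hz
  · simpa using Metric.sphere_subset_closedBall (hy k)

theorem differentiableOn_insertNth (i j : Fin (n + 1)) (y : Fin n → ℂ) (s : Set ℂ) :
    DifferentiableOn ℂ (fun z => i.insertNth (α := fun _ => ℂ) z y j) s := by
  refine Fin.succAboveCases i ?_ (fun k => ?_) j
  · simpa using! differentiableOn_id
  · simp

theorem differentiableOn_comp_insertNth {i j : Fin (n + 1)} (hj : j ≠ i) (g : ℂ → ℂ)
    (y : Fin n → ℂ) (s : Set ℂ) :
    DifferentiableOn ℂ (fun z => g (i.insertNth (α := fun _ => ℂ) z y j)) s := by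
  obtain ⟨k, rfl⟩ := Fin.exists_succAbove_eq hj
  simp

theorem ker_insertNth_last (y : Fin n → ℂ) (z : ℂ) :
    ker q ((Fin.last n).insertNth (α := fun _ => ℂ) z y) =
      ker q y * ∏ i, (y i - z) / (y i - q * z) := by
  have e : ∀ {m : ℕ} (y : Fin m → ℂ), ker q y =
      ∏ i : Fin m, ∏ j : Fin m, if i < j then (y i - y j) / (y i - q * y j) else 1 := by
    intro m y
    refine Finset.prod_congr rfl fun i _ => ?_
    rw [← Finset.prod_filter, Finset.filter_lt_eq_Ioi]
  rw [e, e, Fin.prod_univ_castSucc, ← Finset.prod_mul_distrib]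
  have h1 : (∏ j : Fin (n + 1), if Fin.last n < j then
      ((Fin.last n).insertNth (α := fun _ => ℂ) z y (Fin.last n) -
        (Fin.last n).insertNth (α := fun _ => ℂ) z y j) /
      ((Fin.last n).insertNth (α := fun _ => ℂ) z y (Fin.last n) -
        q * (Fin.last n).insertNth (α := fun _ => ℂ) z y j) else 1) = 1 :=
    Finset.prod_eq_one fun j _ => if_neg (Fin.le_last j).not_gt
  rw [h1, mul_one]
  refine Finset.prod_congr rfl fun i _ => ?_
  rw [Fin.prod_univ_castSucc]
  simp [Fin.insertNth_last', Fin.castSucc_lt_last]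

/-- The one-particle factors of the time zero integrand for negative positions `-k i`. -/
def weight (q : ℝ) (k : Fin n → ℕ) (y : Fin n → ℂ) : ℂ := ∏ j, kap q (y j) ^ k j / y j

theorem integrand_neg (k : Fin n → ℕ) (y : Fin n → ℂ) :
    integrand q (fun i => -(k i : ℤ)) y = ker q y * weight q k y := by
  simp only [integrand, weight, xi_zpow_neg]

variable (hq : 0 < q) (hq1 : q < 1) (hρ0 : 0 < ρ) (hρ : ρ < (1 - q) / (1 + q))

include hq hq1 hρ0 hρ

theorem continuousOn_weight (k : Fin n → ℕ) : ContinuousOn (weight q k) (torus n ρ) := by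
  unfold weight
  refine continuousOn_finsetProd _ fun i _ => ?_
  exact continuousOn_coord (f := fun z => kap q z ^ k i / z) (((continuousOn_kap hρ0).pow _).div
    continuousOn_id fun y hy => ne_zero_of_mem hq hq1 hρ (Metric.sphere_subset_closedBall hy)) i

omit hq1 hρ0 in
theorem continuousOn_kerResidue (i : Fin n) : ContinuousOn (kerResidue q i) (torus n ρ) := by
  have hne : ∀ y ∈ torus n ρ, ∀ a b, y a - q * y b ≠ 0 := fun y hy a b => sub_mul_ne_zero hq hρ
    (Metric.sphere_subset_closedBall (hy a)) (Metric.sphere_subset_closedBall (hy b))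
  unfold kerResidue
  refine ContinuousOn.mul (by fun_prop) (continuousOn_finsetProd _ fun p _ => ?_)
  unfold residueFactor
  split_ifs
  · exact continuousOn_const
  · exact ContinuousOn.div (by fun_prop) (by fun_prop) fun y hy => hne y hy _ _
  · exact ContinuousOn.div (by fun_prop) (by fun_prop) fun y hy => hne y hy _ _

omit hq1 in
theorem sub_ne_zero_of_mem {w : ℂ} (hw : w ∈ Metric.closedBall (1 : ℂ) ρ) : (q : ℂ) - w ≠ 0 := by
  have := sub_mul_ne_zero hq hρ hw (Metric.mem_closedBall_self hρ0.le)
  rw [mul_one] at this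
  rw [← neg_sub]
  exact neg_ne_zero.2 this

theorem continuousOn_residue_term (k : Fin n → ℕ) (m : ℕ) (i : Fin n) :
    ContinuousOn (fun y => kerResidue q i y * weight q k y * (eta q (y i) ^ m / y i))
      (torus n ρ) := by
  refine ((continuousOn_kerResidue hq hρ i).mul
    (continuousOn_weight hq hq1 hρ0 hρ k)).mul ?_
  refine continuousOn_coord (f := fun z => eta q z ^ m / z) ((ContinuousOn.pow ?_ _).div
    continuousOn_id fun y hy => ne_zero_of_mem hq hq1 hρ (Metric.sphere_subset_closedBall hy)) i
  unfold eta
  exact ContinuousOn.div (by fun_prop) (by fun_prop) fun y hy =>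
    sub_ne_zero_of_mem hq hρ0 hρ (Metric.sphere_subset_closedBall hy)

omit hq1 hρ0 in
theorem differentiableOn_kerResidue (i : Fin (n + 1)) {y : Fin n → ℂ} (hy : y ∈ torus n ρ) :
    DifferentiableOn ℂ (fun z => kerResidue q i (i.insertNth z y)) (Metric.closedBall 1 ρ) := by
  have hne : ∀ z ∈ Metric.closedBall (1 : ℂ) ρ, ∀ a b,
      i.insertNth (α := fun _ => ℂ) z y a - q * i.insertNth (α := fun _ => ℂ) z y b ≠ 0 :=
    fun z hz a b => sub_mul_ne_zero hq hρ (insertNth_mem_closedBall i hz hy a)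
      (insertNth_mem_closedBall i hz hy b)
  have hd := fun j => differentiableOn_insertNth i j y (Metric.closedBall 1 ρ)
  unfold kerResidue
  refine DifferentiableOn.fun_mul ((hd i).const_mul _) (DifferentiableOn.fun_finsetProd
    fun p _ => ?_)
  unfold residueFactor
  split_ifs
  · exact differentiableOn_const _
  · exact (((hd _).const_mul _).fun_sub (hd _)).fun_div ((hd _).fun_sub ((hd _).const_mul _))
      fun z hz => hne z hz _ _
  · exact ((hd _).fun_sub (hd _)).fun_div ((hd _).fun_sub ((hd _).const_mul _))
      fun z hz => hne z hz _ _

omit hq1 hρ0 in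
theorem differentiableOn_ker (i : Fin (n + 1)) {y : Fin n → ℂ} (hy : y ∈ torus n ρ) :
    DifferentiableOn ℂ (fun z => ker q (i.insertNth z y)) (Metric.closedBall 1 ρ) := by
  have hd := fun j => differentiableOn_insertNth i j y (Metric.closedBall 1 ρ)
  unfold ker
  refine DifferentiableOn.fun_finsetProd fun a _ => DifferentiableOn.fun_finsetProd fun b _ => ?_
  exact ((hd _).fun_sub (hd _)).fun_div ((hd _).fun_sub ((hd _).const_mul _))
    fun z hz => sub_mul_ne_zero hq hρ (insertNth_mem_closedBall i hz hy a)
      (insertNth_mem_closedBall i hz hy b)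

/-- The factor `eta^m` has a zero of order `m` at `y_i = 1`, which absorbs the pole of order `k i`
of `kap`, as `k i ≤ m`. The integrand then extends holomorphically in `y_i` to the disc. The
ordering of the particles enters here. -/
theorem torusI_residue_term (k : Fin n → ℕ) (m : ℕ) (i : Fin n) (hk : k i ≤ m) :
    torusI ρ (fun y => kerResidue q i y * weight q k y * (eta q (y i) ^ m / y i)) = 0 := by
  cases n with
  | zero => exact i.elim0
  | succ n =>
  -- The factor of `y_i`, including `eta^m`, after the powers of `1 - w` have been cancelled.
  set R : ℂ → ℂ := fun w => (1 - q * w) ^ k i * (1 - w) ^ (m - k i) * q ^ m / (q - w) ^ m / w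
    with hR
  refine torusI_eq_zero_of_differentiableOn hρ0.le (continuousOn_residue_term hq hq1 hρ0 hρ k m i) i
    (h := fun y => kerResidue q i y *
      (∏ j, if j = i then R (y i) else kap q (y j) ^ k j / y j) / y i) ?_ ?_
  · intro y hy
    have h1 := one_sub_ne_zero hρ0 (hy i)
    have h2 := sub_ne_zero_of_mem hq hρ0 hρ (Metric.sphere_subset_closedBall (hy i))
    have h3 := ne_zero_of_mem hq hq1 hρ (Metric.sphere_subset_closedBall (hy i))
    dsimp only
    rw [weight, ← Finset.mul_prod_erase _ (fun j => kap q (y j) ^ k j / y j) (Finset.mem_univ i),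
      ← Finset.mul_prod_erase _ (fun j => if j = i then R (y i) else kap q (y j) ^ k j / y j)
        (Finset.mem_univ i), if_pos rfl]
    rw [Finset.prod_congr (g := fun j => kap q (y j) ^ k j / y j) rfl fun j hj =>
      if_neg (Finset.ne_of_mem_erase hj)]
    have : kap q (y i) ^ k i / y i * eta q (y i) ^ m = R (y i) := by
      simp only [hR, kap, eta, div_pow, mul_pow]
      rw [← Nat.add_sub_cancel' hk, pow_add (1 - y i)]
      simp only [Nat.add_sub_cancel_left]
      field_simp
    rw [← this]
    ring
  · intro y hy
    have hd := fun j => differentiableOn_insertNth i j y (Metric.closedBall 1 ρ)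
    have hyi : ∀ z ∈ Metric.closedBall (1 : ℂ) ρ, i.insertNth (α := fun _ => ℂ) z y i ≠ 0 :=
      fun z hz => ne_zero_of_mem hq hq1 hρ (insertNth_mem_closedBall i hz hy i)
    refine ((differentiableOn_kerResidue hq hρ i hy).fun_mul
      (DifferentiableOn.fun_finsetProd fun j _ => ?_)).fun_div (hd i) hyi
    split_ifs with hj
    · refine DifferentiableOn.fun_div (DifferentiableOn.fun_div ?_ ?_ fun z hz => ?_) (hd i) hyi
      · exact (((differentiableOn_const _).fun_sub ((hd i).const_mul _)).fun_pow _).fun_mul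
          (((differentiableOn_const _).fun_sub (hd i)).fun_pow _) |>.mul_const _
      · exact ((differentiableOn_const _).fun_sub (hd i)).fun_pow _
      · exact pow_ne_zero _ (sub_ne_zero_of_mem hq hρ0 hρ (insertNth_mem_closedBall i hz hy i))
    · exact differentiableOn_comp_insertNth hj (fun w => kap q w ^ k j / w) y _

/-- Partial fractions of the kernel in the last variable reduce the integral to the one-dimensional
ones. -/
theorem circleIntegral_integrand_last (k : Fin (n + 1) → ℕ) {y : Fin n → ℂ} (hy : y ∈ torus n ρ) :
    (∮ z in C(1, ρ), integrand q (fun i => -(k i : ℤ)) ((Fin.last n).insertNth z y)) =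
      2 * Real.pi * Complex.I * ((q : ℂ) ^ k (Fin.last n) * ((q : ℂ) ^ n)⁻¹ - 1) *
        (ker q y * weight q (k ∘ Fin.castSucc) y) -
      ∑ i, 2 * Real.pi * Complex.I * ((q : ℂ) ^ n)⁻¹ * (kerResidue q i y *
        weight q (k ∘ Fin.castSucc) y * (eta q (y i) ^ k (Fin.last n) / y i)) := by
  set m := k (Fin.last n) with hm
  set W := weight q (k ∘ Fin.castSucc) y with hW
  have hqn : (q : ℂ) ^ n ≠ 0 := pow_ne_zero _ (by exact_mod_cast hq.ne')
  have hyc := fun i => Metric.sphere_subset_closedBall (hy i)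
  have hne : ∀ a b, y a - q * y b ≠ 0 := fun a b => sub_mul_ne_zero hq hρ (hyc a) (hyc b)
  have e : (∮ z in C(1, ρ), integrand q (fun i => -(k i : ℤ)) ((Fin.last n).insertNth z y)) =
      ∮ z in C(1, ρ), (((q : ℂ) ^ n)⁻¹ * W * ker q y * (kap q z ^ m / z) +
        ∑ i, -(((q : ℂ) ^ n)⁻¹ * W * kerResidue q i y) *
          (kap q z ^ m / ((y i - q * z) * z))) := by
    refine circleIntegral.integral_congr hρ0.le fun z hz => ?_
    have hw : weight q k ((Fin.last n).insertNth z y) = W * (kap q z ^ m / z) := by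
      rw [weight, Fin.prod_univ_castSucc]
      simp [Fin.insertNth_last', hW, weight, hm]
    have hz' : ∀ i, y i - q * z ≠ 0 := fun i => sub_mul_ne_zero hq hρ (hyc i)
      (Metric.sphere_subset_closedBall hz)
    rw [integrand_neg, hw, ker_insertNth_last, ker_mul_prod hq.ne' hne hz', mul_add, add_mul,
      Finset.mul_sum, Finset.sum_mul]
    congr 1
    · ring
    · refine Finset.sum_congr rfl fun i _ => ?_
      have h1 := hz' i
      rw [← neg_sub (y i), div_neg, mul_comm (y i - q * z) z, ← div_div]
      ring
  -- The `-1` in each `eta^m - 1` contributes `kerResidue / y_i`. These sum to a multiple of the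
  -- kernel and change the scalar `q^{-n} (q^m - 1)` into `q^m q^{-n} - 1`.
  have hs := sum_kerResidue_div hq.ne' hne fun i => ne_zero_of_mem hq hq1 hρ (hyc i)
  rw [e, circleIntegral.integral_add, circleIntegral.integral_const_mul,
    circleIntegral_kap_pow_div hq hq1 hρ0 hρ, circleIntegral.integral_fun_sum]
  · simp only [circleIntegral.integral_const_mul]
    rw [Finset.sum_congr rfl fun i _ => by
      rw [circleIntegral_kap_pow_div_sub hq hq1 hρ0 hρ m (hy i)]]
    have h2 : ∀ i, -(((q : ℂ) ^ n)⁻¹ * W * kerResidue q i y) *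
        (2 * Real.pi * Complex.I * (eta q (y i) ^ m - 1) / y i) =
        2 * Real.pi * Complex.I * ((q : ℂ) ^ n)⁻¹ * W * (kerResidue q i y / y i) -
        2 * Real.pi * Complex.I * ((q : ℂ) ^ n)⁻¹ * (kerResidue q i y * W *
          (eta q (y i) ^ m / y i)) := fun i => by ring
    rw [Finset.sum_congr rfl fun i _ => h2 i, Finset.sum_sub_distrib, ← Finset.mul_sum, hs]
    field_simp
    ring
  · exact fun i _ => circleIntegrable_const_mul _
      (circleIntegrable_kap_pow_div_sub hq hq1 hρ0 hρ m (hy i))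
  · exact circleIntegrable_const_mul _ (circleIntegrable_kap_pow_div hq hq1 hρ0 hρ m)
  · exact CircleIntegrable.fun_sum _ fun i _ => circleIntegrable_const_mul _
      (circleIntegrable_kap_pow_div_sub hq hq1 hρ0 hρ m (hy i))

theorem torusI_integrand_succ (k : Fin (n + 1) → ℕ) (hk : ∀ i, k i ≤ k (Fin.last n)) :
    torusI ρ (integrand q fun i => -(k i : ℤ)) =
      2 * Real.pi * Complex.I * ((q : ℂ) ^ k (Fin.last n) * ((q : ℂ) ^ n)⁻¹ - 1) *
        torusI ρ (integrand q fun i : Fin n => -(k i.castSucc : ℤ)) := by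
  have hc : ContinuousOn (fun y => ker q y * weight q (k ∘ Fin.castSucc) y) (torus n ρ) :=
    (continuousOn_ker hq hρ).mul (continuousOn_weight hq hq1 hρ0 hρ _)
  have hr := continuousOn_residue_term hq hq1 hρ0 hρ (k ∘ Fin.castSucc) (k (Fin.last n))
  rw [torusI_succAbove hρ0.le (continuousOn_integrand hq hq1 hρ0 hρ _) (Fin.last n),
    torusI_congr hρ0.le fun y hy => circleIntegral_integrand_last hq hq1 hρ0 hρ k hy,
    torusI_sub hρ0.le (continuousOn_const.fun_mul hc)
      (continuousOn_finsetSum _ fun i _ => continuousOn_const.fun_mul (hr i)),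
    torusI_sum hρ0.le _ fun i _ => continuousOn_const.fun_mul (hr i), torusI_const_mul]
  simp only [torusI_const_mul]
  rw [Finset.sum_eq_zero fun i _ => by
    rw [torusI_residue_term hq hq1 hρ0 hρ _ _ i (hk i.castSucc), mul_zero], sub_zero]
  congr 2
  funext y
  exact (integrand_neg (k ∘ Fin.castSucc) y).symm

theorem torusI_integrand_neg (k : Fin n → ℕ) (hk : Monotone k) :
    torusI ρ (integrand q fun i => -(k i : ℤ)) =
      (2 * Real.pi * Complex.I) ^ n * ∏ i, ((q : ℂ) ^ k i * ((q : ℂ) ^ (i : ℕ))⁻¹ - 1) := by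
  induction n with
  | zero => simp [torusI, integrand, ker]
  | succ n ih =>
    rw [torusI_integrand_succ hq hq1 hρ0 hρ k fun i => hk (Fin.le_last i),
      ih (fun i => k i.castSucc) fun i j h => hk (by simpa using h), Fin.prod_univ_castSucc]
    simp only [Fin.val_castSucc, Fin.val_last]
    ring

/-- For a nonnegative exponent `ξ^{x_1}` has no pole at `1`, so the integrand is holomorphic in the
first variable. -/
theorem torusI_integrand_eq_zero (x : Fin (n + 1) → ℤ) (hx : 0 ≤ x 0) :
    torusI ρ (integrand q x) = 0 := by
  refine torusI_eq_zero_of_differentiableOn hρ0.le (continuousOn_integrand hq hq1 hρ0 hρ x) 0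
    (fun _ _ => rfl) fun y hy => ?_
  have hd := fun j => differentiableOn_insertNth 0 j y (Metric.closedBall 1 ρ)
  unfold integrand
  refine (differentiableOn_ker hq hρ 0 hy).fun_mul
    (DifferentiableOn.fun_finsetProd fun j _ => ?_)
  by_cases hj : j = 0
  · subst hj
    obtain ⟨m, hm⟩ := Int.eq_ofNat_of_zero_le hx
    simp only [hm, zpow_natCast]
    unfold xi
    have hmem := fun z hz => insertNth_mem_closedBall (0 : Fin (n + 1)) (z := z) hz hy 0
    exact ((((differentiableOn_const _).fun_sub (hd 0)).fun_div
      ((differentiableOn_const _).fun_sub ((hd 0).const_mul _)) fun z hz =>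
        one_sub_mul_ne_zero hq hρ0.le hρ (hmem z hz)).fun_pow m).fun_div (hd 0)
        fun z hz => ne_zero_of_mem hq hq1 hρ (hmem z hz)
  · exact differentiableOn_comp_insertNth hj (fun w => xi q w ^ x j / w) y _

theorem contourI_zero (x : Config n) : contourI q ρ 0 x = ((stepInit q x : ℝ) : ℂ) := by
  have hq' : (q : ℂ) ≠ 0 := by exact_mod_cast hq.ne'
  have ht : (timeIntegrand q 0 x.1 : (Fin n → ℂ) → ℂ) = integrand q x.1 := by
    funext y
    simp [timeIntegrand]
  rw [contourI_eq, ht]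
  by_cases hx : ∀ i, x.1 i ≤ 0
  · have hk : ∀ i, x.1 i = -((x.1 i).natAbs : ℤ) := fun i => by have := hx i; omega
    have hmono : Monotone fun i => (x.1 i).natAbs := by
      intro i j hij
      rcases hij.eq_or_lt with rfl | hij
      · exact le_rfl
      · have := x.2 hij
        have := hx i
        dsimp only
        omega
    have := torusI_integrand_neg hq hq1 hρ0 hρ (fun i => (x.1 i).natAbs) hmono
    simp only [← hk] at this
    rw [show (fun i => x.1 i) = x.1 from rfl] at this
    rw [this]
    have h2 : (2 * (Real.pi : ℂ) * Complex.I) ^ n ≠ 0 := pow_ne_zero _ Complex.two_pi_I_ne_zero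
    rw [← mul_assoc, div_mul_cancel₀ _ h2]
    -- The prefactor supplies one `q^i` for each variable and turns `q^{k_i} q^{-i} - 1` into
    -- `q^{k_i} - q^i`.
    have h3 : (q : ℂ) ^ (n * (n - 1) / 2) = ∏ i : Fin n, (q : ℂ) ^ (i : ℕ) := by
      rw [Finset.prod_pow_eq_pow_sum, Fin.sum_univ_eq_sum_range (fun i => i), Finset.sum_range_id]
    rw [h3, ← Finset.prod_mul_distrib, stepInit, Complex.ofReal_prod]
    refine Finset.prod_congr rfl fun i _ => ?_
    rw [if_pos (hx i), show -x.1 i = ((x.1 i).natAbs : ℤ) by have := hx i; omega, zpow_natCast]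
    have h4 : (q : ℂ) ^ (i : ℕ) ≠ 0 := pow_ne_zero _ hq'
    push_cast
    field_simp
  · push Not at hx
    obtain ⟨j, hj⟩ := hx
    cases n with
    | zero => exact j.elim0
    | succ n =>
    have h0 : 0 < x.1 0 := by
      rcases (Fin.zero_le j).eq_or_lt with h | h
      · rwa [← h] at hj
      · exact hj.trans (x.2 h)
    rw [torusI_integrand_eq_zero hq hq1 hρ0 hρ x.1 h0.le, mul_zero, stepInit,
      Finset.prod_eq_zero (Finset.mem_univ 0), Complex.ofReal_zero]
    simp [h0.not_ge]

end TimeZero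

end DynASEP

end

noncomputable section

namespace DynASEP

/-! ### The expectations solve the system -/

section Expectations

variable {Ω : Type*} [mΩ : MeasurableSpace Ω] {q α : ℝ} {P : Measure Ω} [IsProbabilityMeasure P]
  {ℱ : Filtration ℝ≥0 (inferInstance : MeasurableSpace Ω)} {s : ℝ≥0 → Ω → Height} {n : ℕ}

omit [IsProbabilityMeasure P] in
theorem IsStepData.abs_le {S : Ω → Height} (hS : IsStepData P S) :
    ∀ᵐ ω ∂P, |((S ω).1 0 : ℝ)| ≤ 0 := by
  filter_upwards [hS] with ω hω
  simp [hω 0]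

omit [IsProbabilityMeasure P] in
theorem IsHalfStationaryData.abs_cast_le {S : Ω → Height} (hS : IsHalfStationaryData q α P S) :
    ∀ᵐ ω ∂P, |((S ω).1 0 : ℝ)| ≤ 2 := by
  filter_upwards [hS.abs_le] with ω hω
  exact_mod_cast hω

theorem IsStepData.solvesASEP_stepE (hn : 1 ≤ n) (hq : 0 < q) (hq1 : q < 1) (hα : 0 < α)
    (hs : IsDynamicASEP q α P ℱ s) (hS : IsStepData P (s 0)) :
    SolvesASEP (n := n) 1 q (stepInit q) (stepE q α P s) :=
  ⟨stepE_zero hn hq hα hS,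
    (hs.solvesASEP n hq hq1 hα hS.abs_le (qPoch (-α⁻¹) q n)⁻¹).ode⟩

theorem IsStepData.expGrowth_stepE (n : ℕ) (hq : 0 < q) (hq1 : q < 1) (hα : 0 < α)
    (hs : IsDynamicASEP q α P ℱ s) (hS : IsStepData P (s 0)) :
    ExpGrowth (n := n) (stepE q α P s) :=
  hs.expGrowth n hq hq1 hα hS.abs_le (qPoch (-α⁻¹) q n)⁻¹

theorem IsHalfStationaryData.solvesASEP_halfE (hn : 1 ≤ n) (hq : 0 < q) (hq1 : q < 1)
    (hα : 0 < α) (hs : IsDynamicASEP q α P ℱ s) (hS : IsHalfStationaryData q α P (s 0)) :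
    SolvesASEP (n := n) 1 q (halfInit q) (halfE q α P s) :=
  ⟨halfE_zero hn hq hq1 hα (hs.measurable_eval 0) hS,
    (hs.solvesASEP n hq hq1 hα hS.abs_cast_le (α ^ n / q ^ (n * (n - 1) / 2))).ode⟩

theorem IsHalfStationaryData.expGrowth_halfE (n : ℕ) (hq : 0 < q) (hq1 : q < 1)
    (hα : 0 < α) (hs : IsDynamicASEP q α P ℱ s) (hS : IsHalfStationaryData q α P (s 0)) :
    ExpGrowth (n := n) (halfE q α P s) :=
  hs.expGrowth n hq hq1 hα hS.abs_cast_le (α ^ n / q ^ (n * (n - 1) / 2))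

theorem solvesASEP_contourI_stepInit {ρ : ℝ} (hn : 1 ≤ n) (hq : 0 < q) (hq1 : q < 1) (hρ0 : 0 < ρ)
    (hρ : ρ < (1 - q) / (1 + q)) :
    SolvesASEP (n := n) 1 q (fun x => ((stepInit q x : ℝ) : ℂ)) (fun t x => contourI q ρ t x) :=
  ⟨contourI_zero hq hq1 hρ0 hρ, (solvesASEP_contourI hq hq1 hρ0 hρ hn).ode⟩

end Expectations

end DynASEP

end

/-- The radius bound `ρ < (1 - q) / (1 + q)` makes "small" precise: the closed disc `D` of radius `ρ`
around `1` then contains neither `0` nor `1 / q` and is disjoint from `q D`. -/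
theorem corollary2p3 (n : ℕ) (hn : 1 ≤ n) (q α : ℝ) (hq0 : 0 < q) (hq1 : q < 1) (hα : 0 < α) :
    -- the contour integral solves the system with the step initial values
    (∀ ρ : ℝ, 0 < ρ → ρ < (1 - q) / (1 + q) →
      DynASEP.SolvesASEP (n := n) 1 q (fun x => ((DynASEP.stepInit q x : ℝ) : ℂ))
        (fun t x => DynASEP.contourI q ρ t x)) ∧
    -- step initial data
    (∀ (Ω : Type*) [MeasurableSpace Ω] (P : Measure Ω) [IsProbabilityMeasure P]
      (ℱ : Filtration ℝ≥0 (inferInstance : MeasurableSpace Ω)) (s : ℝ≥0 → Ω → DynASEP.Height),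
      DynASEP.IsDynamicASEP q α P ℱ s → DynASEP.IsStepData P (s 0) →
        (∀ (t : ℝ≥0) (x : DynASEP.Config n),
          Integrable (fun ω => DynASEP.dualityZ q α x (s t ω)) P) ∧
        DynASEP.SolvesASEP (n := n) 1 q (DynASEP.stepInit q) (DynASEP.stepE q α P s) ∧
        (∀ ρ : ℝ, 0 < ρ → ρ < (1 - q) / (1 + q) →
          ∀ (t : ℝ) (x : DynASEP.Config n), 0 ≤ t →
            ((DynASEP.stepE q α P s t x : ℝ) : ℂ) = DynASEP.contourI q ρ t x)) ∧
    -- half-stationary initial data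
    (∀ (Ω : Type*) [MeasurableSpace Ω] (P : Measure Ω) [IsProbabilityMeasure P]
      (ℱ : Filtration ℝ≥0 (inferInstance : MeasurableSpace Ω)) (s : ℝ≥0 → Ω → DynASEP.Height),
      DynASEP.IsDynamicASEP q α P ℱ s → DynASEP.IsHalfStationaryData q α P (s 0) →
        (∀ (t : ℝ≥0) (x : DynASEP.Config n),
          Integrable (fun ω => DynASEP.dualityZ q α x (s t ω)) P) ∧
        DynASEP.SolvesASEP (n := n) 1 q (DynASEP.halfInit q) (DynASEP.halfE q α P s)) ∧
    -- comparison of the two initial data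
    (∀ x : DynASEP.Config n, DynASEP.halfInit q x = DynASEP.stepInit q x.shift) ∧
    (∀ (Ω : Type*) [MeasurableSpace Ω] (P : Measure Ω) [IsProbabilityMeasure P]
      (ℱ : Filtration ℝ≥0 (inferInstance : MeasurableSpace Ω)) (s : ℝ≥0 → Ω → DynASEP.Height)
      (Ω' : Type*) [MeasurableSpace Ω'] (P' : Measure Ω') [IsProbabilityMeasure P']
      (ℱ' : Filtration ℝ≥0 (inferInstance : MeasurableSpace Ω'))
      (s' : ℝ≥0 → Ω' → DynASEP.Height),
      DynASEP.IsDynamicASEP q α P ℱ s → DynASEP.IsStepData P (s 0) →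
      DynASEP.IsDynamicASEP q α P' ℱ' s' → DynASEP.IsHalfStationaryData q α P' (s' 0) →
        ∀ (t : ℝ) (x : DynASEP.Config n), 0 ≤ t →
          DynASEP.halfE q α P' s' t x = DynASEP.stepE q α P s t x.shift) := by
  refine ⟨fun ρ hρ0 hρ => DynASEP.solvesASEP_contourI_stepInit hn hq0 hq1 hρ0 hρ, ?_, ?_,
    DynASEP.halfInit_eq q, ?_⟩
  · intro Ω _ P _ ℱ s hs hS
    have hsol := DynASEP.IsStepData.solvesASEP_stepE hn hq0 hq1 hα hs hS
    refine ⟨fun t x => hs.integrable_of_expLocal hq0 hq1 hα hS.abs_le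
      (DynASEP.expLocal_dualityZ hq0 hq1 hα x) t, hsol, fun ρ hρ0 hρ t x ht => ?_⟩
    -- Both sides solve the complex system with the same initial values and have at most exponential
    -- growth.
    exact hsol.ofReal.unique (DynASEP.solvesASEP_contourI_stepInit hn hq0 hq1 hρ0 hρ)
      (DynASEP.IsStepData.expGrowth_stepE n hq0 hq1 hα hs hS).ofReal
      (DynASEP.expGrowth_contourI hq0 hq1 hρ0 hρ) ht x
  · intro Ω _ P _ ℱ s hs hS
    exact ⟨fun t x => hs.integrable_of_expLocal hq0 hq1 hα hS.abs_cast_le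
      (DynASEP.expLocal_dualityZ hq0 hq1 hα x) t,
      DynASEP.IsHalfStationaryData.solvesASEP_halfE hn hq0 hq1 hα hs hS⟩
  · intro Ω _ P _ ℱ s Ω' _ P' _ ℱ' s' hs hS hs' hS' t x ht
    have hstep := (DynASEP.IsStepData.solvesASEP_stepE hn hq0 hq1 hα hs hS).shift
    -- The generator is translation invariant, so the shifted step solution is again a solution, now
    -- with the half-stationary initial values.
    rw [← funext (DynASEP.halfInit_eq (n := n) q)] at hstep
    exact (DynASEP.IsHalfStationaryData.solvesASEP_halfE hn hq0 hq1 hα hs' hS').unique hstep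
      (DynASEP.IsHalfStationaryData.expGrowth_halfE n hq0 hq1 hα hs' hS')
      (DynASEP.IsStepData.expGrowth_stepE n hq0 hq1 hα hs hS).shift ht x
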